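/- Let $(X,\mathcal B,m)$ be a probability space and let $T:X\to X$ be an ergodic endomorphism of it, i.e. a measurable, $m$-preserving, ergodic map (not necessarily invertible). For a sub-$\sigma$-algebra $\mathcal F\subset\mathcal B$ and $n\ge 0$, write $T^{-n}\mathcal F=\{T^{-n}A : A\in\mathcal F\}$ and $T^{n}\mathcal F=\{A\in\mathcal B : T^{-n}A\in\mathcal F\}$ (when $T$ is invertible and bimeasurable, the latter is $\{T^nA : A\in\mathcal F\}$). Suppose that $\mathcal F\subset T\mathcal F$. Let $f:X\to\mathbb R$ be square-integrable with $\int f\,dm=0$ and $$\sum_{n\ge 0}\bigl\| \mathbb E(f\mid T^n\mathcal F)-f\bigr\|_{L^2}<\infty \quad\text{and}\quad \sum_{n\ge 0}\bigl\| \mathbb E(f\mid T^{-n}\mathcal F)\bigr\|_{L^2}<\infty .$$ Write $S_nf=\sum_{k=0}^{n-1} f\circ T^k$. Then there exists $\sigma^2\ge 0$ such that both of the following hold (where $\mathcal N(0,0)$ is the Dirac mass at $0$). (1) $S_nf/\sqrt n$ converges with tight maxima to $\mathcal N(0,\sigma^2)$. That is, $S_nf/\sqrt n$ converges in law to $\mathcal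 N(0,\sigma^2)$ and, for every $\epsilon>0$, there is $c>0$ such that for all $n\ge 1$ $$ m\Bigl\{x : \max_{1\le k\le n}|S_kf(x)|/\sqrt n>c\Bigr\}\le\epsilon .$$ (2) $S_nf/\sqrt n$ satisfies an almost sure central limit theorem towards $\mathcal N(0,\sigma^2)$. That is, for $m$-almost every $x$, the measures $$\frac1{\log N}\sum_{k=1}^N\frac1k\,\delta_{S_kf(x)/\sqrt k}$$ on $\mathbb R$ converge weakly to $\mathcal N(0,\sigma^2)$ as $N\to\infty$. -/

import Mathlib

open MeasureTheory ProbabilityTheory Filter Topology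

noncomputable section

/-- The `σ`-algebra `S 𝓕`: the measurable sets `A` (measurable for the ambient `σ`-algebra `mX`)
such that `S⁻¹ A` belongs to `𝓕`. When `S` is an invertible bimeasurable map and `𝓕 ≤ mX`, these
are exactly the images `S(A')` of the sets `A' ∈ 𝓕`. -/
abbrev imageSigmaAlgebra {X : Type*} (mX : MeasurableSpace X) (S : X → X) (F : MeasurableSpace X) :
    MeasurableSpace X :=
  F.map S ⊓ mX

/-- `S n / B n` converges with tight maxima (relatively to `B`) to the probability distribution
`ν` on `ℝ`: it converges in law to a random variable of law `ν`, and the random variables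
`max_{1 ≤ k ≤ n} |S k| / B n`, for `n ≥ 1`, are tight. -/
def ConvergesWithTightMaxima {Ω : Type*} [MeasurableSpace Ω] (P : Measure Ω)
    [IsProbabilityMeasure P] (S : ℕ → Ω → ℝ) (B : ℕ → ℝ) (ν : Measure ℝ)
    [IsProbabilityMeasure ν] : Prop :=
  TendstoInDistribution (fun n ω => S n ω / B n) atTop (id : ℝ → ℝ) (fun _ => P) ν ∧
  ∀ ε : ℝ, 0 < ε → ∃ c : ℝ, 0 < c ∧ ∀ (n : ℕ) (hn : 1 ≤ n),
    P {ω | c < (Finset.Icc 1 n).sup' (Finset.nonempty_Icc.mpr hn) (fun k => |S k ω|) / B n}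
      ≤ ENNReal.ofReal ε

/-- The finite measure `(1 / log N) ∑_{k=1}^N (1 / k) δ_{x k}` on `ℝ`. (For `N ≤ 1` it is the zero
measure, which plays no role in limits as `N → ∞`.) -/
def logEmpiricalMeasure (x : ℕ → ℝ) (N : ℕ) : FiniteMeasure ℝ :=
  Real.toNNReal (1 / Real.log N) •
    ∑ k ∈ Finset.Icc 1 N, (1 / (k : NNReal)) • (diracProba (x k)).toFiniteMeasure

/-- `S n / B n` satisfies an almost sure central limit theorem towards the probability
distribution `ν`: for almost every `ω`, the measures
`(1 / log N) ∑_{k=1}^N (1 / k) δ_{S k ω / B k}` converge weakly to `ν` as `N → ∞`. -/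
def SatisfiesASCLT {Ω : Type*} [MeasurableSpace Ω] (P : Measure Ω)
    (S : ℕ → Ω → ℝ) (B : ℕ → ℝ) (ν : Measure ℝ) [IsProbabilityMeasure ν] : Prop :=
  ∀ᵐ ω ∂P, Tendsto (fun N : ℕ => logEmpiricalMeasure (fun k => S k ω / B k) N) atTop
    (𝓝 (⟨ν, inferInstance⟩ : FiniteMeasure ℝ))

end

/-!
The proof follows Gordin's martingale method, in its reversed form, which needs no invertibility
of `T`. Write `Fₙ = T⁻ⁿ F`, a decreasing sequence of `σ`-algebras.

*Reduction to martingale differences.* The two summability assumptions say that `f ∘ Tⁿ` is well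
approximated by `F`-measurable functions, and that `E(f | Fₙ)` is small.
Hence the series of the errors `E(f ∘ Tⁿ | F) - f ∘ Tⁿ` and of the `F`-measurable functions `qₙ`
with `qₙ ∘ Tⁿ⁺¹ = E(f | Fₙ₊₁)` converges in `L²` to a function `g`, and a telescoping shows that
`h = f + g - g ∘ T` is `F`-measurable with `E(h | F₁) = 0`
(`exists_reversedMartingaleDifference_add_coboundary`). Thus the `h ∘ Tᵏ` are reversed martingale
differences, the variance is `σ² = ∫ h²`, and `Sₙ f = Sₙ h + g ∘ Tⁿ - g`.

*Quenched central limit theorem.* Let `L` be the transfer operator, so that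
`(Lⁿ p) ∘ Tⁿ = E(p | Fₙ)`. Almost everywhere, `Lⁿ cos (t Sₙ h / √n + θ)` tends to
`exp (-t² σ² / 2) cos θ` (`IsReversedMartingaleDifference.tendsto_transfer_iterate_cos`). This is a
Lindeberg type telescoping over the tails of `Sₙ h` (`abs_exp_mul_cos_sum_sub_le`), in which
`h² - σ²` is replaced by a bounded coboundary up to a small `L¹` error, by the mean ergodic theorem
(`Ergodic.exists_bounded_coboundary`); the remaining errors are ergodic sums for `L`, controlled by
the maximal ergodic inequality for Markov operators
(`IsMarkovOperator.measure_exists_lt_sum_le`). Integrating gives the central limit theorem.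

*Almost sure central limit theorem.* Split `cos (t Sₖ h / √k + θ)` into its conditional expectation
given `Fₖ` and a fluctuation. The fluctuations of indices `j < k` have correlation `O(√(j / k))`,
so their logarithmic averages tend to zero (`ae_tendsto_logAverage_of_correlation_le`). The
conditional expectation is `Tᵏ` composed with the quenched quantity, whose averages along orbits
converge by Egorov's theorem and the maximal inequality
(`ae_tendsto_average_comp_iterate_of_tendsto_zero`). The exceptional null set depends on `t`; by
Fubini's theorem almost every point is good for almost every `t`, and this is enough for Lévy's
convergence theorem (`tendsto_of_ae_tendsto_charFun`).

*Maxima and the coboundary.* Doob's inequality for the reversed partial sums `Sₙ h - Sₙ₋ᵢ h`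
bounds the maxima of `|Sₖ h|`. The coboundary is negligible since `∑ m {g² > δ n}` is finite for
every `δ > 0`.
-/

/-! ### Logarithmic averages of real sequences -/

theorem sum_Icc_one_div_eq_harmonic (N : ℕ) :
    ∑ k ∈ Finset.Icc 1 N, 1 / (k : ℝ) = (harmonic N : ℝ) := by
  rw [harmonic_eq_sum_Icc]
  push_cast
  simp

theorem tendsto_log_natCast_atTop : Tendsto (fun N : ℕ => Real.log N) atTop atTop :=
  Real.tendsto_log_atTop.comp tendsto_natCast_atTop_atTop

theorem tendsto_harmonic_div_log :
    Tendsto (fun N : ℕ => (∑ k ∈ Finset.Icc 1 N, 1 / (k : ℝ)) / Real.log N) atTop (𝓝 1) := by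
  have h1 : Tendsto (fun N : ℕ => 1 / Real.log N + 1) atTop (𝓝 (0 + 1)) :=
    (tendsto_log_natCast_atTop.const_div_atTop 1).add_const 1
  rw [zero_add] at h1
  refine tendsto_of_tendsto_of_tendsto_of_le_of_le' tendsto_const_nhds h1 ?_ ?_
  · filter_upwards [tendsto_log_natCast_atTop.eventually_gt_atTop 0, eventually_ge_atTop 1]
      with N hN hN1
    rw [le_div_iff₀ hN, one_mul, sum_Icc_one_div_eq_harmonic]
    have h2 := log_add_one_le_harmonic N
    have h3 : Real.log N ≤ Real.log ((N + 1 : ℕ) : ℝ) :=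
      Real.log_le_log (by exact_mod_cast hN1) (by push_cast; linarith)
    linarith
  · filter_upwards [tendsto_log_natCast_atTop.eventually_gt_atTop 0] with N hN
    rw [div_add_one hN.ne', sum_Icc_one_div_eq_harmonic]
    gcongr
    exact harmonic_le_one_add_log N

/-- Logarithmic averages of a null sequence are null. -/
theorem tendsto_logAverage_of_tendsto_zero {a : ℕ → ℝ} (ha : Tendsto a atTop (𝓝 0)) :
    Tendsto (fun N : ℕ => (∑ k ∈ Finset.Icc 1 N, (1 / (k : ℝ)) * a k) / Real.log N)
      atTop (𝓝 0) := by
  have hsum : ∀ (b : ℕ → ℝ) (N : ℕ),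
      ∑ k ∈ Finset.Icc 1 N, b k = ∑ i ∈ Finset.range N, b (i + 1) := by
    intro b N
    rw [Finset.range_eq_Ico, Finset.sum_Ico_add' b 0 N 1]
    rfl
  have h1 : (fun i : ℕ => (1 / ((i + 1 : ℕ) : ℝ)) * a (i + 1)) =o[atTop]
      fun i : ℕ => 1 / ((i + 1 : ℕ) : ℝ) := by
    have h0 : (fun i : ℕ => a (i + 1)) =o[atTop] fun _ : ℕ => (1 : ℝ) :=
      (Asymptotics.isLittleO_one_iff ℝ).2 (ha.comp (tendsto_add_atTop_nat 1))
    have hO := Asymptotics.isBigO_refl (fun i : ℕ => 1 / ((i + 1 : ℕ) : ℝ)) atTop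
    simpa using hO.mul_isLittleO h0
  have h2 : Tendsto (fun n => ∑ i ∈ Finset.range n, 1 / ((i + 1 : ℕ) : ℝ)) atTop atTop := by
    simpa using Real.tendsto_sum_range_one_div_nat_succ_atTop
  have h3 := (h1.sum_range (fun i => by positivity) h2).tendsto_div_nhds_zero
  have h4 := h3.mul tendsto_harmonic_div_log
  rw [zero_mul] at h4
  refine h4.congr' ?_
  filter_upwards [eventually_ge_atTop 1] with N hN
  rw [hsum, hsum, div_mul_div_cancel₀]
  have : 0 < ∑ i ∈ Finset.range N, 1 / ((i + 1 : ℕ) : ℝ) :=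
    Finset.sum_pos (fun i _ => by positivity) ⟨0, by simp; omega⟩
  exact this.ne'

/-- If the Cesàro averages of a sequence tend to zero, then so do its logarithmic averages. -/
theorem tendsto_logAverage_of_tendsto_average {a : ℕ → ℝ}
    (ha : Tendsto (fun n : ℕ => (∑ k ∈ Finset.range n, a k) / n) atTop (𝓝 0)) :
    Tendsto (fun N : ℕ => (∑ k ∈ Finset.Icc 1 N, (1 / (k : ℝ)) * a k) / Real.log N)
      atTop (𝓝 0) := by
  set c : ℕ → ℝ := fun n => (∑ k ∈ Finset.range n, a k) / n with hc
  -- Summation by parts expresses the weighted sum through the Cesàro averages.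
  have key : ∀ N : ℕ, ∑ k ∈ Finset.Icc 1 N, (1 / (k : ℝ)) * a k =
      ∑ k ∈ Finset.Icc 1 N, (1 / (k : ℝ)) * c (k + 1) + (c (N + 1) - c 1) := by
    intro N
    induction N with
    | zero => simp
    | succ N ih =>
      rw [Finset.sum_Icc_succ_top (by omega), Finset.sum_Icc_succ_top (by omega), ih]
      simp only [hc]
      rw [Finset.sum_range_succ _ (N + 1)]
      push_cast
      field_simp
      ring
  have h1 : Tendsto (fun N : ℕ => (c (N + 1) - c 1) / Real.log N) atTop (𝓝 0) :=
    ((ha.comp (tendsto_add_atTop_nat 1)).sub_const (c 1)).div_atTop tendsto_log_natCast_atTop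
  have h2 := (tendsto_logAverage_of_tendsto_zero (ha.comp (tendsto_add_atTop_nat 1))).add h1
  rw [add_zero] at h2
  refine h2.congr fun N => ?_
  rw [key, add_div]
  rfl

/-! ### Conditional expectations along a measure preserving map -/

section Transfer

variable {X : Type*} {F : MeasurableSpace X} {mX : MeasurableSpace X} {m : Measure X} {T : X → X}

theorem MeasureTheory.MeasurePreserving.integral_comp_of_aestronglyMeasurable {Y : Type*}
    {mY : MeasurableSpace Y} {ν : Measure Y} {S : X → Y} (hS : MeasurePreserving S m ν)
    {p : Y → ℝ} (hp : AEStronglyMeasurable p ν) : ∫ x, p (S x) ∂m = ∫ y, p y ∂ν := by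
  rw [← hS.map_eq] at hp ⊢
  exact (integral_map hS.aemeasurable hp).symm

theorem comap_le_of_measurable (hT : Measurable T) (hF : F ≤ mX) : F.comap T ≤ mX :=
  (MeasurableSpace.comap_mono hF).trans hT.comap_le

theorem comap_iterate_succ' (F : MeasurableSpace X) (T : X → X) (n : ℕ) :
    F.comap T^[n + 1] = (F.comap T).comap T^[n] := by
  rw [MeasurableSpace.comap_comp, Function.iterate_succ']

theorem comap_iterate_antitone (hFT : F.comap T ≤ F) : Antitone fun n => F.comap T^[n] := by
  refine antitone_nat_of_succ_le fun n => ?_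
  rw [comap_iterate_succ']
  exact MeasurableSpace.comap_mono hFT

theorem comap_iterate_le (hT : Measurable T) (hF : F ≤ mX) (n : ℕ) : F.comap T^[n] ≤ mX :=
  comap_le_of_measurable (hT.iterate n) hF

/-- The transfer operator of `T` relative to the `σ`-algebra `F`: `transfer m F T p` is the
`F`-measurable function `q` such that `q ∘ T` is the conditional expectation of `p` with respect
to `T⁻¹ F`. It is determined up to null sets; a version is chosen. -/
noncomputable def transfer (m : Measure X) (F : MeasurableSpace X) (T : X → X) (p : X → ℝ) :
    X → ℝ :=
  (StronglyMeasurable.exists_eq_measurable_comp (mY := F) (f := T)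
    (stronglyMeasurable_condExp (m := F.comap T) (μ := m) (f := p))).choose

theorem stronglyMeasurable_transfer (p : X → ℝ) :
    StronglyMeasurable[F] (transfer m F T p) :=
  (StronglyMeasurable.exists_eq_measurable_comp (mY := F) (f := T)
    (stronglyMeasurable_condExp (m := F.comap T) (μ := m) (f := p))).choose_spec.1

theorem transfer_comp (p : X → ℝ) : transfer m F T p ∘ T = m[p | F.comap T] :=
  (StronglyMeasurable.exists_eq_measurable_comp (mY := F) (f := T)
    (stronglyMeasurable_condExp (m := F.comap T) (μ := m) (f := p))).choose_spec.2.symm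

/-- An almost everywhere inequality can be checked after composition with a measure preserving
map. -/
theorem ae_le_of_comp_ae_le (hT : MeasurePreserving T m m) {p q : X → ℝ}
    (hp : Measurable p) (hq : Measurable q) (h : p ∘ T ≤ᵐ[m] q ∘ T) : p ≤ᵐ[m] q := by
  have : ∀ᵐ y ∂(m.map T), p y ≤ q y :=
    (ae_map_iff hT.aemeasurable (measurableSet_le hp hq)).2 h
  rwa [hT.map_eq] at this

theorem ae_eq_of_comp_ae_eq (hT : MeasurePreserving T m m) {p q : X → ℝ}
    (hp : Measurable p) (hq : Measurable q) (h : p ∘ T =ᵐ[m] q ∘ T) : p =ᵐ[m] q :=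
  (ae_le_of_comp_ae_le hT hp hq h.le).antisymm (ae_le_of_comp_ae_le hT hq hp h.symm.le)

theorem measurable_transfer (hF : F ≤ mX) (p : X → ℝ) : Measurable (transfer m F T p) :=
  ((stronglyMeasurable_transfer p).mono hF).measurable

theorem memLp_transfer_of_memLp_condExp (hT : MeasurePreserving T m m) (hF : F ≤ mX) {p : X → ℝ}
    {r : ENNReal} (hp : MemLp (m[p | F.comap T]) r m) : MemLp (transfer m F T p) r m := by
  rw [← transfer_comp] at hp
  have h := (measurable_transfer (m := m) (T := T) hF p).aestronglyMeasurable (μ := m.map T)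
  have h2 := (memLp_map_measure_iff h hT.aemeasurable).2 hp
  rwa [hT.map_eq] at h2

/-- Conditional expectation commutes with composition by a measure preserving map. -/
theorem condExp_comp_ae_eq [IsProbabilityMeasure m]
    (hT : MeasurePreserving T m m) (hF : F ≤ mX) {p : X → ℝ}
    (hp : Integrable p m) : (m[p | F]) ∘ T =ᵐ[m] m[p ∘ T | F.comap T] := by
  have hc : Integrable ((m[p | F]) ∘ T) m := hT.integrable_comp_of_integrable integrable_condExp
  refine ae_eq_condExp_of_forall_setIntegral_eq (comap_le_of_measurable hT.measurable hF)
    (hT.integrable_comp_of_integrable hp) (fun s _ _ => hc.integrableOn) ?_ ?_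
  · rintro _ ⟨A, hA, rfl⟩ -
    have hr := hT.restrict_preimage (hF A hA)
    have h1 := hr.integral_comp_of_aestronglyMeasurable
      (p := m[p | F]) integrable_condExp.aestronglyMeasurable.restrict
    have h2 := hr.integral_comp_of_aestronglyMeasurable hp.aestronglyMeasurable.restrict
    simp only [Function.comp_apply]
    rw [h1, h2, setIntegral_condExp hF hp hA]
  · exact (stronglyMeasurable_condExp.comp_measurable
      (comap_measurable T)).aestronglyMeasurable

theorem condExp_comp_iterate_ae_eq [IsProbabilityMeasure m]
    (hT : MeasurePreserving T m m) (hF : F ≤ mX) {p : X → ℝ}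
    (hp : Integrable p m) (n : ℕ) :
    (m[p | F]) ∘ T^[n] =ᵐ[m] m[p ∘ T^[n] | F.comap T^[n]] :=
  condExp_comp_ae_eq (hT.iterate n) hF hp

theorem integrable_transfer (hT : MeasurePreserving T m m) (hF : F ≤ mX) (p : X → ℝ) :
    Integrable (transfer m F T p) m :=
  memLp_one_iff_integrable.1 (memLp_transfer_of_memLp_condExp hT hF
    (memLp_one_iff_integrable.2 integrable_condExp))

theorem integral_transfer [IsProbabilityMeasure m]
    (hT : MeasurePreserving T m m) (hF : F ≤ mX) {p : X → ℝ} :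
    ∫ x, transfer m F T p x ∂m = ∫ x, p x ∂m := by
  rw [← hT.integral_comp_of_aestronglyMeasurable
    (measurable_transfer (m := m) hF p).aestronglyMeasurable]
  change ∫ x, (transfer m F T p ∘ T) x ∂m = _
  rw [transfer_comp, integral_condExp (comap_le_of_measurable hT.measurable hF)]

theorem transfer_mono (hT : MeasurePreserving T m m) (hF : F ≤ mX) {p q : X → ℝ}
    (hp : Integrable p m) (hq : Integrable q m) (h : p ≤ᵐ[m] q) :
    transfer m F T p ≤ᵐ[m] transfer m F T q := by
  refine ae_le_of_comp_ae_le hT (measurable_transfer hF p) (measurable_transfer hF q) ?_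
  rw [transfer_comp, transfer_comp]
  exact condExp_mono hp hq h

theorem transfer_add (hT : MeasurePreserving T m m) (hF : F ≤ mX) {p q : X → ℝ}
    (hp : Integrable p m) (hq : Integrable q m) :
    transfer m F T (p + q) =ᵐ[m] transfer m F T p + transfer m F T q := by
  refine ae_eq_of_comp_ae_eq hT (measurable_transfer hF _)
    ((measurable_transfer hF p).add (measurable_transfer hF q)) ?_
  have : (transfer m F T p + transfer m F T q) ∘ T =
    transfer m F T p ∘ T + transfer m F T q ∘ T := rfl
  rw [this, transfer_comp, transfer_comp, transfer_comp]
  exact condExp_add hp hq _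

theorem transfer_const [IsProbabilityMeasure m]
    (hT : MeasurePreserving T m m) (hF : F ≤ mX) (c : ℝ) :
    transfer m F T (fun _ => c) =ᵐ[m] fun _ => c := by
  refine ae_eq_of_comp_ae_eq hT (measurable_transfer hF _) measurable_const ?_
  rw [transfer_comp, condExp_const (comap_le_of_measurable hT.measurable hF)]
  rfl

theorem measurable_transfer_iterate (hF : F ≤ mX) {p : X → ℝ}
    (hp : Measurable p) (n : ℕ) : Measurable ((transfer m F T)^[n] p) := by
  cases n with
  | zero => exact hp
  | succ n => rw [Function.iterate_succ_apply']; exact measurable_transfer hF _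

theorem integrable_transfer_iterate (hT : MeasurePreserving T m m) (hF : F ≤ mX) {p : X → ℝ}
    (hp : Integrable p m) (n : ℕ) : Integrable ((transfer m F T)^[n] p) m := by
  cases n with
  | zero => exact hp
  | succ n => rw [Function.iterate_succ_apply']; exact integrable_transfer hT hF _

/-- Powers of the transfer operator compute conditional expectations with respect to the
`σ`-algebras `T⁻ⁿ F`. -/
theorem transfer_iterate_comp_iterate [IsProbabilityMeasure m]
    (hT : MeasurePreserving T m m) (hF : F ≤ mX)
    (hFT : F.comap T ≤ F) {p : X → ℝ} (hp : Integrable p m) (n : ℕ) :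
    (transfer m F T)^[n + 1] p ∘ T^[n + 1] =ᵐ[m] m[p | F.comap T^[n + 1]] := by
  induction n with
  | zero => simp [transfer_comp]
  | succ n ih =>
    have h1 : (transfer m F T)^[n + 2] p ∘ T^[n + 2] =
        (m[(transfer m F T)^[n + 1] p | F.comap T]) ∘ T^[n + 1] := by
      rw [← transfer_comp, Function.iterate_succ_apply', Function.iterate_succ' T]
      rfl
    rw [h1]
    refine (condExp_comp_iterate_ae_eq hT (comap_le_of_measurable hT.measurable hF)
      (integrable_transfer_iterate hT hF hp _) _).trans ?_
    rw [← comap_iterate_succ']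
    refine (condExp_congr_ae ih).trans ?_
    exact condExp_condExp_of_le (comap_iterate_antitone hFT (Nat.le_succ (n + 1)))
      (comap_iterate_le hT.measurable hF _)

/-- `Lⁿ (p ∘ Tʲ) = Lⁿ⁻ʲ p` for the transfer operator `L` and `j < n`. -/
theorem transfer_iterate_comp_iterate_of_lt [IsProbabilityMeasure m]
    (hT : MeasurePreserving T m m) (hF : F ≤ mX)
    (hFT : F.comap T ≤ F) {p : X → ℝ} (hp : Integrable p m) {j n : ℕ} (hj : j < n) :
    (transfer m F T)^[n - j] p ∘ T^[n] =ᵐ[m] m[p ∘ T^[j] | F.comap T^[n]] := by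
  obtain ⟨k, rfl⟩ : ∃ k, n = j + (k + 1) := ⟨n - j - 1, by omega⟩
  have h1 := transfer_iterate_comp_iterate hT hF hFT hp k
  have h2 := (hT.iterate j).quasiMeasurePreserving.ae_eq_comp h1
  have h3 := condExp_comp_iterate_ae_eq hT (comap_iterate_le hT.measurable hF (k + 1)) hp j
  rw [MeasurableSpace.comap_comp, ← Function.iterate_add] at h3
  rw [Nat.add_sub_cancel_left, add_comm j (k + 1)]
  refine EventuallyEq.trans ?_ h3
  rw [Function.iterate_add T (k + 1) j]
  exact h2

end Transfer

/-! ### The maximal ergodic inequality for Markov operators -/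

/-- A Markov operator on the integrable functions of a probability space: a positive operator
preserving constants and integrals. All identities are required up to null sets, so that the
operator acts on functions rather than on their classes. -/
structure IsMarkovOperator {X : Type*} [MeasurableSpace X] (m : Measure X)
    (A : (X → ℝ) → (X → ℝ)) : Prop where
  integrable : ∀ p, Integrable p m → Integrable (A p) m
  integral_eq : ∀ p, Integrable p m → ∫ x, A p x ∂m = ∫ x, p x ∂m
  mono : ∀ p q, Integrable p m → Integrable q m → p ≤ᵐ[m] q → A p ≤ᵐ[m] A q
  add : ∀ p q, Integrable p m → Integrable q m → A (p + q) =ᵐ[m] A p + A q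
  const : ∀ c : ℝ, A (fun _ => c) =ᵐ[m] fun _ => c

section Maximal

variable {X : Type*} {F : MeasurableSpace X} {mX : MeasurableSpace X} {m : Measure X}
  {T : X → X} {A : (X → ℝ) → (X → ℝ)}

theorem isMarkovOperator_transfer [IsProbabilityMeasure m]
    (hT : MeasurePreserving T m m) (hF : F ≤ mX) :
    IsMarkovOperator m (transfer m F T) where
  integrable p _ := integrable_transfer hT hF p
  integral_eq _ _ := integral_transfer hT hF
  mono _ _ hp hq h := transfer_mono hT hF hp hq h
  add _ _ hp hq := transfer_add hT hF hp hq
  const c := transfer_const hT hF c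

theorem MeasureTheory.MeasurePreserving.isMarkovOperator_comp (hT : MeasurePreserving T m m) :
    IsMarkovOperator m fun p : X → ℝ => p ∘ T where
  integrable _ hp := hT.integrable_comp_of_integrable hp
  integral_eq _ hp := hT.integral_comp_of_aestronglyMeasurable hp.aestronglyMeasurable
  mono _ _ _ _ h := hT.quasiMeasurePreserving.ae h
  add _ _ _ _ := ae_eq_rfl
  const _ := ae_eq_rfl

namespace IsMarkovOperator

theorem integrable_iterate (hA : IsMarkovOperator m A) {p : X → ℝ} (hp : Integrable p m) (n : ℕ) :
    Integrable (A^[n] p) m := by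
  induction n with
  | zero => exact hp
  | succ n ih => rw [Function.iterate_succ_apply']; exact hA.integrable _ ih

theorem abs_iterate_le [IsProbabilityMeasure m] (hA : IsMarkovOperator m A) {p : X → ℝ}
    (hp : Integrable p m) {c : ℝ} (hc : ∀ᵐ x ∂m, |p x| ≤ c) (n : ℕ) :
    ∀ᵐ x ∂m, |A^[n] p x| ≤ c := by
  induction n with
  | zero => exact hc
  | succ n ih =>
    rw [Function.iterate_succ_apply']
    have hi := hA.integrable_iterate hp n
    filter_upwards [hA.mono _ _ hi (integrable_const c) (ih.mono fun x hx => (abs_le.1 hx).2),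
      hA.mono _ _ (integrable_const (-c)) hi (ih.mono fun x hx => (abs_le.1 hx).1),
      hA.const c, hA.const (-c)] with x h1 h2 h3 h4
    rw [h3] at h1
    rw [h4] at h2
    exact abs_le.2 ⟨h2, h1⟩

theorem integrable_sum (hA : IsMarkovOperator m A) {p : X → ℝ} (hp : Integrable p m) (n : ℕ) :
    Integrable (∑ l ∈ Finset.range n, A^[l] p) m :=
  integrable_finsetSum' _ fun l _ => hA.integrable_iterate hp l

theorem sum_succ (hA : IsMarkovOperator m A) {p : X → ℝ} (hp : Integrable p m) (n : ℕ) :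
    ∑ l ∈ Finset.range (n + 1), A^[l] p =ᵐ[m] p + A (∑ l ∈ Finset.range n, A^[l] p) := by
  induction n with
  | zero =>
    have h0 : A 0 =ᵐ[m] 0 := hA.const 0
    simp only [zero_add, Finset.range_one, Finset.sum_singleton, Finset.range_zero,
      Finset.sum_empty]
    filter_upwards [h0] with x hx
    simp [hx]
  | succ n ih =>
    rw [Finset.sum_range_succ]
    have h1 := hA.add _ _ (hA.integrable_sum hp n) (hA.integrable_iterate hp n)
    rw [← Finset.sum_range_succ] at h1
    filter_upwards [ih, h1] with x hx h1x
    rw [Pi.add_apply, hx, Pi.add_apply, Pi.add_apply, h1x, Function.iterate_succ_apply',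
      Pi.add_apply, add_assoc]

/-- The running maximum `max_{k ≤ n} (∑_{l < k} Aˡ p - c k)`. -/
noncomputable def runningMax (A : (X → ℝ) → (X → ℝ)) (p : X → ℝ) (c : ℝ) (n : ℕ) : X → ℝ :=
  (Finset.range (n + 1)).sup' Finset.nonempty_range_add_one
    fun k x => (∑ l ∈ Finset.range k, A^[l] p) x - c * k

theorem integrable_runningMax [IsProbabilityMeasure m]
    (hA : IsMarkovOperator m A) {p : X → ℝ} (hp : Integrable p m)
    (c : ℝ) (n : ℕ) : Integrable (runningMax A p c n) m := by
  unfold runningMax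
  refine Finset.sup'_induction (p := fun q : X → ℝ => Integrable q m) _ _
    (fun _ h _ h' => h.sup h') fun k _ => ?_
  exact (hA.integrable_sum hp k).sub (integrable_const _)

theorem le_runningMax (A : (X → ℝ) → (X → ℝ)) (p : X → ℝ) (c : ℝ) {k n : ℕ} (hk : k ≤ n)
    (x : X) : (∑ l ∈ Finset.range k, A^[l] p) x - c * k ≤ runningMax A p c n x := by
  unfold runningMax
  rw [Finset.sup'_apply]
  exact Finset.le_sup' (fun k : ℕ => (∑ l ∈ Finset.range k, A^[l] p) x - c * k)
    (Finset.mem_range.2 (by omega))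

theorem runningMax_nonneg (A : (X → ℝ) → (X → ℝ)) (p : X → ℝ) (c : ℝ) (n : ℕ) (x : X) :
    0 ≤ runningMax A p c n x := by
  simpa using le_runningMax A p c (Nat.zero_le n) x

/-- Hopf's maximal lemma: the integral of `p - c` over the set where the running maximum is positive
is nonnegative, which gives this bound because `p ≥ 0`. -/
theorem mul_measureReal_runningMax_pos_le [IsProbabilityMeasure m]
    (hA : IsMarkovOperator m A) {p : X → ℝ}
    (hp : Integrable p m) (hp0 : 0 ≤ᵐ[m] p) (c : ℝ) (n : ℕ) :
    c * m.real {x | 0 < runningMax A p c n x} ≤ ∫ x, p x ∂m := by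
  set M := runningMax A p c n with hM
  have hMi : Integrable M m := hA.integrable_runningMax hp c n
  have hM0 : 0 ≤ᵐ[m] M := Eventually.of_forall (runningMax_nonneg A p c n)
  have hAM := hA.integrable M hMi
  have hAM0 : 0 ≤ᵐ[m] A M :=
    (hA.const 0).symm.le.trans (hA.mono _ _ (integrable_const 0) hMi hM0)
  -- `A` applied to the `k`-th centred sum is bounded by `A M`.
  have hk : ∀ k ≤ n, ∀ᵐ x ∂m, (A (∑ l ∈ Finset.range k, A^[l] p)) x - c * k ≤ A M x := by
    intro k hk
    have h1 := hA.mono _ _ ((hA.integrable_sum hp k).add (integrable_const (-(c * k)))) hMi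
      (Eventually.of_forall fun x => by
        simpa [sub_eq_add_neg] using le_runningMax A p c hk x)
    have h2 := hA.add _ _ (hA.integrable_sum hp k) (integrable_const (-(c * k)))
    filter_upwards [h1, h2, hA.const (-(c * k))] with x h1 h2 h3
    rw [h2, Pi.add_apply, h3] at h1
    linarith
  have hk' : ∀ᵐ x ∂m, ∀ k ≤ n, (A (∑ l ∈ Finset.range k, A^[l] p)) x - c * k ≤ A M x :=
    ae_all_iff.2 fun k => by
      by_cases h : k ≤ n
      · filter_upwards [hk k h] with x hx _ using hx
      · exact Eventually.of_forall fun x h' => absurd h' h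
  have hs : ∀ᵐ x ∂m, ∀ k, (∑ l ∈ Finset.range (k + 1), A^[l] p) x =
      p x + A (∑ l ∈ Finset.range k, A^[l] p) x :=
    ae_all_iff.2 fun k => hA.sum_succ hp k
  set E := {x | 0 < M x} with hE
  have hEm : NullMeasurableSet E m := nullMeasurableSet_lt aemeasurable_const hMi.aemeasurable
  -- Garsia's argument: where `M > 0`, the maximum is attained at some `k + 1`, and the sum over
  -- `l < k + 1` is `p` plus the image of the sum over `l < k`.
  have hle : M ≤ᵐ[m] E.indicator (fun x => p x - c) + A M := by
    filter_upwards [hk', hs, hAM0] with x hk hs h0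
    by_cases hx : 0 < M x
    · rw [Pi.add_apply, Set.indicator_of_mem (show x ∈ E from hx)]
      obtain ⟨k, hkn, hke⟩ := Finset.exists_mem_eq_sup' (s := Finset.range (n + 1))
        Finset.nonempty_range_add_one
        (fun k : ℕ => (∑ l ∈ Finset.range k, A^[l] p) x - c * k)
      have hke' : M x = (∑ l ∈ Finset.range k, A^[l] p) x - c * k := by
        rw [hM, runningMax, Finset.sup'_apply]; exact hke
      rw [hke']
      cases k with
      | zero => simp [hke'] at hx
      | succ k =>
        have := hk k (by have := Finset.mem_range.1 hkn; omega)
        rw [hs]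
        push_cast
        linarith
    · rw [Pi.add_apply, Set.indicator_of_notMem (show x ∉ E from hx), zero_add]
      exact (not_lt.1 hx).trans h0
  have hpc : Integrable (fun x => p x - c) m := hp.sub (integrable_const c)
  have hint := integral_mono_ae hMi ((hpc.indicator₀ hEm).add hAM) hle
  rw [integral_add' (hpc.indicator₀ hEm) hAM, hA.integral_eq M hMi,
    integral_indicator₀ hEm, integral_sub hp.integrableOn (integrable_const c).integrableOn] at hint
  have h3 := setIntegral_le_integral (s := E) hp hp0
  simp only [integral_const, measureReal_restrict_apply_univ, smul_eq_mul] at hint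
  linarith

/-- The **maximal ergodic inequality** for a Markov operator. -/
theorem measure_exists_lt_sum_le [IsProbabilityMeasure m]
    (hA : IsMarkovOperator m A) {p : X → ℝ}
    (hp : Integrable p m) (hp0 : 0 ≤ᵐ[m] p) {c : ℝ} (hc : 0 < c) :
    m {x | ∃ n : ℕ, c * n < (∑ l ∈ Finset.range n, A^[l] p) x} ≤
      ENNReal.ofReal ((∫ x, p x ∂m) / c) := by
  have hset : {x | ∃ n : ℕ, c * n < (∑ l ∈ Finset.range n, A^[l] p) x} =
      ⋃ n, {x | 0 < runningMax A p c n x} := by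
    ext x
    simp only [Set.mem_ofPred_eq, Set.mem_iUnion]
    constructor
    · rintro ⟨n, hn⟩
      exact ⟨n, (sub_pos.2 hn).trans_le (le_runningMax A p c le_rfl x)⟩
    · rintro ⟨n, hn⟩
      rw [runningMax, Finset.sup'_apply, Finset.lt_sup'_iff] at hn
      obtain ⟨k, -, hk⟩ := hn
      exact ⟨k, sub_pos.1 hk⟩
  rw [hset, measure_iUnion_eq_iSup_accumulate]
  refine iSup_le fun n => ?_
  have hacc : Set.accumulate (fun n => {x | 0 < runningMax A p c n x}) n ⊆
      {x | 0 < runningMax A p c n x} := by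
    intro x hx
    obtain ⟨k, hk, hx⟩ := Set.mem_accumulate.1 hx
    refine lt_of_lt_of_le (Set.mem_ofPred_eq ▸ hx) ?_
    unfold runningMax
    rw [Finset.sup'_apply, Finset.sup'_apply]
    exact Finset.sup'_mono _ (Finset.range_mono (by omega)) _
  refine (measure_mono hacc).trans ?_
  rw [← ofReal_measureReal]
  refine ENNReal.ofReal_le_ofReal ?_
  rw [le_div_iff₀ hc, mul_comm]
  exact hA.mul_measureReal_runningMax_pos_le hp hp0 c n

end IsMarkovOperator

end Maximal

/-! ### Ergodic averages of null sequences -/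

section NullSequences

variable {X : Type*} {mX : MeasurableSpace X} {m : Measure X} {T : X → X}

/-- A Borel–Cantelli criterion for almost everywhere convergence to zero. -/
theorem ae_tendsto_zero_of_forall_exists {q : ℕ → X → ℝ}
    (h : ∀ ε : ℝ, 0 < ε → ∃ A : Set X, m A ≤ ENNReal.ofReal ε ∧
      ∀ᵐ x ∂m, x ∉ A → ∀ᶠ n in atTop, |q n x| ≤ ε) :
    ∀ᵐ x ∂m, Tendsto (fun n => q n x) atTop (𝓝 0) := by
  choose A hA hq using fun i : ℕ => h ((1 / 2 : ℝ) ^ i) (by positivity)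
  have hsum : ∑' i, m (A i) ≠ ⊤ := by
    have hs : Summable fun i : ℕ => (1 / 2 : ℝ) ^ i := summable_geometric_two
    refine ne_top_of_le_ne_top (hs.tsum_ofReal_ne_top) (ENNReal.tsum_le_tsum hA)
  filter_upwards [ae_eventually_notMem hsum, ae_all_iff.2 hq] with x hx hqx
  rw [Metric.tendsto_nhds]
  intro ε hε
  have h2 : ∀ᶠ i : ℕ in atTop, (1 / 2 : ℝ) ^ i < ε :=
    (tendsto_pow_atTop_nhds_zero_of_lt_one (by norm_num) (by norm_num)).eventually_lt_const hε
  obtain ⟨i, hi, hi2⟩ := (hx.and h2).exists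
  filter_upwards [hqx i hi] with n hn
  rw [dist_zero_right, Real.norm_eq_abs]
  exact hn.trans_lt hi2

theorem iterate_comp_right {Y : Type*} (T : X → X) (p : X → Y) (l : ℕ) :
    (fun q : X → Y => q ∘ T)^[l] p = p ∘ T^[l] := by
  induction l with
  | zero => rfl
  | succ l ih => rw [Function.iterate_succ_apply', ih, Function.iterate_succ]; rfl

/-- Averages along an orbit of a uniformly bounded sequence of functions which tends to zero almost
everywhere tend to zero almost everywhere. -/
theorem ae_tendsto_average_comp_iterate_of_tendsto_zero [IsProbabilityMeasure m]
    (hT : MeasurePreserving T m m) {q : ℕ → X → ℝ} (hq : ∀ n, Measurable (q n)) {C : ℝ}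
    (hC : ∀ n, ∀ᵐ x ∂m, |q n x| ≤ C) (hq0 : ∀ᵐ x ∂m, Tendsto (fun n => q n x) atTop (𝓝 0)) :
    ∀ᵐ x ∂m, Tendsto (fun n : ℕ => (∑ k ∈ Finset.range n, q k (T^[k] x)) / n) atTop (𝓝 0) := by
  have hC0 : 0 ≤ C := by
    obtain ⟨x, hx⟩ := (hC 0).exists
    exact (abs_nonneg _).trans hx
  have hCT : ∀ᵐ x ∂m, ∀ k, |q k (T^[k] x)| ≤ C :=
    ae_all_iff.2 fun k => (hT.iterate k).quasiMeasurePreserving.ae (hC k)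
  refine ae_tendsto_zero_of_forall_exists fun ε hε => ?_
  set c := ε / (4 * (C + 1)) with hc
  have hc0 : 0 < c := by positivity
  -- By Egorov's theorem, convergence is uniform off a small set `t`, and by the maximal ergodic
  -- inequality most orbits visit `t` with frequency at most `c`.
  obtain ⟨t, ht, hmt, hunif⟩ := tendstoUniformlyOn_of_ae_tendsto'
    (fun n => (hq n).stronglyMeasurable) (stronglyMeasurable_const (b := (0 : ℝ))) hq0
    (show 0 < ε * c by positivity)
  have hA := hT.isMarkovOperator_comp.measure_exists_lt_sum_le
    (p := t.indicator fun _ => 1) ((integrable_const 1).indicator ht)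
    (Eventually.of_forall fun x => Set.indicator_nonneg (fun _ _ => zero_le_one) x) hc0
  refine ⟨_, hA.trans (ENNReal.ofReal_le_ofReal ?_), ?_⟩
  · rw [div_le_iff₀ hc0, integral_indicator_const _ ht, smul_eq_mul, mul_one]
    exact ENNReal.toReal_le_of_le_ofReal (by positivity) hmt
  · filter_upwards [hCT] with x hCx hx
    simp only [not_exists, not_lt, iterate_comp_right, Finset.sum_apply,
      Function.comp_apply] at hx
    obtain ⟨K, hK⟩ := eventually_atTop.1
      (Metric.tendstoUniformlyOn_iff.1 hunif (ε / 4) (by positivity))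
    obtain ⟨N, hN⟩ := exists_nat_gt (4 * (K * C) / ε)
    filter_upwards [eventually_ge_atTop (max N 1)] with n hn
    have hn1 : (1 : ℝ) ≤ n := by exact_mod_cast (le_max_right N 1).trans hn
    have hnN : (N : ℝ) ≤ n := by exact_mod_cast (le_max_left N 1).trans hn
    have hb : ∀ k, |q k (T^[k] x)| ≤ (if k < K then C else 0) + ε / 4 +
        C * t.indicator (fun _ => (1 : ℝ)) (T^[k] x) := by
      intro k
      by_cases hkt : T^[k] x ∈ t
      · rw [Set.indicator_of_mem hkt]
        have := hCx k
        split_ifs <;> linarith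
      · rw [Set.indicator_of_notMem hkt]
        by_cases hkK : k < K
        · rw [if_pos hkK]
          have := hCx k
          linarith
        · have := hK k (not_lt.1 hkK) (T^[k] x) hkt
          rw [dist_zero_left, Real.norm_eq_abs] at this
          rw [if_neg hkK]
          linarith
    have hK2 : ∑ k ∈ Finset.range n, (if k < K then C else 0) ≤ K * C := by
      rw [← Finset.sum_filter, Finset.sum_const, nsmul_eq_mul]
      refine mul_le_mul_of_nonneg_right ?_ hC0
      have : (Finset.range n).filter (· < K) ⊆ Finset.range K := fun k hk => by
        simpa using (Finset.mem_filter.1 hk).2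
      simpa using (Nat.cast_le (α := ℝ)).2 (Finset.card_le_card this)
    have hsum : |∑ k ∈ Finset.range n, q k (T^[k] x)| ≤ K * C + n * (ε / 4) + C * (c * n) := by
      refine (Finset.abs_sum_le_sum_abs _ _).trans ((Finset.sum_le_sum fun k _ => hb k).trans ?_)
      rw [Finset.sum_add_distrib, Finset.sum_add_distrib, Finset.sum_const, Finset.card_range,
        nsmul_eq_mul, ← Finset.mul_sum]
      have := mul_le_mul_of_nonneg_left (hx n) hC0
      linarith
    have hCc : C * c ≤ ε / 4 := by
      rw [hc]
      rw [mul_div_assoc', div_le_div_iff₀ (by positivity) (by norm_num)]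
      nlinarith
    have hKC : K * C ≤ n * (ε / 4) := by
      have := (div_lt_iff₀ hε).1 (hN.trans_le hnN)
      linarith
    rw [abs_div, Nat.abs_cast, div_le_iff₀ (by linarith)]
    have : C * (c * n) ≤ ε / 4 * n := by
      rw [← mul_assoc]; exact mul_le_mul_of_nonneg_right hCc (by linarith)
    nlinarith

end NullSequences

/-! ### Stationary reversed martingale differences -/

/-- The functions `h ∘ Tᵏ` are square integrable reversed martingale differences for the decreasing
sequence of `σ`-algebras `T⁻ᵏ F`: each `h ∘ Tᵏ` is `T⁻ᵏ F`-measurable and has zero conditional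
expectation with respect to `T⁻ᵏ⁻¹ F`. By stationarity it suffices to require this for `k = 0`. -/
structure IsReversedMartingaleDifference {X : Type*} (F : MeasurableSpace X)
    {mX : MeasurableSpace X} (m : Measure X) (T : X → X) (h : X → ℝ) : Prop where
  le : F ≤ mX
  measurePreserving : MeasurePreserving T m m
  comap_le : F.comap T ≤ F
  stronglyMeasurable : StronglyMeasurable[F] h
  memLp : MemLp h 2 m
  condExp_eq_zero : m[h | F.comap T] =ᵐ[m] 0

namespace IsReversedMartingaleDifference

variable {X : Type*} {F : MeasurableSpace X} {mX : MeasurableSpace X} {m : Measure X}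
  {T : X → X} {h : X → ℝ}

theorem comap_iterate_le (hh : IsReversedMartingaleDifference F m T h) (k : ℕ) :
    F.comap T^[k] ≤ mX :=
  _root_.comap_iterate_le hh.measurePreserving.measurable hh.le k

theorem antitone (hh : IsReversedMartingaleDifference F m T h) :
    Antitone fun n => F.comap T^[n] :=
  comap_iterate_antitone hh.comap_le

theorem measurable (hh : IsReversedMartingaleDifference F m T h) : Measurable h :=
  (hh.stronglyMeasurable.mono hh.le).measurable

theorem measurable_comp (hh : IsReversedMartingaleDifference F m T h) (k : ℕ) :
    Measurable fun x => h (T^[k] x) :=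
  hh.measurable.comp (hh.measurePreserving.measurable.iterate k)

theorem stronglyMeasurable_comp (hh : IsReversedMartingaleDifference F m T h) {j k : ℕ}
    (hjk : j ≤ k) : StronglyMeasurable[F.comap T^[j]] fun x => h (T^[k] x) :=
  StronglyMeasurable.mono (hh.stronglyMeasurable.comp_measurable (comap_measurable T^[k]))
    (hh.antitone hjk)

theorem stronglyMeasurable_sum_Ico (hh : IsReversedMartingaleDifference F m T h) (j n : ℕ) :
    StronglyMeasurable[F.comap T^[j]] fun x => ∑ i ∈ Finset.Ico j n, h (T^[i] x) := by
  have := Finset.stronglyMeasurable_sum (m := F.comap T^[j]) (Finset.Ico j n)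
    (f := fun i x => h (T^[i] x))
    fun i hi => hh.stronglyMeasurable_comp (Finset.mem_Ico.1 hi).1
  simpa [Finset.sum_fn] using this

theorem memLp_comp (hh : IsReversedMartingaleDifference F m T h) (k : ℕ) :
    MemLp (fun x => h (T^[k] x)) 2 m :=
  hh.memLp.comp_measurePreserving (hh.measurePreserving.iterate k)

theorem measurable_birkhoffSum (hh : IsReversedMartingaleDifference F m T h) (n : ℕ) :
    Measurable (birkhoffSum T h n) := by
  unfold birkhoffSum
  exact Finset.measurable_sum _ fun k _ => hh.measurable_comp k

theorem memLp_birkhoffSum (hh : IsReversedMartingaleDifference F m T h) (n : ℕ) :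
    MemLp (birkhoffSum T h n) 2 m :=
  memLp_finsetSum _ fun k _ => hh.memLp_comp k

variable [IsProbabilityMeasure m]

theorem integrable (hh : IsReversedMartingaleDifference F m T h) : Integrable h m :=
  hh.memLp.integrable one_le_two

theorem integrable_comp (hh : IsReversedMartingaleDifference F m T h) (k : ℕ) :
    Integrable (fun x => h (T^[k] x)) m :=
  (hh.memLp_comp k).integrable one_le_two

theorem condExp_comp (hh : IsReversedMartingaleDifference F m T h) (k : ℕ) :
    m[fun x => h (T^[k] x) | F.comap T^[k + 1]] =ᵐ[m] 0 := by
  have h1 := condExp_comp_iterate_ae_eq hh.measurePreserving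
    (comap_le_of_measurable hh.measurePreserving.measurable hh.le) hh.integrable k
  rw [← comap_iterate_succ'] at h1
  refine h1.symm.trans ?_
  exact (hh.measurePreserving.iterate k).quasiMeasurePreserving.ae_eq_comp hh.condExp_eq_zero

theorem condExp_mul_comp_eq_zero (hh : IsReversedMartingaleDifference F m T h) {k n : ℕ}
    (hkn : k < n) {c : X → ℝ} (hc : StronglyMeasurable[F.comap T^[k + 1]] c) {C : ℝ}
    (hC : ∀ x, |c x| ≤ C) :
    m[fun x => c x * h (T^[k] x) | F.comap T^[n]] =ᵐ[m] 0 := by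
  have hint : Integrable (c * fun x => h (T^[k] x)) m :=
    (hh.integrable_comp k).bdd_mul (hc.mono (hh.comap_iterate_le _)).aestronglyMeasurable
      (Eventually.of_forall hC)
  have h1 := condExp_mul_of_stronglyMeasurable_left hc hint (hh.integrable_comp k)
  have h2 : m[c * fun x => h (T^[k] x) | F.comap T^[k + 1]] =ᵐ[m] 0 := by
    filter_upwards [h1, hh.condExp_comp k] with x hx hx2
    rw [hx, Pi.mul_apply, hx2]
    simp
  have h3 := condExp_condExp_of_le (μ := m) (f := c * fun x => h (T^[k] x))
    (hh.antitone (Nat.succ_le_of_lt hkn)) (hh.comap_iterate_le _)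
  refine h3.symm.trans ((condExp_congr_ae h2).trans ?_)
  rw [condExp_zero]

theorem integral_sq_birkhoffSum (hh : IsReversedMartingaleDifference F m T h) (n : ℕ) :
    ∫ x, birkhoffSum T h n x ^ 2 ∂m = n * ∫ x, h x ^ 2 ∂m := by
  induction n with
  | zero => simp
  | succ n ih =>
    set R : X → ℝ := fun x => birkhoffSum T h n (T x) with hR
    have hRL : MemLp R 2 m := (hh.memLp_birkhoffSum n).comp_measurePreserving hh.measurePreserving
    have hRm : StronglyMeasurable[F.comap T] R := by
      have h1 : StronglyMeasurable[F] (birkhoffSum T h n) := by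
        have := hh.stronglyMeasurable_sum_Ico 0 n
        rw [← Finset.range_eq_Ico, Function.iterate_zero, MeasurableSpace.comap_id] at this
        exact this
      exact h1.comp_measurable (comap_measurable T)
    have hint : Integrable (R * h) m := hRL.integrable_mul hh.memLp
    have hcross : ∫ x, R x * h x ∂m = 0 := by
      have h1 := condExp_mul_of_stronglyMeasurable_left hRm hint hh.integrable
      have h2 : m[R * h | F.comap T] =ᵐ[m] 0 := by
        filter_upwards [h1, hh.condExp_eq_zero] with x hx hx2
        rw [hx, Pi.mul_apply, hx2]
        simp
      change ∫ x, (R * h) x ∂m = 0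
      rw [← integral_condExp (comap_le_of_measurable hh.measurePreserving.measurable hh.le),
        integral_congr_ae h2]
      simp
    have hR2 : ∫ x, R x ^ 2 ∂m = n * ∫ x, h x ^ 2 ∂m := by
      rw [← ih]
      exact hh.measurePreserving.integral_comp_of_aestronglyMeasurable
        (p := fun x => birkhoffSum T h n x ^ 2)
        ((hh.measurable_birkhoffSum n).pow_const 2).aestronglyMeasurable
    have hexp : ∀ x, birkhoffSum T h (n + 1) x ^ 2 = h x ^ 2 + R x ^ 2 + 2 * (R x * h x) := by
      intro x
      rw [birkhoffSum_succ']
      simp only [hR]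
      ring
    have hc2 : Integrable (fun x => 2 * (R x * h x)) m := hint.const_mul 2
    have hs2 : Integrable (fun x => h x ^ 2 + R x ^ 2) m :=
      hh.memLp.integrable_sq.add hRL.integrable_sq
    simp_rw [hexp]
    rw [integral_add hs2 hc2, integral_add hh.memLp.integrable_sq hRL.integrable_sq,
      integral_const_mul, hcross, hR2]
    push_cast
    ring

theorem integral_abs_birkhoffSum_le (hh : IsReversedMartingaleDifference F m T h) (n : ℕ) :
    ∫ x, |birkhoffSum T h n x| ∂m ≤ √(∫ x, h x ^ 2 ∂m) * √n := by
  have h0 : 0 ≤ ∫ x, h x ^ 2 ∂m := integral_nonneg fun x => sq_nonneg _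
  rw [← Real.sqrt_mul h0, mul_comm, ← hh.integral_sq_birkhoffSum]
  refine Real.le_sqrt_of_sq_le ?_
  have habs : MemLp (fun x => |birkhoffSum T h n x|) 2 m := (hh.memLp_birkhoffSum n).abs
  have hv := variance_nonneg (fun x => |birkhoffSum T h n x|) m
  rw [variance_eq_sub habs] at hv
  have h2 : ((fun x => |birkhoffSum T h n x|) ^ 2) = fun x => birkhoffSum T h n x ^ 2 := by
    ext x; simp
  rw [h2] at hv
  linarith

end IsReversedMartingaleDifference

/-! ### A telescoping estimate for cosines of partial sums -/

theorem abs_cos_taylor_le (y : ℝ) :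
    |Real.cos y - 1 + y ^ 2 / 2| ≤ min (y ^ 2) (|y| ^ 3) := by
  have h1 := Real.one_sub_sq_div_two_le_cos (x := y)
  have h2 := Real.cos_le_one y
  rw [abs_of_nonneg (by linarith)]
  refine le_min (by nlinarith [sq_nonneg y]) ?_
  rcases le_total |y| 1 with hy | hy
  · have h3 := (abs_le.1 (Real.cos_bound hy)).2
    have h4 : |y| ^ 4 ≤ |y| ^ 3 := pow_le_pow_of_le_one (abs_nonneg y) hy (by norm_num)
    have h5 : 0 ≤ |y| ^ 3 := by positivity
    linarith
  · have h4 : |y| ^ 2 ≤ |y| ^ 3 := pow_le_pow_right₀ hy (by norm_num)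
    rw [sq_abs] at h4
    nlinarith [sq_nonneg y]

theorem abs_sin_taylor_le (y : ℝ) : |Real.sin y - y| ≤ 2 * min (y ^ 2) (|y| ^ 3) := by
  have h0 : |Real.sin y - y| ≤ 2 * |y| := by
    have := abs_sub (Real.sin y) y
    have h2 : |Real.sin y| ≤ |y| := Real.abs_sin_le_abs
    linarith
  rw [mul_min_of_nonneg _ _ (by norm_num : (0 : ℝ) ≤ 2), ← sq_abs y]
  have hy0 := abs_nonneg y
  rcases le_total |y| 1 with hy | hy
  · have h3 := abs_le.1 (Real.sin_bound hy)
    have h4 : |y| ^ 5 ≤ |y| ^ 3 := pow_le_pow_of_le_one hy0 hy (by norm_num)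
    have h6 : |y| ^ 3 ≤ |y| ^ 2 := pow_le_pow_of_le_one hy0 hy (by norm_num)
    have h5 : 0 ≤ |y| ^ 3 := by positivity
    have h7 : |y ^ 3| = |y| ^ 3 := abs_pow y 3
    have h8 := abs_le.1 h7.le
    have : |Real.sin y - y| ≤ 2 * |y| ^ 3 := by
      rw [abs_le]; constructor <;> linarith
    exact le_min (by linarith) this
  · have h1 : |y| ≤ |y| ^ 2 := by nlinarith
    have h4 : |y| ^ 2 ≤ |y| ^ 3 := pow_le_pow_right₀ hy (by norm_num)
    exact le_min (by linarith) (by linarith)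

/-- Second order expansion of `y ↦ cos (A + y)`. -/
theorem abs_cos_add_taylor_le (A y : ℝ) :
    |Real.cos (A + y) - Real.cos A + y * Real.sin A + y ^ 2 / 2 * Real.cos A| ≤
      3 * min (y ^ 2) (|y| ^ 3) := by
  have h : Real.cos (A + y) - Real.cos A + y * Real.sin A + y ^ 2 / 2 * Real.cos A =
      Real.cos A * (Real.cos y - 1 + y ^ 2 / 2) - Real.sin A * (Real.sin y - y) := by
    rw [Real.cos_add]; ring
  rw [h]
  refine (abs_sub _ _).trans ?_
  rw [abs_mul, abs_mul]
  have h1 := mul_le_mul (Real.abs_cos_le_one A) (abs_cos_taylor_le y) (abs_nonneg _) zero_le_one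
  have h2 := mul_le_mul (Real.abs_sin_le_one A) (abs_sin_taylor_le y) (abs_nonneg _) zero_le_one
  linarith

theorem abs_cos_add_sub_cos_le (A y : ℝ) : |Real.cos (A + y) - Real.cos A| ≤ |y| := by
  have := Real.abs_cos_sub_cos_le (A + y) A
  simpa using this

theorem exp_sub_one_le_mul_exp (b : ℝ) : Real.exp b - 1 ≤ b * Real.exp b := by
  have h := Real.add_one_le_exp (-b)
  have h2 := mul_le_mul_of_nonneg_right h (Real.exp_pos b).le
  rw [← Real.exp_add, neg_add_cancel, Real.exp_zero] at h2
  linarith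

/-- One step of the telescoping argument: the effect of adding an increment `y` to the argument of
the cosine while multiplying by `exp b`. -/
theorem abs_exp_mul_cos_add_le {A y b a : ℝ} (hb : 0 ≤ b) (hba : b ≤ a) :
    |Real.exp b * Real.cos (A + y) - Real.cos A + y * Real.sin A +
      (y ^ 2 / 2 - b) * Real.cos A| ≤
      4 * Real.exp a * (min (y ^ 2) (|y| ^ 3) + b ^ 2 + |y| * b) := by
  have h : Real.exp b * Real.cos (A + y) - Real.cos A + y * Real.sin A +
      (y ^ 2 / 2 - b) * Real.cos A =
      (Real.cos (A + y) - Real.cos A + y * Real.sin A + y ^ 2 / 2 * Real.cos A) +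
      ((Real.exp b - 1 - b) * Real.cos A +
        (Real.exp b - 1) * (Real.cos (A + y) - Real.cos A)) := by ring
  have he1 : 0 ≤ Real.exp b - 1 - b := by linarith [Real.add_one_le_exp b]
  have hea : Real.exp b ≤ Real.exp a := Real.exp_le_exp.2 hba
  have h1a : 1 ≤ Real.exp a := Real.one_le_exp (hb.trans hba)
  have he2 : Real.exp b - 1 ≤ b * Real.exp a :=
    (exp_sub_one_le_mul_exp b).trans (mul_le_mul_of_nonneg_left hea hb)
  have he3 : Real.exp b - 1 - b ≤ b ^ 2 * Real.exp a := by
    have := mul_le_mul_of_nonneg_left he2 hb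
    have := exp_sub_one_le_mul_exp b
    nlinarith
  have hm : 0 ≤ min (y ^ 2) (|y| ^ 3) := le_min (sq_nonneg _) (by positivity)
  have e1 : |(Real.exp b - 1 - b) * Real.cos A| ≤ b ^ 2 * Real.exp a := by
    rw [abs_mul, abs_of_nonneg he1]
    exact (mul_le_of_le_one_right he1 (Real.abs_cos_le_one A)).trans he3
  have e2 : |(Real.exp b - 1) * (Real.cos (A + y) - Real.cos A)| ≤ b * Real.exp a * |y| := by
    rw [abs_mul, abs_of_nonneg (by linarith)]
    exact mul_le_mul he2 (abs_cos_add_sub_cos_le A y) (abs_nonneg _) (by positivity)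
  rw [h]
  refine (abs_add_le _ _).trans ?_
  have e3 := abs_add_le ((Real.exp b - 1 - b) * Real.cos A)
    ((Real.exp b - 1) * (Real.cos (A + y) - Real.cos A))
  have e4 := abs_cos_add_taylor_le A y
  have e5 := mul_le_mul_of_nonneg_right h1a hm
  have e6 : 0 ≤ b ^ 2 * Real.exp a := by positivity
  have e7 : 0 ≤ b * Real.exp a * |y| := by positivity
  nlinarith

theorem abs_exp_mul_cos_add_sub_le {A y b a : ℝ} (hb : 0 ≤ b) (hba : b ≤ a) :
    |Real.exp b * Real.cos (A + y) - Real.cos A| ≤ Real.exp a * (|y| + b) := by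
  have hea : Real.exp b ≤ Real.exp a := Real.exp_le_exp.2 hba
  have he2 : Real.exp b - 1 ≤ b * Real.exp a :=
    (exp_sub_one_le_mul_exp b).trans (mul_le_mul_of_nonneg_left hea hb)
  have he0 : 0 ≤ Real.exp b - 1 := by linarith [Real.add_one_le_exp b]
  have h : Real.exp b * Real.cos (A + y) - Real.cos A =
      Real.exp b * (Real.cos (A + y) - Real.cos A) + (Real.exp b - 1) * Real.cos A := by ring
  rw [h]
  refine (abs_add_le _ _).trans ?_
  rw [abs_mul, abs_mul, abs_of_pos (Real.exp_pos b), abs_of_nonneg he0]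
  have h1 := mul_le_mul hea (abs_cos_add_sub_cos_le A y) (abs_nonneg _) (Real.exp_pos a).le
  have h2 := mul_le_of_le_one_right he0 (Real.abs_cos_le_one A)
  linarith

/-- Collects the constants of the two error terms in `abs_exp_mul_cos_sum_sub_le`. -/
theorem telescoping_error_le {t a P Sw Sm u v : ℝ} (ha0 : 0 ≤ a) (hP0 : 0 ≤ P) (hSw0 : 0 ≤ Sw)
    (hSm0 : 0 ≤ Sm) (hu0 : 0 ≤ u) (hv0 : 0 ≤ v) :
    4 * Real.exp (2 * a) * ((t ^ 2 + t ^ 2 * |t|) * Sm + a ^ 2 * v + a * |t| * u) +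
      Real.exp (2 * a) * t ^ 2 * (Sw + 2 * (P * v) + P * (|t| * u) + P * (a * v)) ≤
    4 * Real.exp (2 * a) * (t ^ 2 + t ^ 2 * |t| + a ^ 2 + a * |t| + t ^ 2 * a) *
      (Sw + Sm + (1 + P) * u + (1 + P) * v) := by
  have hrw : 4 * Real.exp (2 * a) * ((t ^ 2 + t ^ 2 * |t|) * Sm + a ^ 2 * v + a * |t| * u) +
      Real.exp (2 * a) * t ^ 2 * (Sw + 2 * (P * v) + P * (|t| * u) + P * (a * v)) =
      Real.exp (2 * a) * (4 * ((t ^ 2 + t ^ 2 * |t|) * Sm + a ^ 2 * v + a * |t| * u) +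
        t ^ 2 * (Sw + 2 * (P * v) + P * (|t| * u) + P * (a * v))) := by ring
  rw [hrw, mul_comm (4 : ℝ) (Real.exp (2 * a)), mul_assoc (Real.exp (2 * a)),
    mul_assoc (Real.exp (2 * a))]
  refine mul_le_mul_of_nonneg_left ?_ (Real.exp_pos _).le
  rw [← sub_nonneg]
  have : 0 ≤ |t| := abs_nonneg t
  have hdiff : 4 * (t ^ 2 + t ^ 2 * |t| + a ^ 2 + a * |t| + t ^ 2 * a) *
      (Sw + Sm + (1 + P) * u + (1 + P) * v) -
      (4 * ((t ^ 2 + t ^ 2 * |t|) * Sm + a ^ 2 * v + a * |t| * u) +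
        t ^ 2 * (Sw + 2 * (P * v) + P * (|t| * u) + P * (a * v))) =
      3 * t ^ 2 * Sw + 4 * (t ^ 2 * |t| + a ^ 2 + a * |t| + t ^ 2 * a) * Sw +
      4 * (a ^ 2 + a * |t| + t ^ 2 * a) * Sm +
      4 * (t ^ 2 + a ^ 2 + t ^ 2 * a) * (1 + P) * u + 4 * t ^ 2 * |t| * u +
      3 * t ^ 2 * |t| * P * u + 4 * a * |t| * P * u +
      4 * (t ^ 2 * |t| + a * |t|) * (1 + P) * v + 4 * t ^ 2 * v + 2 * t ^ 2 * P * v +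
      4 * a ^ 2 * P * v + 4 * t ^ 2 * a * v + 3 * t ^ 2 * a * P * v := by ring
  rw [hdiff]
  positivity

/-- Comparison of `cos (t (x₀ + ⋯ + xₙ₋₁) / √n + θ)` with `exp (-t² s / 2) cos θ`: up to terms
linear in the increments, which are martingale differences in the application, the difference is
controlled once `x² - s` is a small perturbation `w` of a bounded coboundary `p (j + 1) - p j`. The
bound comes from telescoping `exp (a (n - j) / n) cos (t Rⱼ / √n + θ)`, where `a = t² s / 2` and
`Rⱼ = xⱼ + ⋯ + xₙ₋₁`, and a summation by parts for the coboundary. -/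
theorem abs_exp_mul_cos_sum_sub_le {t s : ℝ} (θ : ℝ) (hs : 0 ≤ s) {n : ℕ} (hn : 1 ≤ n)
    {x p w : ℕ → ℝ} {P : ℝ} (hP : ∀ j, |p j| ≤ P)
    (hx : ∀ j, x j ^ 2 - s = p (j + 1) - p j + w j) :
    |Real.exp (t ^ 2 * s / 2) * Real.cos (t * (∑ j ∈ Finset.range n, x j) / √n + θ) - Real.cos θ +
      ∑ j ∈ Finset.range n, Real.exp (t ^ 2 * s / 2 * (n - (j + 1 : ℕ)) / n) *
        Real.sin (t * (∑ i ∈ Finset.Ico (j + 1) n, x i) / √n + θ) * (t / √n) * x j| ≤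
    4 * Real.exp (2 * (t ^ 2 * s / 2)) *
      (t ^ 2 + |t| ^ 3 + (t ^ 2 * s / 2) ^ 2 + t ^ 2 * s / 2 * |t| + t ^ 2 * (t ^ 2 * s / 2)) *
      ((∑ j ∈ Finset.range n, (|w j| + min (x j ^ 2) (|x j| ^ 3 / √n))) / n +
        (1 + P) / √n * ((∑ j ∈ Finset.range n, |x j|) / n) + (1 + P) / n) := by
  have hP0 : 0 ≤ P := (abs_nonneg _).trans (hP 0)
  have hn0 : (0 : ℝ) < n := by exact_mod_cast hn
  have hsn : 0 < √(n : ℝ) := Real.sqrt_pos.2 hn0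
  have hsq : √(n : ℝ) * √n = n := Real.mul_self_sqrt hn0.le
  set a := t ^ 2 * s / 2 with ha
  have ha0 : 0 ≤ a := by positivity
  set b := a / n with hb
  have hb0 : 0 ≤ b := by positivity
  have hba : b ≤ a := div_le_self ha0 (by exact_mod_cast hn)
  set y : ℕ → ℝ := fun j => t * x j / √n with hy
  set A : ℕ → ℝ := fun j => t * (∑ i ∈ Finset.Ico j n, x i) / √n + θ with hA
  set E : ℕ → ℝ := fun j => Real.exp (a * (n - j) / n) with hE
  set e : ℕ → ℝ := fun j => E j * Real.cos (A j) with he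
  have hE0 : ∀ j, 0 < E j := fun j => Real.exp_pos _
  have hEa : ∀ j, E j ≤ Real.exp a := fun j => by
    refine Real.exp_le_exp.2 ?_
    rw [div_le_iff₀ hn0]
    exact mul_le_mul_of_nonneg_left (by linarith [Nat.cast_nonneg (α := ℝ) j]) ha0
  have hEs : ∀ j, E j = E (j + 1) * Real.exp b := fun j => by
    simp only [hE, hb]
    rw [← Real.exp_add]
    congr 1
    push_cast
    field_simp
    ring
  have hAs : ∀ j < n, A j = A (j + 1) + y j := fun j hj => by
    simp only [hA, hy]
    rw [Finset.sum_eq_sum_Ico_succ_bot hj]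
    ring
  have hes : ∀ j < n, e j - e (j + 1) =
      E (j + 1) * (Real.exp b * Real.cos (A (j + 1) + y j) - Real.cos (A (j + 1))) := fun j hj => by
    simp only [he]
    rw [← hAs j hj, hEs j]
    ring
  have he_le : ∀ j, |e j| ≤ Real.exp a := fun j => by
    rw [he, abs_mul, abs_of_pos (hE0 j)]
    exact (mul_le_of_le_one_right (hE0 j).le (Real.abs_cos_le_one _)).trans (hEa j)
  have hes_le : ∀ j < n, |e j - e (j + 1)| ≤ Real.exp (2 * a) * (|y j| + b) := fun j hj => by
    rw [hes j hj, abs_mul, abs_of_pos (hE0 _), two_mul, Real.exp_add, mul_assoc]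
    exact mul_le_mul (hEa _) (abs_exp_mul_cos_add_sub_le hb0 hba) (abs_nonneg _)
      (Real.exp_pos _).le
  have hyq : ∀ j, y j ^ 2 / 2 - b = t ^ 2 / (2 * n) * (p (j + 1) - p j + w j) := fun j => by
    rw [← hx j]
    simp only [hy, hb, ha]
    rw [div_pow, Real.sq_sqrt hn0.le]
    field_simp
  -- The remainder of one step.
  set ρ : ℕ → ℝ := fun j => Real.exp b * Real.cos (A (j + 1) + y j) - Real.cos (A (j + 1)) +
      y j * Real.sin (A (j + 1)) + (y j ^ 2 / 2 - b) * Real.cos (A (j + 1)) with hρ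
  have hmin : ∀ j, min (y j ^ 2) (|y j| ^ 3) ≤
      (t ^ 2 + |t| ^ 3) * (min (x j ^ 2) (|x j| ^ 3 / √n) / n) := fun j => by
    have h1 : y j ^ 2 = t ^ 2 * (x j ^ 2 / n) := by
      simp only [hy]; rw [div_pow, Real.sq_sqrt hn0.le]; ring
    have h2 : |y j| ^ 3 = |t| ^ 3 * (|x j| ^ 3 / √n / n) := by
      simp only [hy]
      rw [abs_div, abs_mul, abs_of_pos hsn, div_pow, mul_pow, pow_succ √(n : ℝ) 2,
        Real.sq_sqrt hn0.le]
      field_simp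
    rw [h1, h2]
    have ht2 : 0 ≤ t ^ 2 := sq_nonneg t
    have ht3 : 0 ≤ |t| ^ 3 := by positivity
    rcases min_cases (x j ^ 2) (|x j| ^ 3 / √n) with ⟨h, -⟩ | ⟨h, -⟩
    · rw [h]
      refine (min_le_left _ _).trans (mul_le_mul_of_nonneg_right (by linarith) (by positivity))
    · rw [h]
      refine (min_le_right _ _).trans (mul_le_mul_of_nonneg_right (by linarith) (by positivity))
  -- Telescoping, followed by a summation by parts against the coboundary.
  have hident : Real.exp a * Real.cos (t * (∑ j ∈ Finset.range n, x j) / √n + θ) - Real.cos θ +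
      ∑ j ∈ Finset.range n, E (j + 1) * Real.sin (A (j + 1)) * (t / √n) * x j =
      ∑ j ∈ Finset.range n, E (j + 1) * ρ j -
        t ^ 2 / (2 * n) * (∑ j ∈ Finset.range n, e (j + 1) * w j +
          (e n * p n - e 0 * p 0 + ∑ j ∈ Finset.range n, (e j - e (j + 1)) * p j)) := by
    have h0 : Real.exp a * Real.cos (t * (∑ j ∈ Finset.range n, x j) / √n + θ) = e 0 := by
      simp only [he, hE, hA]
      rw [Nat.cast_zero, sub_zero, mul_div_cancel_right₀ _ hn0.ne', Finset.range_eq_Ico]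
    have h1 : Real.cos θ = e n := by
      simp [he, hE, hA]
    have h2 : e 0 - e n = ∑ j ∈ Finset.range n, (e j - e (j + 1)) :=
      (Finset.sum_range_sub' e n).symm
    have h3 : e n * p n - e 0 * p 0 =
        ∑ j ∈ Finset.range n, (e (j + 1) * p (j + 1) - e j * p j) :=
      (Finset.sum_range_sub (fun j => e j * p j) n).symm
    rw [h0, h1, h2, h3, ← Finset.sum_add_distrib,
      ← Finset.sum_add_distrib, ← Finset.sum_add_distrib, Finset.mul_sum,
      ← Finset.sum_sub_distrib]
    refine Finset.sum_congr rfl fun j hj => ?_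
    have h4 := hes j (Finset.mem_range.1 hj)
    have h5 := hyq j
    have h6 : t / √n * x j = y j := by simp only [hy]; ring
    simp only [hρ]
    rw [mul_assoc _ (t / √n), h6, h5]
    have h7 : e (j + 1) = E (j + 1) * Real.cos (A (j + 1)) := rfl
    linear_combination h4 - t ^ 2 / (2 * n) * (p (j + 1) - p j + w j) * h7
  rw [hident]
  set Sw := (∑ j ∈ Finset.range n, |w j|) / n with hSw
  set Sm := (∑ j ∈ Finset.range n, min (x j ^ 2) (|x j| ^ 3 / √n)) / n with hSm
  set Sx := (∑ j ∈ Finset.range n, |x j|) / n with hSx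
  have hSw0 : 0 ≤ Sw := by positivity
  have hSm0 : 0 ≤ Sm :=
    div_nonneg (Finset.sum_nonneg fun j _ => le_min (sq_nonneg _) (by positivity)) hn0.le
  have hSx0 : 0 ≤ Sx := by positivity
  have hysum : ∑ j ∈ Finset.range n, |y j| = |t| * (n * (Sx / √n)) := by
    simp only [hy, hSx]
    simp_rw [abs_div, abs_mul, abs_of_pos hsn]
    rw [← Finset.sum_div, ← Finset.mul_sum]
    field_simp
  have hnb : n * b = a := by rw [hb]; field_simp
  have b1 : |∑ j ∈ Finset.range n, E (j + 1) * ρ j| ≤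
      4 * Real.exp (2 * a) * ((t ^ 2 + |t| ^ 3) * Sm + a ^ 2 / n + a * |t| * (Sx / √n)) := by
    calc |∑ j ∈ Finset.range n, E (j + 1) * ρ j|
        ≤ ∑ j ∈ Finset.range n, |E (j + 1) * ρ j| := Finset.abs_sum_le_sum_abs _ _
      _ ≤ ∑ j ∈ Finset.range n, 4 * Real.exp (2 * a) *
          ((t ^ 2 + |t| ^ 3) * (min (x j ^ 2) (|x j| ^ 3 / √n) / n) + b ^ 2 + |y j| * b) := by
          refine Finset.sum_le_sum fun j _ => ?_
          rw [abs_mul, abs_of_pos (hE0 _), two_mul, Real.exp_add]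
          have h1 := abs_exp_mul_cos_add_le (A := A (j + 1)) (y := y j) hb0 hba
          have h2 := mul_le_mul (hEa (j + 1)) h1 (abs_nonneg _) (Real.exp_pos _).le
          refine h2.trans ?_
          have h3 := mul_le_mul_of_nonneg_left (hmin j)
            (show 0 ≤ 4 * (Real.exp a * Real.exp a) by positivity)
          linarith
      _ = _ := by
          rw [← Finset.mul_sum, Finset.sum_add_distrib, Finset.sum_add_distrib, ← Finset.mul_sum,
            ← Finset.sum_div, ← Finset.sum_mul, hysum, Finset.sum_const, Finset.card_range,
            nsmul_eq_mul]
          congr 1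
          rw [← hSm]
          have h1 : n * b ^ 2 = a ^ 2 / n := by rw [hb]; field_simp
          rw [h1]
          linear_combination |t| * (Sx / √n) * hnb
  have b2 : |∑ j ∈ Finset.range n, e (j + 1) * w j| ≤ Real.exp a * (n * Sw) := by
    calc |∑ j ∈ Finset.range n, e (j + 1) * w j|
        ≤ ∑ j ∈ Finset.range n, |e (j + 1) * w j| := Finset.abs_sum_le_sum_abs _ _
      _ ≤ ∑ j ∈ Finset.range n, Real.exp a * |w j| := by
          refine Finset.sum_le_sum fun j _ => ?_
          rw [abs_mul]
          exact mul_le_mul_of_nonneg_right (he_le _) (abs_nonneg _)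
      _ = _ := by rw [← Finset.mul_sum, hSw]; field_simp
  have b3 : |∑ j ∈ Finset.range n, (e j - e (j + 1)) * p j| ≤
      Real.exp (2 * a) * P * (|t| * (n * (Sx / √n)) + a) := by
    calc |∑ j ∈ Finset.range n, (e j - e (j + 1)) * p j|
        ≤ ∑ j ∈ Finset.range n, |(e j - e (j + 1)) * p j| := Finset.abs_sum_le_sum_abs _ _
      _ ≤ ∑ j ∈ Finset.range n, Real.exp (2 * a) * P * (|y j| + b) := by
          refine Finset.sum_le_sum fun j hj => ?_
          rw [abs_mul]
          have := mul_le_mul (hes_le j (Finset.mem_range.1 hj)) (hP j) (abs_nonneg _)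
            (by positivity)
          linarith
      _ = _ := by
          rw [← Finset.mul_sum, Finset.sum_add_distrib, hysum, Finset.sum_const,
            Finset.card_range, nsmul_eq_mul, hnb]
  have b4 : |e n * p n - e 0 * p 0| ≤ 2 * Real.exp a * P := by
    refine (abs_sub _ _).trans ?_
    rw [abs_mul (e n), abs_mul (e 0)]
    have h1 := mul_le_mul (he_le n) (hP n) (abs_nonneg _) (Real.exp_pos a).le
    have h2 := mul_le_mul (he_le 0) (hP 0) (abs_nonneg _) (Real.exp_pos a).le
    linarith
  have hexp : Real.exp a ≤ Real.exp (2 * a) := Real.exp_le_exp.2 (by linarith)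
  have b5 : |∑ j ∈ Finset.range n, e (j + 1) * w j +
      (e n * p n - e 0 * p 0 + ∑ j ∈ Finset.range n, (e j - e (j + 1)) * p j)| ≤
      Real.exp (2 * a) * (n * Sw + 2 * P + P * (|t| * (n * (Sx / √n)) + a)) := by
    have h1 := abs_add_le (∑ j ∈ Finset.range n, e (j + 1) * w j)
      (e n * p n - e 0 * p 0 + ∑ j ∈ Finset.range n, (e j - e (j + 1)) * p j)
    have h2 := abs_add_le (e n * p n - e 0 * p 0) (∑ j ∈ Finset.range n, (e j - e (j + 1)) * p j)
    have h3 := mul_le_mul_of_nonneg_right hexp (show 0 ≤ n * Sw + 2 * P by positivity)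
    linarith
  have b6 : |t ^ 2 / (2 * n) * (∑ j ∈ Finset.range n, e (j + 1) * w j +
      (e n * p n - e 0 * p 0 + ∑ j ∈ Finset.range n, (e j - e (j + 1)) * p j))| ≤
      Real.exp (2 * a) * t ^ 2 * (Sw + 2 * (P / n) + P * (|t| * (Sx / √n)) + P * (a / n)) := by
    rw [abs_mul, abs_of_nonneg (show 0 ≤ t ^ 2 / (2 * (n : ℝ)) by positivity)]
    refine (mul_le_mul_of_nonneg_left b5 (by positivity)).trans ?_
    have h1 : t ^ 2 / (2 * (n : ℝ)) *
        (Real.exp (2 * a) * (n * Sw + 2 * P + P * (|t| * (n * (Sx / √n)) + a))) =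
        (Real.exp (2 * a) * t ^ 2 *
          (Sw + 2 * (P / n) + P * (|t| * (Sx / √n)) + P * (a / n))) / 2 := by
      field_simp
      ring
    rw [h1]
    refine half_le_self ?_
    positivity
  refine (abs_sub _ _).trans ((add_le_add b1 b6).trans ?_)
  have hfin : (∑ j ∈ Finset.range n, (|w j| + min (x j ^ 2) (|x j| ^ 3 / √n))) / n +
        (1 + P) / √n * ((∑ j ∈ Finset.range n, |x j|) / n) + (1 + P) / n =
      Sw + Sm + (1 + P) * (Sx / √n) + (1 + P) * (1 / n) := by
    rw [Finset.sum_add_distrib, add_div]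
    ring
  rw [hfin]
  have ht3 : |t| ^ 3 = t ^ 2 * |t| := by rw [← sq_abs t]; ring
  rw [ht3]
  set u := Sx / √n with hu
  set v := 1 / (n : ℝ) with hv
  have hu0 : 0 ≤ u := by positivity
  have hv0 : 0 ≤ v := by positivity
  have e1 : a ^ 2 / n = a ^ 2 * v := by rw [hv]; ring
  have e2 : P / n = P * v := by rw [hv]; ring
  have e3 : a / n = a * v := by rw [hv]; ring
  rw [e1, e2, e3]
  exact telescoping_error_le ha0 hP0 hSw0 hSm0 hu0 hv0

/-! ### Approximation by bounded coboundaries -/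

section Coboundary

variable {X : Type*} {mX : MeasurableSpace X} {m : Measure X} [IsProbabilityMeasure m] {T : X → X}

theorem integral_abs_le_eLpNorm_two {u : X → ℝ} (hu : MemLp u 2 m) :
    ∫ x, |u x| ∂m ≤ (eLpNorm u 2 m).toReal := by
  have h1 := integral_norm_eq_lintegral_enorm hu.aestronglyMeasurable
  simp only [Real.norm_eq_abs] at h1
  rw [h1, ← eLpNorm_one_eq_lintegral_enorm]
  exact ENNReal.toReal_mono hu.eLpNorm_ne_top
    (eLpNorm_le_eLpNorm_of_exponent_le one_le_two hu.aestronglyMeasurable)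

/-- The mean ergodic theorem for a square integrable function of zero mean. -/
theorem Ergodic.tendsto_integral_abs_average (hT : Ergodic T m) {v : X → ℝ}
    (hv : MemLp v 2 m) (hv0 : ∫ x, v x ∂m = 0) :
    Tendsto (fun N : ℕ => ∫ x, |(N : ℝ)⁻¹ * ∑ n ∈ Finset.range N, v (T^[n] x)| ∂m)
      atTop (𝓝 0) := by
  have hTm := hT.toMeasurePreserving
  set U : Lp ℝ 2 m →ₗᵢ[ℝ] Lp ℝ 2 m := Lp.compMeasurePreservingₗᵢ ℝ T hTm with hU
  set V : Lp ℝ 2 m := hv.toLp v with hV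
  have hlim := U.toContinuousLinearMap.tendsto_birkhoffAverage_orthogonalProjection
    U.norm_toContinuousLinearMap_le V
  have hproj : (U.toContinuousLinearMap.eqLocus
      (1 : Lp ℝ 2 m →L[ℝ] Lp ℝ 2 m)).orthogonalProjectionOnto V = 0 := by
    rw [Submodule.orthogonalProjectionOnto_eq_zero_iff, Submodule.mem_orthogonal]
    intro w hw
    have hw' : U w = w := by simpa using hw
    have hw2 : (w : X → ℝ) ∘ T =ᵐ[m] w := by
      have h1 : U w =ᵐ[m] (w : X → ℝ) ∘ T := Lp.coeFn_compMeasurePreserving w hTm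
      rw [hw'] at h1
      exact h1.symm
    obtain ⟨c, hc⟩ := hT.ae_eq_const_of_ae_eq_comp_ae (Lp.aestronglyMeasurable w) hw2
    rw [L2.inner_def]
    have h2 : ∀ᵐ x ∂m, inner ℝ (w x) (V x) = c * v x := by
      filter_upwards [hc, hv.coeFn_toLp] with x h1 h2
      rw [h1, h2, real_inner_eq_re_inner, RCLike.inner_apply]
      simp [mul_comm]
    rw [integral_congr_ae h2, integral_const_mul, hv0, mul_zero]
  -- By ergodicity the invariant vectors are constants, so the projection of `V` vanishes.
  rw [hproj] at hlim
  have hlim0 : Tendsto (fun N => ‖birkhoffAverage ℝ U id N V‖) atTop (𝓝 0) := by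
    simpa using hlim.norm
  have hiter : ∀ n : ℕ, U^[n] V =ᵐ[m] fun x => v (T^[n] x) := by
    intro n
    have h1 : U^[n] V = Lp.compMeasurePreserving T^[n] (hTm.iterate n) V := by
      rw [← Lp.compMeasurePreserving_iterate]
      rfl
    rw [h1]
    refine (Lp.coeFn_compMeasurePreserving V (hTm.iterate n)).trans ?_
    exact (hTm.iterate n).quasiMeasurePreserving.ae_eq_comp hv.coeFn_toLp
  refine squeeze_zero (fun N => integral_nonneg fun x => abs_nonneg _) (fun N => ?_) hlim0
  have havg : (birkhoffAverage ℝ U (id : Lp ℝ 2 m → Lp ℝ 2 m) N V : Lp ℝ 2 m) =ᵐ[m]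
      fun x => (N : ℝ)⁻¹ * ∑ n ∈ Finset.range N, v (T^[n] x) := by
    simp only [birkhoffAverage, birkhoffSum, id]
    filter_upwards [Lp.coeFn_smul (N : ℝ)⁻¹ (∑ n ∈ Finset.range N, U^[n] V),
      Lp.coeFn_finsetSum (Finset.range N) (fun n => U^[n] V), ae_all_iff.2 hiter] with x h1 h2 h3
    rw [h1, Pi.smul_apply, h2, smul_eq_mul, Finset.sum_apply]
    congr 1
    exact Finset.sum_congr rfl fun n _ => h3 n
  have h5 : ∫ x, |(N : ℝ)⁻¹ * ∑ n ∈ Finset.range N, v (T^[n] x)| ∂m =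
      ∫ x, |(birkhoffAverage ℝ U (id : Lp ℝ 2 m → Lp ℝ 2 m) N V : Lp ℝ 2 m) x| ∂m :=
    integral_congr_ae (by filter_upwards [havg] with x hx; rw [hx])
  rw [h5]
  exact integral_abs_le_eLpNorm_two (Lp.memLp _)

/-- An integrable function of zero mean over an ergodic system is, up to a small error in `L¹`, a
coboundary `p ∘ T - p` with `p` bounded. -/
theorem Ergodic.exists_bounded_coboundary (hT : Ergodic T m) {v : X → ℝ}
    (hv : Integrable v m) (hv0 : ∫ x, v x ∂m = 0) {ε : ℝ} (hε : 0 < ε) :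
    ∃ p : X → ℝ, Measurable p ∧ (∃ P, ∀ x, |p x| ≤ P) ∧
      ∫ x, |v x - (p (T x) - p x)| ∂m < ε := by
  have hTm := hT.toMeasurePreserving
  obtain ⟨g, hg, hgL⟩ := (memLp_one_iff_integrable.2 hv).exists_simpleFunc_eLpNorm_sub_lt
    ENNReal.one_ne_top (show ENNReal.ofReal (ε / 4) ≠ 0 by simpa using hε)
  have hgi : Integrable g m := memLp_one_iff_integrable.1 hgL
  have hvg : ∫ x, |v x - g x| ∂m < ε / 4 := by
    have h1 := integral_norm_eq_lintegral_enorm (hv.sub hgi).aestronglyMeasurable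
    simp only [Real.norm_eq_abs, Pi.sub_apply] at h1
    rw [h1]
    rw [eLpNorm_one_eq_lintegral_enorm] at hg
    simp only [Pi.sub_apply] at hg
    exact (ENNReal.toReal_lt_toReal hg.ne_top ENNReal.ofReal_ne_top).2 hg |>.trans_eq
      (ENNReal.toReal_ofReal (by positivity))
  set c := ∫ x, g x ∂m with hc
  have hcs : |c| < ε / 4 := by
    have h1 : c = -∫ x, (v x - g x) ∂m := by
      rw [integral_sub hv hgi, hv0, zero_sub, neg_neg]
    rw [h1, abs_neg]
    exact (abs_integral_le_integral_abs).trans_lt hvg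
  set u : X → ℝ := fun x => g x - c with hu
  have hum : Measurable u := g.measurable.sub_const c
  obtain ⟨G, hG⟩ : ∃ G, ∀ x, |g x| ≤ G := by
    obtain ⟨G, hG⟩ := g.exists_forall_norm_le
    exact ⟨G, hG⟩
  have huB : ∀ x, |u x| ≤ G + |c| := fun x =>
    (abs_sub _ _).trans (by linarith [hG x])
  have huL : MemLp u 2 m :=
    MemLp.of_bound hum.aestronglyMeasurable (G + |c|) (Eventually.of_forall huB)
  have hu0 : ∫ x, u x ∂m = 0 := by
    simp only [hu]
    rw [integral_sub hgi (integrable_const c)]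
    simp [hc]
  have hlim := hT.tendsto_integral_abs_average huL hu0
  obtain ⟨N, hN, hN1⟩ := ((hlim.eventually_lt_const (show 0 < ε / 4 by positivity)).and
    (eventually_ge_atTop 1)).exists
  have hN0 : (N : ℝ) ≠ 0 := by
    have : N ≠ 0 := by omega
    exact_mod_cast this
  -- `u` minus its `N`-th ergodic average is the coboundary of an average of Birkhoff sums.
  set p : X → ℝ := fun x => -((N : ℝ)⁻¹ * ∑ n ∈ Finset.range N, birkhoffSum T u n x) with hp
  have hbm : ∀ n, Measurable (birkhoffSum T u n) := fun n =>
    Finset.measurable_sum _ fun k _ => hum.comp (hTm.measurable.iterate k)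
  have hpm : Measurable p :=
    ((Finset.measurable_sum _ fun n _ => hbm n).const_mul _).neg
  have hcob : ∀ x, p (T x) - p x = u x - (N : ℝ)⁻¹ * ∑ n ∈ Finset.range N, u (T^[n] x) := by
    intro x
    have h1 : ∑ n ∈ Finset.range N, birkhoffSum T u n (T x) =
        ∑ n ∈ Finset.range N, birkhoffSum T u n x +
          (∑ n ∈ Finset.range N, u (T^[n] x) - N * u x) := by
      have : ∀ n, birkhoffSum T u n (T x) = birkhoffSum T u n x + (u (T^[n] x) - u x) := fun n => by
        rw [← birkhoffSum_apply_sub_birkhoffSum]; ring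
      simp_rw [this]
      rw [Finset.sum_add_distrib, Finset.sum_sub_distrib]
      simp
    simp only [hp]
    rw [h1]
    field_simp
    ring
  refine ⟨p, hpm, ?_, ?_⟩
  · refine ⟨(N : ℝ)⁻¹ * ∑ n ∈ Finset.range N, (n * (G + |c|)), fun x => ?_⟩
    simp only [hp, abs_neg]
    rw [abs_mul, abs_of_nonneg (by positivity : (0 : ℝ) ≤ (N : ℝ)⁻¹)]
    refine mul_le_mul_of_nonneg_left ?_ (by positivity)
    refine (Finset.abs_sum_le_sum_abs _ _).trans (Finset.sum_le_sum fun n _ => ?_)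
    refine (Finset.abs_sum_le_sum_abs _ _).trans ((Finset.sum_le_sum fun k _ => huB _).trans ?_)
    rw [Finset.sum_const, Finset.card_range, nsmul_eq_mul]
  · have hai : Integrable (fun x => (N : ℝ)⁻¹ * ∑ n ∈ Finset.range N, u (T^[n] x)) m :=
      (integrable_finsetSum _ fun n _ => (hTm.iterate n).integrable_comp_of_integrable
        (huL.integrable one_le_two)).const_mul _
    have hle : ∀ x, |v x - (p (T x) - p x)| ≤
        |v x - g x| + |(N : ℝ)⁻¹ * ∑ n ∈ Finset.range N, u (T^[n] x)| + |c| := by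
      intro x
      rw [hcob]
      have h1 : v x - (u x - (N : ℝ)⁻¹ * ∑ n ∈ Finset.range N, u (T^[n] x)) =
          (v x - g x) + (N : ℝ)⁻¹ * ∑ n ∈ Finset.range N, u (T^[n] x) + c := by
        simp only [hu]; ring
      rw [h1]
      exact abs_add_three _ _ _
    have hi1 : Integrable (fun x => |v x - g x|) m := (hv.sub hgi).abs
    have hi2 := hi1.add hai.abs
    have hint := integral_mono_of_nonneg (Eventually.of_forall fun x => abs_nonneg _)
      (hi2.add (integrable_const |c|)) (Eventually.of_forall hle)
    refine hint.trans_lt ?_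
    rw [integral_add' hi2 (integrable_const |c|), integral_add' hi1 hai.abs]
    simp only [integral_const, probReal_univ, smul_eq_mul, one_mul]
    have : ∫ x, |(N : ℝ)⁻¹ * ∑ n ∈ Finset.range N, u (T^[n] x)| ∂m < ε / 4 := hN
    linarith

end Coboundary

/-! ### The quenched central limit theorem -/

namespace IsReversedMartingaleDifference

variable {X : Type*} {F : MeasurableSpace X} {mX : MeasurableSpace X} {m : Measure X}
  {T : X → X} {h : X → ℝ}

/-- The Lindeberg condition. -/
theorem tendsto_integral_min_sq_cube (hh : IsReversedMartingaleDifference F m T h) :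
    Tendsto (fun K : ℕ => ∫ x, min (h x ^ 2) (|h x| ^ 3 / √K) ∂m) atTop (𝓝 0) := by
  have h1 : Tendsto (fun K : ℕ => ∫ x, min (h x ^ 2) (|h x| ^ 3 / √K) ∂m) atTop
      (𝓝 (∫ _, (0 : ℝ) ∂m)) := by
    refine tendsto_integral_of_dominated_convergence (fun x => h x ^ 2) (fun K => ?_)
      hh.memLp.integrable_sq (fun K => Eventually.of_forall fun x => ?_)
      (Eventually.of_forall fun x => ?_)
    · exact ((hh.measurable.pow_const 2).min
        ((hh.measurable.abs.pow_const 3).div_const _)).aestronglyMeasurable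
    · rw [Real.norm_eq_abs, abs_of_nonneg (le_min (sq_nonneg _) (by positivity))]
      exact min_le_left _ _
    · have h2 : Tendsto (fun K : ℕ => |h x| ^ 3 / √(K : ℝ)) atTop (𝓝 0) :=
        (Real.tendsto_sqrt_atTop.comp tendsto_natCast_atTop_atTop).const_div_atTop _
      refine squeeze_zero (fun K => le_min (sq_nonneg _) (by positivity))
        (fun K => min_le_right _ _) h2
  simpa using h1

variable [IsProbabilityMeasure m]

/-- If `κ g - γ` differs from a function with vanishing conditional expectation by at most Birkhoff
sums of integrable functions, then `Lⁿ g` is controlled by ergodic sums of the transfer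
operator `L`. -/
theorem abs_transfer_iterate_sub_le (hh : IsReversedMartingaleDifference F m T h) {n : ℕ}
    {g M u v : X → ℝ} (hg : Integrable g m) (hM : Integrable M m) (hu : Integrable u m)
    (hv : Integrable v m) (hM0 : m[M | F.comap T^[n]] =ᵐ[m] 0) (hgm : Measurable g)
    {κ γ α β d : ℝ}
    (hle : ∀ x, |κ * g x - γ + M x| ≤ α * ∑ j ∈ Finset.range n, u (T^[j] x) +
      β * ∑ j ∈ Finset.range n, v (T^[j] x) + d) (hn : 1 ≤ n) :
    ∀ᵐ x ∂m, |κ * (transfer m F T)^[n] g x - γ| ≤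
      α * (∑ l ∈ Finset.range n, (transfer m F T)^[l] (transfer m F T u)) x +
      β * (∑ l ∈ Finset.range n, (transfer m F T)^[l] (transfer m F T v)) x + d := by
  have hT := hh.measurePreserving
  set L := transfer m F T with hL
  have hnle : F.comap T^[n] ≤ mX := hh.comap_iterate_le n
  -- conditional expectation of Birkhoff sums
  have hsum : ∀ u : X → ℝ, Integrable u m →
      m[fun x => ∑ j ∈ Finset.range n, u (T^[j] x) | F.comap T^[n]] =ᵐ[m]
        (∑ l ∈ Finset.range n, L^[l] (L u)) ∘ T^[n] := by
    intro u hu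
    have h1 := condExp_finsetSum (μ := m) (s := Finset.range n) (f := fun j => u ∘ T^[j])
      (fun j _ => (hT.iterate j).integrable_comp_of_integrable hu) (F.comap T^[n])
    have h2 : ∀ᵐ x ∂m, ∀ j < n, L^[n - j] u (T^[n] x) = (m[u ∘ T^[j] | F.comap T^[n]]) x := by
      refine ae_all_iff.2 fun j => ?_
      by_cases hj : j < n
      · filter_upwards [transfer_iterate_comp_iterate_of_lt hT hh.le hh.comap_le hu hj]
          with x hx _ using hx
      · exact Eventually.of_forall fun x hj' => absurd hj' hj
    have h3 : (fun x => ∑ j ∈ Finset.range n, u (T^[j] x)) =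
        ∑ j ∈ Finset.range n, u ∘ T^[j] := by
      ext x; simp
    rw [h3]
    filter_upwards [h1, h2] with x h1 h2
    rw [h1, Finset.sum_apply, Function.comp_apply, Finset.sum_apply,
      ← Finset.sum_range_reflect (fun l => L^[l] (L u) (T^[n] x))]
    refine Finset.sum_congr rfl fun j hj => ?_
    have hj := Finset.mem_range.1 hj
    rw [← h2 j hj, ← Function.iterate_succ_apply, show n - j = (n - 1 - j).succ by omega]
  have hgn : L^[n] g ∘ T^[n] =ᵐ[m] m[g | F.comap T^[n]] := by
    obtain ⟨k, rfl⟩ : ∃ k, n = k + 1 := ⟨n - 1, by omega⟩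
    exact transfer_iterate_comp_iterate hT hh.le hh.comap_le hg k
  set Bu : X → ℝ := fun x => ∑ j ∈ Finset.range n, u (T^[j] x) with hBu
  set Bv : X → ℝ := fun x => ∑ j ∈ Finset.range n, v (T^[j] x) with hBv
  have hBui : Integrable Bu m := integrable_finsetSum _ fun j _ =>
    (hT.iterate j).integrable_comp_of_integrable hu
  have hBvi : Integrable Bv m := integrable_finsetSum _ fun j _ =>
    (hT.iterate j).integrable_comp_of_integrable hv
  -- conditional expectations of both sides of the hypothesis
  have hG : m[κ • g - (fun _ => γ) + M | F.comap T^[n]] =ᵐ[m]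
      fun x => κ * (m[g | F.comap T^[n]]) x - γ := by
    have h1 := condExp_add (m := F.comap T^[n]) ((hg.smul κ).sub (integrable_const γ)) hM
    have h2 := condExp_sub (hg.smul κ) (integrable_const γ) (F.comap T^[n]) (μ := m)
    have h3 := condExp_smul κ g (F.comap T^[n]) (μ := m)
    rw [condExp_const hnle] at h2
    filter_upwards [h1, h2, h3, hM0] with x h1 h2 h3 h4
    rw [h1, Pi.add_apply, h2, Pi.sub_apply, h3, h4]
    simp
  have hR : m[α • Bu + β • Bv + (fun _ => d) | F.comap T^[n]] =ᵐ[m]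
      fun x => α * (m[Bu | F.comap T^[n]]) x + β * (m[Bv | F.comap T^[n]]) x + d := by
    have h1 := condExp_add (m := F.comap T^[n]) ((hBui.smul α).add (hBvi.smul β))
      (integrable_const d)
    have h2 := condExp_add (hBui.smul α) (hBvi.smul β) (F.comap T^[n]) (μ := m)
    have h3 := condExp_smul α Bu (F.comap T^[n]) (μ := m)
    have h4 := condExp_smul β Bv (F.comap T^[n]) (μ := m)
    rw [condExp_const hnle] at h1
    filter_upwards [h1, h2, h3, h4] with x h1 h2 h3 h4
    rw [h1, Pi.add_apply, h2, Pi.add_apply, h3, h4]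
    simp
  have hGi : Integrable (κ • g - (fun _ => γ) + M) m :=
    ((hg.smul κ).sub (integrable_const γ)).add hM
  have hRi : Integrable (α • Bu + β • Bv + (fun _ => d)) m :=
    ((hBui.smul α).add (hBvi.smul β)).add (integrable_const d)
  have hup := condExp_mono (m := F.comap T^[n]) hGi hRi
    (Eventually.of_forall fun x => (abs_le.1 (hle x)).2)
  have hlo := condExp_mono (m := F.comap T^[n]) hGi.neg hRi
    (Eventually.of_forall fun x => neg_le.1 (abs_le.1 (hle x)).1)
  have hneg := condExp_neg (κ • g - (fun _ => γ) + M) (F.comap T^[n]) (μ := m)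
  have hmain : ∀ᵐ x ∂m, |κ * L^[n] g (T^[n] x) - γ| ≤
      α * (∑ l ∈ Finset.range n, L^[l] (L u)) (T^[n] x) +
      β * (∑ l ∈ Finset.range n, L^[l] (L v)) (T^[n] x) + d := by
    filter_upwards [hG, hR, hup, hlo, hneg, hgn, hsum u hu, hsum v hv]
      with x h1 h2 h3 h4 h5 h6 h7 h8
    rw [h1, h2] at h3
    rw [h5, h2, Pi.neg_apply, h1] at h4
    rw [Function.comp_apply] at h6 h7 h8
    rw [h6, ← h7, ← h8]
    exact abs_le.2 ⟨neg_le.1 h4, h3⟩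
  have hLm : ∀ u : X → ℝ, Measurable (∑ l ∈ Finset.range n, L^[l] (L u)) := fun u => by
    rw [Finset.sum_fn]
    exact Finset.measurable_sum _ fun l _ =>
      measurable_transfer_iterate hh.le (measurable_transfer hh.le u) l
  exact ae_le_of_comp_ae_le (hT.iterate n)
    (((measurable_transfer_iterate hh.le hgm n).const_mul κ).sub_const γ).abs
    ((((hLm u).const_mul α).add ((hLm v).const_mul β)).add_const d) hmain

/-- The **quenched central limit theorem** for stationary ergodic reversed martingale differences:
the conditional distributions of `Sₙ / √n` given the `σ`-algebra `T⁻ⁿ F` are asymptotically Gaussian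
almost everywhere. The conditional expectations are expressed through powers of the transfer
operator. -/
theorem tendsto_transfer_iterate_cos (hh : IsReversedMartingaleDifference F m T h)
    (hT : Ergodic T m) (t θ : ℝ) :
    ∀ᵐ x ∂m, Tendsto (fun n : ℕ => (transfer m F T)^[n]
      (fun y => Real.cos (t * birkhoffSum T h n y / √n + θ)) x) atTop
      (𝓝 (Real.exp (-(t ^ 2 * (∫ x, h x ^ 2 ∂m) / 2)) * Real.cos θ)) := by
  set s := ∫ x, h x ^ 2 ∂m with hs
  have hs0 : 0 ≤ s := integral_nonneg fun x => sq_nonneg _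
  set a := t ^ 2 * s / 2 with ha
  set L := transfer m F T with hL
  set c : ℕ → X → ℝ := fun n y => Real.cos (t * birkhoffSum T h n y / √n + θ) with hc
  have hTm := hh.measurePreserving
  have hcm : ∀ n, Measurable (c n) := fun n =>
    Real.measurable_cos.comp
      ((((hh.measurable_birkhoffSum n).const_mul t).div_const _).add_const θ)
  have hci : ∀ n, Integrable (c n) m := fun n =>
    Integrable.of_bound (hcm n).aestronglyMeasurable 1
      (Eventually.of_forall fun x => Real.abs_cos_le_one _)
  suffices hq : ∀ᵐ x ∂m, Tendsto (fun n : ℕ => Real.exp a * L^[n] (c n) x - Real.cos θ)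
      atTop (𝓝 0) by
    filter_upwards [hq] with x hx
    have h1 := (hx.add_const (Real.cos θ)).const_mul (Real.exp (-a))
    rw [zero_add] at h1
    refine h1.congr fun n => ?_
    rw [sub_add_cancel, ← mul_assoc, ← Real.exp_add, neg_add_cancel, Real.exp_zero, one_mul]
  obtain ⟨C, hC⟩ : ∃ C, C = 4 * Real.exp (2 * (t ^ 2 * s / 2)) *
      (t ^ 2 + |t| ^ 3 + (t ^ 2 * s / 2) ^ 2 + t ^ 2 * s / 2 * |t| + t ^ 2 * (t ^ 2 * s / 2)) :=
    ⟨_, rfl⟩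
  have hC0 : 0 ≤ C := by rw [hC]; positivity
  refine ae_tendsto_zero_of_forall_exists fun ε hε => ?_
  set η := ε / (2 * (C + 1)) with hη
  have hη0 : 0 < η := by positivity
  have hhi2 : Integrable (fun x => h x ^ 2 - s) m :=
    hh.memLp.integrable_sq.sub (integrable_const s)
  have hhi0 : ∫ x, (h x ^ 2 - s) ∂m = 0 := by
    rw [integral_sub hh.memLp.integrable_sq (integrable_const s)]
    simp [hs]
  obtain ⟨p, hpm, ⟨P, hP⟩, hpw⟩ := hT.exists_bounded_coboundary hhi2 hhi0
    (show 0 < η * (ε / 2) / 2 by positivity)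
  set w : X → ℝ := fun x => h x ^ 2 - s - (p (T x) - p x) with hw
  have hwm : Measurable w := ((hh.measurable.pow_const 2).sub_const s).sub
    ((hpm.comp hTm.measurable).sub hpm)
  have hpi : Integrable p m := Integrable.of_bound hpm.aestronglyMeasurable P
    (Eventually.of_forall hP)
  have hwi : Integrable w m :=
    hhi2.sub ((hTm.integrable_comp_of_integrable hpi).sub hpi)
  obtain ⟨K, hK, hK1⟩ := ((hh.tendsto_integral_min_sq_cube.eventually_lt_const
    (show 0 < η * (ε / 2) / 2 by positivity)).and (eventually_ge_atTop 1)).exists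
  set r : X → ℝ := fun x => min (h x ^ 2) (|h x| ^ 3 / √K) with hr
  have hrm : Measurable r := (hh.measurable.pow_const 2).min
    ((hh.measurable.abs.pow_const 3).div_const _)
  have hr0 : ∀ x, 0 ≤ r x := fun x => le_min (sq_nonneg _) (by positivity)
  have hri : Integrable r m := Integrable.mono' hh.memLp.integrable_sq
    hrm.aestronglyMeasurable (Eventually.of_forall fun x => by
      rw [Real.norm_eq_abs, abs_of_nonneg (hr0 x)]; exact min_le_left _ _)
  set u : X → ℝ := fun x => |w x| + r x with hu
  have hui : Integrable u m := hwi.abs.add hri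
  have hu0 : ∀ x, 0 ≤ u x := fun x => add_nonneg (abs_nonneg _) (hr0 x)
  have hu_int : ∫ x, u x ∂m ≤ η * (ε / 2) := by
    simp only [hu]
    rw [integral_add hwi.abs hri]
    linarith
  set v : X → ℝ := fun x => |h x| with hv
  have hvi : Integrable v m := hh.integrable.abs
  -- The maximal inequality bounds the ergodic sums of `L u` by `η n` and those of `L v` by `Λ n`,
  -- each off a set of measure at most `ε / 2`.
  set Λ := (∫ x, v x ∂m) / (ε / 2) + 1 with hΛ
  have hv_int0 : 0 ≤ ∫ x, v x ∂m := integral_nonneg fun x => abs_nonneg _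
  have hΛ0 : 0 < Λ := by positivity
  have hMk := isMarkovOperator_transfer hTm hh.le
  have hLnn : ∀ q : X → ℝ, Integrable q m → (∀ x, 0 ≤ q x) → 0 ≤ᵐ[m] L q := by
    intro q hq hq0
    exact (hMk.const 0).symm.le.trans
      (hMk.mono _ _ (integrable_const 0) hq (Eventually.of_forall hq0))
  have hbad1 := hMk.measure_exists_lt_sum_le (hMk.integrable u hui)
    (hLnn u hui hu0) hη0
  have hbad2 := hMk.measure_exists_lt_sum_le (hMk.integrable v hvi)
    (hLnn v hvi fun x => abs_nonneg _) hΛ0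
  rw [hMk.integral_eq u hui] at hbad1
  rw [hMk.integral_eq v hvi] at hbad2
  -- the pointwise bound for each large `n`
  have hbound : ∀ᵐ x ∂m, ∀ n : ℕ, K ≤ n → |Real.exp a * L^[n] (c n) x - Real.cos θ| ≤
      C / n * (∑ l ∈ Finset.range n, L^[l] (L u)) x +
      C * (1 + P) / (√n * n) * (∑ l ∈ Finset.range n, L^[l] (L v)) x + C * (1 + P) / n := by
    refine ae_all_iff.2 fun n => ?_
    by_cases hKn : K ≤ n
    swap
    · exact Eventually.of_forall fun x h' => absurd h' hKn
    have hn1 : 1 ≤ n := hK1.trans hKn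
    have hn0 : (0 : ℝ) < n := by exact_mod_cast hn1
    set k : ℕ → X → ℝ := fun j x => Real.exp (t ^ 2 * s / 2 * (n - (j + 1 : ℕ)) / n) *
        Real.sin (t * (∑ i ∈ Finset.Ico (j + 1) n, h (T^[i] x)) / √n + θ) * (t / √n) with hk
    have hkm : ∀ j, StronglyMeasurable[F.comap T^[j + 1]] (k j) := fun j => by
      have h1 := (hh.stronglyMeasurable_sum_Ico (j + 1) n).measurable
      exact ((measurable_const.mul (Real.measurable_sin.comp
        (((h1.const_mul t).div_const _).add_const θ))).mul_const _).stronglyMeasurable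
    have hkb : ∀ j x, |k j x| ≤ Real.exp (t ^ 2 * s / 2 * (n - (j + 1 : ℕ)) / n) *
        |t / √n| := fun j x => by
      simp only [hk]
      rw [abs_mul, abs_mul, abs_of_pos (Real.exp_pos _)]
      refine mul_le_mul_of_nonneg_right ?_ (abs_nonneg _)
      exact mul_le_of_le_one_right (Real.exp_pos _).le (Real.abs_sin_le_one _)
    have hki : ∀ j, Integrable (fun x => k j x * h (T^[j] x)) m := fun j =>
      (hh.integrable_comp j).bdd_mul
        ((hkm j).mono (hh.comap_iterate_le _)).aestronglyMeasurable
        (Eventually.of_forall (hkb j))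
    set M : X → ℝ := ∑ j ∈ Finset.range n, fun x => k j x * h (T^[j] x) with hM
    have hMi : Integrable M m := integrable_finsetSum' _ fun j _ => hki j
    have hM0 : m[M | F.comap T^[n]] =ᵐ[m] 0 := by
      have h1 := condExp_finsetSum (μ := m) (s := Finset.range n)
        (f := fun j x => k j x * h (T^[j] x)) (fun j _ => hki j) (F.comap T^[n])
      have h2 : ∀ᵐ x ∂m, ∀ j < n,
          (m[fun x => k j x * h (T^[j] x) | F.comap T^[n]]) x = 0 := by
        refine ae_all_iff.2 fun j => ?_
        by_cases hj : j < n
        · filter_upwards [hh.condExp_mul_comp_eq_zero hj (hkm j) (hkb j)] with x hx _ using hx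
        · exact Eventually.of_forall fun x hj' => absurd hj' hj
      filter_upwards [h1, h2] with x h1 h2
      rw [h1, Finset.sum_apply]
      exact Finset.sum_eq_zero fun j hj => h2 j (Finset.mem_range.1 hj)
    have hP0 : ∀ x : X, 0 ≤ P := fun x => (abs_nonneg _).trans (hP x)
    have hmain := hh.abs_transfer_iterate_sub_le (n := n) (g := c n) (M := M) (u := u) (v := v)
      (κ := Real.exp a) (γ := Real.cos θ) (α := C / n) (β := C * (1 + P) / (√n * n))
      (d := C * (1 + P) / n) (hci n) hMi hui hvi hM0 (hcm n) ?_ hn1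
    · filter_upwards [hmain] with x hx _ using hx
    intro x
    have hdet := abs_exp_mul_cos_sum_sub_le (t := t) θ hs0 hn1 (x := fun j => h (T^[j] x))
      (p := fun j => p (T^[j] x)) (w := fun j => w (T^[j] x)) (fun j => hP _)
      (fun j => by simp only [hw, Function.iterate_succ_apply']; ring)
    rw [← hC] at hdet
    have hMx : M x = ∑ j ∈ Finset.range n, k j x * h (T^[j] x) := by
      rw [hM, Finset.sum_apply]
    rw [hMx]
    refine hdet.trans ?_
    have hmono : ∑ j ∈ Finset.range n, (|w (T^[j] x)| +
        min (h (T^[j] x) ^ 2) (|h (T^[j] x)| ^ 3 / √n)) ≤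
        ∑ j ∈ Finset.range n, u (T^[j] x) := by
      refine Finset.sum_le_sum fun j _ => ?_
      simp only [hu, hr]
      have hKn' : √(K : ℝ) ≤ √n := Real.sqrt_le_sqrt (by exact_mod_cast hKn)
      have hK0 : 0 < √(K : ℝ) := Real.sqrt_pos.2 (by exact_mod_cast hK1)
      gcongr
    have h1 : C * ((∑ j ∈ Finset.range n, (|w (T^[j] x)| +
        min (h (T^[j] x) ^ 2) (|h (T^[j] x)| ^ 3 / √n))) / n +
        (1 + P) / √n * ((∑ j ∈ Finset.range n, |h (T^[j] x)|) / n) + (1 + P) / n) ≤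
        C * ((∑ j ∈ Finset.range n, u (T^[j] x)) / n +
        (1 + P) / √n * ((∑ j ∈ Finset.range n, |h (T^[j] x)|) / n) + (1 + P) / n) := by
      gcongr
    refine h1.trans (le_of_eq ?_)
    simp only [hv]
    have : √(n : ℝ) ≠ 0 := (Real.sqrt_pos.2 hn0).ne'
    field_simp
  refine ⟨_ ∪ _, (measure_union_le _ _).trans ((add_le_add hbad1 hbad2).trans ?_), ?_⟩
  · rw [← ENNReal.ofReal_add (div_nonneg (integral_nonneg hu0) hη0.le) (by positivity)]
    refine ENNReal.ofReal_le_ofReal ?_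
    have h1 : (∫ x, u x ∂m) / η ≤ ε / 2 := by
      rw [div_le_iff₀ hη0]; linarith
    have h2 : (∫ x, v x ∂m) / Λ ≤ ε / 2 := by
      rw [div_le_iff₀ hΛ0, hΛ]
      have : ε / 2 * ((∫ x, v x ∂m) / (ε / 2) + 1) = ∫ x, v x ∂m + ε / 2 := by
        field_simp
      rw [this]
      linarith
    linarith
  · filter_upwards [hbound] with x hx hxA
    simp only [Set.mem_union, Set.mem_ofPred_eq, not_or, not_exists, not_lt] at hxA
    obtain ⟨hxu, hxv⟩ := hxA
    have hP0 : 0 ≤ P := (abs_nonneg _).trans (hP x)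
    have hlim : Tendsto (fun n : ℕ => C * η + C * (1 + P) * Λ / √n + C * (1 + P) / n) atTop
        (𝓝 (C * η + 0 + 0)) := by
      refine (tendsto_const_nhds.add ?_).add ?_
      · exact (Real.tendsto_sqrt_atTop.comp tendsto_natCast_atTop_atTop).const_div_atTop _
      · exact tendsto_natCast_atTop_atTop.const_div_atTop _
    have hCη : C * η + 0 + 0 < ε := by
      have h1 : C * η = ε / 2 * (C / (C + 1)) := by
        rw [hη]; field_simp
      have h2 : C / (C + 1) ≤ 1 := by
        rw [div_le_one (by positivity)]; linarith
      nlinarith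
    filter_upwards [hlim.eventually_lt_const hCη, eventually_ge_atTop K] with n hn hKn
    refine (hx n hKn).trans (le_trans ?_ hn.le)
    have hn0 : (0 : ℝ) < n := by exact_mod_cast hK1.trans hKn
    have hsn : 0 < √(n : ℝ) := Real.sqrt_pos.2 hn0
    have h1 : C / n * (∑ l ∈ Finset.range n, L^[l] (L u)) x ≤ C * η := by
      refine (mul_le_mul_of_nonneg_left (hxu n) (by positivity)).trans (le_of_eq ?_)
      field_simp
    have h2 : C * (1 + P) / (√n * n) * (∑ l ∈ Finset.range n, L^[l] (L v)) x ≤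
        C * (1 + P) * Λ / √n := by
      refine (mul_le_mul_of_nonneg_left (hxv n) (by positivity)).trans (le_of_eq ?_)
      field_simp
    linarith

end IsReversedMartingaleDifference

/-! ### A law of large numbers for logarithmic averages -/

theorem sum_Icc_inv_sqrt_le (N : ℕ) : ∑ j ∈ Finset.Icc 1 N, 1 / √(j : ℝ) ≤ 2 * √(N : ℝ) := by
  induction N with
  | zero => simp
  | succ N ih =>
    rw [Finset.sum_Icc_succ_top (by omega)]
    have h0 : (0 : ℝ) < ((N + 1 : ℕ) : ℝ) := by positivity
    set b := √((N + 1 : ℕ) : ℝ) with hb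
    have hb0 : 0 < b := Real.sqrt_pos.2 h0
    have hb2 : b ^ 2 = N + 1 := by rw [hb, Real.sq_sqrt h0.le]; push_cast; ring
    have ha2 : √(N : ℝ) ^ 2 = N := Real.sq_sqrt (Nat.cast_nonneg N)
    have h1 : 1 / b ≤ 2 * b - 2 * √(N : ℝ) := by
      rw [div_le_iff₀ hb0]
      nlinarith [sq_nonneg (b - √(N : ℝ))]
    linarith

/-- Logarithmic averages of a bounded sequence tend to zero if they do so along the subsequence
`2 ^ (i ^ 2)`. -/
theorem tendsto_logAverage_of_subseq {x : ℕ → ℝ} {B : ℝ} (hB : ∀ k, |x k| ≤ B)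
    (hx : Tendsto (fun i : ℕ => (∑ k ∈ Finset.Icc (1 : ℕ) (2 ^ (i ^ 2)), (1 / (k : ℝ)) * x k) /
      Real.log ((2 ^ (i ^ 2) : ℕ) : ℝ)) atTop (𝓝 0)) :
    Tendsto (fun N : ℕ => (∑ k ∈ Finset.Icc 1 N, (1 / (k : ℝ)) * x k) / Real.log N)
      atTop (𝓝 0) := by
  have hB0 : 0 ≤ B := (abs_nonneg _).trans (hB 0)
  have hl2 : 0 < Real.log 2 := Real.log_pos one_lt_two
  set W : ℕ → ℝ := fun N => ∑ k ∈ Finset.Icc 1 N, (1 / (k : ℝ)) * x k with hW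
  have hlog : ∀ i : ℕ, Real.log ((2 ^ (i ^ 2) : ℕ) : ℝ) = i ^ 2 * Real.log 2 := fun i => by
    push_cast
    rw [Real.log_pow]
    push_cast
    ring
  -- the index of the block containing `N`
  set ι : ℕ → ℕ := fun N => Nat.sqrt (Nat.log 2 N) with hι
  have hιt : Tendsto ι atTop atTop := by
    refine tendsto_atTop_atTop.2 fun b => ⟨2 ^ (b * b), fun N hN => ?_⟩
    refine Nat.le_sqrt.2 ?_
    exact Nat.le_log_of_pow_le (by norm_num) hN
  have hlow : ∀ N, 1 ≤ N → 2 ^ (ι N ^ 2) ≤ N := fun N hN => by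
    refine (Nat.pow_le_pow_right (by norm_num) ?_).trans (Nat.pow_log_le_self 2 (by omega))
    exact Nat.sqrt_le' _
  have hupp : ∀ N, N ≤ 2 ^ ((ι N + 1) ^ 2) := fun N => by
    refine (Nat.lt_pow_succ_log_self (by norm_num) N).le.trans
      (Nat.pow_le_pow_right (by norm_num) ?_)
    exact Nat.lt_succ_sqrt' _
  have hlim2 : Tendsto (fun i : ℕ => B * (1 + (2 * i + 1) * Real.log 2) / (i ^ 2 * Real.log 2))
      atTop (𝓝 0) := by
    have hinv : Tendsto (fun i : ℕ => 1 / (i : ℝ)) atTop (𝓝 0) :=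
      tendsto_one_div_atTop_nhds_zero_nat
    have h1 : Tendsto (fun i : ℕ => B / Real.log 2 * ((1 / (i : ℝ)) ^ 2 * (1 + Real.log 2) +
        (1 / (i : ℝ)) * (2 * Real.log 2))) atTop
        (𝓝 (B / Real.log 2 * (0 ^ 2 * (1 + Real.log 2) + 0 * (2 * Real.log 2)))) :=
      (((hinv.pow 2).mul_const _).add (hinv.mul_const _)).const_mul _
    simp only [ne_eq, OfNat.ofNat_ne_zero, not_false_eq_true, zero_pow, zero_mul, add_zero,
      mul_zero] at h1
    refine h1.congr' ?_
    filter_upwards [eventually_ge_atTop 1] with i hi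
    have : (i : ℝ) ≠ 0 := by exact_mod_cast (show i ≠ 0 by omega)
    field_simp
    ring
  have hbound := (hx.abs.comp hιt).add (hlim2.comp hιt)
  rw [abs_zero, add_zero] at hbound
  refine squeeze_zero_norm' ?_ hbound
  filter_upwards [hιt.eventually_ge_atTop 1, eventually_ge_atTop 1] with N hiN hN
  set i := ι N with hi
  have hi0 : (0 : ℝ) < i := by exact_mod_cast hiN
  have hli : 0 < (i : ℝ) ^ 2 * Real.log 2 := by positivity
  have hle : (i : ℝ) ^ 2 * Real.log 2 ≤ Real.log N := by
    rw [← hlog]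
    exact Real.log_le_log (by positivity) (by exact_mod_cast hlow N hN)
  have hlN : 0 < Real.log N := hli.trans_le hle
  -- Inside a block the sums vary by `O(i)`, while `log N` is of order `i ^ 2`.
  have hdiff : |W N - W (2 ^ (i ^ 2))| ≤ B * (1 + (2 * i + 1) * Real.log 2) := by
    have hsub : ∀ y : ℕ → ℝ, ∑ k ∈ Finset.Icc 1 N, y k -
        ∑ k ∈ Finset.Icc 1 (2 ^ (i ^ 2)), y k = ∑ k ∈ Finset.Ioc (2 ^ (i ^ 2)) N, y k := by
      intro y
      have h1 : ∀ M, Finset.Icc 1 M = Finset.Ioc 0 M := fun M => rfl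
      rw [sub_eq_iff_eq_add', h1, h1]
      exact (Finset.sum_Ioc_consecutive y (Nat.zero_le _) (hlow N hN)).symm
    simp only [hW]
    rw [hsub]
    have h1 : |∑ k ∈ Finset.Ioc (2 ^ (i ^ 2)) N, 1 / (k : ℝ) * x k| ≤
        ∑ k ∈ Finset.Ioc (2 ^ (i ^ 2)) N, B * (1 / (k : ℝ)) := by
      refine (Finset.abs_sum_le_sum_abs _ _).trans (Finset.sum_le_sum fun k _ => ?_)
      rw [abs_mul, abs_of_nonneg (by positivity : (0 : ℝ) ≤ 1 / k), mul_comm]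
      exact mul_le_mul_of_nonneg_right (hB k) (by positivity)
    refine h1.trans ?_
    rw [← Finset.mul_sum, ← hsub, sum_Icc_one_div_eq_harmonic, sum_Icc_one_div_eq_harmonic]
    refine mul_le_mul_of_nonneg_left ?_ hB0
    have h2 := harmonic_le_one_add_log N
    have h3 := log_add_one_le_harmonic (2 ^ (i ^ 2))
    have h4 : Real.log N ≤ ((i + 1 : ℕ) : ℝ) ^ 2 * Real.log 2 := by
      rw [← hlog]
      exact Real.log_le_log (by exact_mod_cast hN) (by exact_mod_cast hupp N)
    have h5 : (i : ℝ) ^ 2 * Real.log 2 ≤ Real.log ((2 ^ (i ^ 2) + 1 : ℕ) : ℝ) := by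
      rw [← hlog]
      exact Real.log_le_log (by positivity) (by push_cast; linarith)
    push_cast at h2 h3 h4 h5 ⊢
    nlinarith
  rw [Real.norm_eq_abs, abs_div, abs_of_pos hlN]
  simp only [Function.comp_apply]
  rw [abs_div, hlog, abs_of_pos hli, ← add_div]
  have h6 : |W N| ≤ |W (2 ^ (i ^ 2))| + B * (1 + (2 * i + 1) * Real.log 2) := by
    have := abs_sub_abs_le_abs_sub (W N) (W (2 ^ (i ^ 2)))
    linarith
  exact div_le_div₀ (by positivity) h6 hli hle

section LogLLN

variable {X : Type*} {mX : MeasurableSpace X} {m : Measure X}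

theorem ae_tendsto_zero_of_summable_integral_sq {V : ℕ → X → ℝ} (hV : ∀ i, MemLp (V i) 2 m)
    (hs : Summable fun i => ∫ x, V i x ^ 2 ∂m) :
    ∀ᵐ x ∂m, Tendsto (fun i => V i x) atTop (𝓝 0) := by
  have h1 : ∀ i, ∫⁻ x, ENNReal.ofReal (V i x ^ 2) ∂m = ENNReal.ofReal (∫ x, V i x ^ 2 ∂m) :=
    fun i => (ofReal_integral_eq_lintegral_ofReal (hV i).integrable_sq
      (Eventually.of_forall fun x => sq_nonneg _)).symm
  have hmeas : ∀ i, AEMeasurable (fun x => ENNReal.ofReal (V i x ^ 2)) m := fun i =>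
    ((hV i).aestronglyMeasurable.aemeasurable.pow_const 2).ennreal_ofReal
  have h2 : ∫⁻ x, ∑' i, ENNReal.ofReal (V i x ^ 2) ∂m ≠ ⊤ := by
    rw [lintegral_tsum hmeas]
    simp_rw [h1]
    exact hs.tsum_ofReal_ne_top
  filter_upwards [ae_lt_top' (AEMeasurable.tsum hmeas) h2] with x hx
  have h3 := ENNReal.tendsto_atTop_zero_of_tsum_ne_top hx.ne
  have h4 : Tendsto (fun i => V i x ^ 2) atTop (𝓝 0) := by
    have := (ENNReal.tendsto_toReal ENNReal.zero_ne_top).comp h3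
    simpa [Function.comp_def, ENNReal.toReal_ofReal (sq_nonneg _)] using this
  have h5 := (Real.continuous_sqrt.tendsto 0).comp h4
  rw [Real.sqrt_zero] at h5
  rw [tendsto_zero_iff_abs_tendsto_zero]
  simpa [Function.comp_def, Real.sqrt_sq_eq_abs] using h5

/-- Logarithmic averages of bounded random variables whose correlations satisfy
`|E ξⱼ ξₖ| ≤ C √(j / k)` for `j < k` tend to zero almost surely. -/
theorem ae_tendsto_logAverage_of_correlation_le [IsProbabilityMeasure m] {ξ : ℕ → X → ℝ}
    (hξ : ∀ k, AEStronglyMeasurable (ξ k) m) {B C : ℝ} (hB : ∀ k, ∀ᵐ x ∂m, |ξ k x| ≤ B)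
    (hC : ∀ j k : ℕ, 1 ≤ j → j < k → |∫ x, ξ j x * ξ k x ∂m| ≤ C * (√(j : ℝ) / √(k : ℝ))) :
    ∀ᵐ x ∂m, Tendsto (fun N : ℕ => (∑ k ∈ Finset.Icc 1 N, (1 / (k : ℝ)) * ξ k x) / Real.log N)
      atTop (𝓝 0) := by
  have hC0 : 0 ≤ C := by
    have h1 := (abs_nonneg _).trans (hC 1 2 le_rfl one_lt_two)
    exact nonneg_of_mul_nonneg_left h1 (by positivity)
  have hξL : ∀ k, MemLp (ξ k) 2 m := fun k => MemLp.of_bound (hξ k) B (hB k)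
  set W : ℕ → X → ℝ := fun N x => ∑ k ∈ Finset.Icc 1 N, (1 / (k : ℝ)) * ξ k x with hW
  have hWL : ∀ N, MemLp (W N) 2 m := fun N =>
    memLp_finsetSum _ fun k _ => (hξL k).const_mul _
  set D := 4 * C + B ^ 2 with hD
  have hD0 : 0 ≤ D := by positivity
  -- The second moments grow like `log N`; along `N = 2 ^ (i ^ 2)`, for which `log N` is of order
  -- `i ^ 2`, the normalized second moments are summable.
  have hmom : ∀ N, ∫ x, W N x ^ 2 ∂m ≤ D * ∑ k ∈ Finset.Icc 1 N, 1 / (k : ℝ) := by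
    intro N
    induction N with
    | zero => simp [hW]
    | succ N ih =>
      have hk0 : (0 : ℝ) < ((N + 1 : ℕ) : ℝ) := by positivity
      have hcross : ∫ x, W N x * ξ (N + 1) x ∂m ≤ 2 * C := by
        have h1 : ∀ x, W N x * ξ (N + 1) x =
            ∑ j ∈ Finset.Icc 1 N, (1 / (j : ℝ)) * (ξ j x * ξ (N + 1) x) := fun x => by
          simp only [hW]
          rw [Finset.sum_mul]
          exact Finset.sum_congr rfl fun j _ => by ring
        simp_rw [h1]
        have hij : ∀ j, Integrable (fun x => ξ j x * ξ (N + 1) x) m := fun j =>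
          (hξL j).integrable_mul (hξL (N + 1))
        rw [integral_finsetSum _ fun j _ => (hij j).const_mul _]
        have h2 : ∀ j ∈ Finset.Icc 1 N, ∫ x, (1 / (j : ℝ)) * (ξ j x * ξ (N + 1) x) ∂m ≤
            C / √((N + 1 : ℕ) : ℝ) * (1 / √(j : ℝ)) := fun j hj => by
          obtain ⟨hj1, hjN⟩ := Finset.mem_Icc.1 hj
          have hj0 : (0 : ℝ) < j := by exact_mod_cast hj1
          rw [integral_const_mul]
          have h3 := (le_abs_self _).trans (hC j (N + 1) hj1 (by omega))
          refine (mul_le_mul_of_nonneg_left h3 (by positivity)).trans (le_of_eq ?_)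
          have h4 : √(j : ℝ) * √(j : ℝ) = j := Real.mul_self_sqrt hj0.le
          have h5 : √(j : ℝ) ≠ 0 := (Real.sqrt_pos.2 hj0).ne'
          have h6 : √((N + 1 : ℕ) : ℝ) ≠ 0 := (Real.sqrt_pos.2 hk0).ne'
          field_simp
          rw [sq, h4, mul_comm]
        refine (Finset.sum_le_sum h2).trans ?_
        rw [← Finset.mul_sum]
        have h7 := sum_Icc_inv_sqrt_le N
        have h8 : √(N : ℝ) ≤ √((N + 1 : ℕ) : ℝ) := Real.sqrt_le_sqrt (by push_cast; linarith)
        have h9 : 0 < √((N + 1 : ℕ) : ℝ) := Real.sqrt_pos.2 hk0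
        rw [div_mul_eq_mul_div, div_le_iff₀ h9]
        nlinarith
      have hsq : ∫ x, ξ (N + 1) x ^ 2 ∂m ≤ B ^ 2 := by
        have h1 : ∀ᵐ x ∂m, ξ (N + 1) x ^ 2 ≤ B ^ 2 := by
          filter_upwards [hB (N + 1)] with x hx
          rw [← sq_abs]
          exact pow_le_pow_left₀ (abs_nonneg _) hx 2
        have := integral_mono_ae (hξL (N + 1)).integrable_sq (integrable_const (B ^ 2)) h1
        simpa using this
      set k : ℝ := ((N + 1 : ℕ) : ℝ) with hk
      have hexp : ∀ x, W (N + 1) x ^ 2 = W N x ^ 2 + 2 / k * (W N x * ξ (N + 1) x) +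
          1 / k ^ 2 * ξ (N + 1) x ^ 2 := fun x => by
        simp only [hW]
        rw [Finset.sum_Icc_succ_top (by omega)]
        ring
      have hi1 : Integrable (fun x => 2 / k * (W N x * ξ (N + 1) x)) m :=
        ((hWL N).integrable_mul (hξL (N + 1))).const_mul _
      have hi2 : Integrable (fun x => 1 / k ^ 2 * ξ (N + 1) x ^ 2) m :=
        (hξL (N + 1)).integrable_sq.const_mul _
      have hi3 : Integrable (fun x => W N x ^ 2 + 2 / k * (W N x * ξ (N + 1) x)) m :=
        (hWL N).integrable_sq.add hi1
      simp_rw [hexp]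
      rw [integral_add hi3 hi2, integral_add (hWL N).integrable_sq hi1, integral_const_mul,
        integral_const_mul, Finset.sum_Icc_succ_top (by omega), mul_add, ← hk]
      have hk1 : 1 ≤ k := by rw [hk]; push_cast; linarith [Nat.cast_nonneg (α := ℝ) N]
      have e1 : 2 / k * ∫ x, W N x * ξ (N + 1) x ∂m ≤ 4 * C * (1 / k) := by
        refine (mul_le_mul_of_nonneg_left hcross (by positivity)).trans (le_of_eq ?_)
        ring
      have e2 : 1 / k ^ 2 * ∫ x, ξ (N + 1) x ^ 2 ∂m ≤ B ^ 2 * (1 / k) := by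
        refine (mul_le_mul_of_nonneg_left hsq (by positivity)).trans ?_
        rw [mul_comm]
        refine mul_le_mul_of_nonneg_left ?_ (sq_nonneg B)
        exact one_div_le_one_div_of_le hk0 (by nlinarith)
      rw [hD]
      linarith
  have hl2 : 0 < Real.log 2 := Real.log_pos one_lt_two
  have hlog : ∀ i : ℕ, Real.log ((2 ^ (i ^ 2) : ℕ) : ℝ) = i ^ 2 * Real.log 2 := fun i => by
    push_cast
    rw [Real.log_pow]
    push_cast
    ring
  have hsub : ∀ᵐ x ∂m, Tendsto (fun i : ℕ => W (2 ^ (i ^ 2)) x /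
      Real.log ((2 ^ (i ^ 2) : ℕ) : ℝ)) atTop (𝓝 0) := by
    refine ae_tendsto_zero_of_summable_integral_sq
      (V := fun i x => W (2 ^ (i ^ 2)) x / Real.log ((2 ^ (i ^ 2) : ℕ) : ℝ))
      (fun i => by simpa [div_eq_mul_inv] using (hWL (2 ^ (i ^ 2))).mul_const _) ?_
    have hsum : Summable fun i : ℕ => D * (1 / Real.log 2 ^ 2 + 1 / Real.log 2) *
        (1 / (i : ℝ) ^ 2) :=
      (Real.summable_one_div_nat_pow.2 one_lt_two).mul_left _
    refine Summable.of_nonneg_of_le (fun i => integral_nonneg fun x => sq_nonneg _)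
      (fun i => ?_) hsum
    simp_rw [div_pow]
    rw [integral_div, hlog]
    rcases Nat.eq_zero_or_pos i with rfl | hi
    · simp
    have hi1 : (1 : ℝ) ≤ i := by exact_mod_cast hi
    have hi0 : (0 : ℝ) < i := by linarith
    have h1 := hmom (2 ^ (i ^ 2))
    rw [sum_Icc_one_div_eq_harmonic] at h1
    have h2 := harmonic_le_one_add_log (2 ^ (i ^ 2))
    rw [hlog] at h2
    rw [div_le_iff₀ (by positivity)]
    refine h1.trans ((mul_le_mul_of_nonneg_left h2 hD0).trans ?_)
    have h3 : D * (1 / Real.log 2 ^ 2 + 1 / Real.log 2) * (1 / (i : ℝ) ^ 2) *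
        ((i : ℝ) ^ 2 * Real.log 2) ^ 2 = D * ((i : ℝ) ^ 2 + (i : ℝ) ^ 2 * Real.log 2) := by
      field_simp
    rw [h3]
    refine mul_le_mul_of_nonneg_left ?_ hD0
    nlinarith
  filter_upwards [hsub, ae_all_iff.2 hB] with x hx hBx
  exact tendsto_logAverage_of_subseq hBx hx

end LogLLN

/-! ### Logarithmic averages for reversed martingale differences -/

namespace IsReversedMartingaleDifference

variable {X : Type*} {F : MeasurableSpace X} {mX : MeasurableSpace X} {m : Measure X}
  [IsProbabilityMeasure m] {T : X → X} {h : X → ℝ}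

/-- The fluctuations of `cos (t Sₖ / √k + θ)` around its conditional expectation given `T⁻ᵏ F` are
weakly correlated: for `j < k`, replacing `Sₖ` by `Sₖ - Sⱼ` makes the second fluctuation
`T⁻ʲ F`-measurable, hence orthogonal to the first one. -/
theorem abs_integral_fluctuation_mul_le (hh : IsReversedMartingaleDifference F m T h) (t θ : ℝ)
    {j k : ℕ} (hjk : j < k) {c : ℕ → X → ℝ}
    (hc : c = fun n y => Real.cos (t * birkhoffSum T h n y / √n + θ)) :
    |∫ x, (c j x - (m[c j | F.comap T^[j]]) x) * (c k x - (m[c k | F.comap T^[k]]) x) ∂m| ≤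
      2 * |t| * √(∫ x, h x ^ 2 ∂m) * (√(j : ℝ) / √(k : ℝ)) := by
  have hcm : ∀ n, Measurable (c n) := fun n => by
    rw [hc]
    exact Real.measurable_cos.comp
      ((((hh.measurable_birkhoffSum n).const_mul t).div_const _).add_const θ)
  have hc1 : ∀ n x, |c n x| ≤ 1 := fun n x => by rw [hc]; exact Real.abs_cos_le_one _
  have hci : ∀ n, Integrable (c n) m := fun n =>
    Integrable.of_bound (hcm n).aestronglyMeasurable 1 (Eventually.of_forall (hc1 n))
  have hE1 : ∀ n, ∀ᵐ x ∂m, |(m[c n | F.comap T^[n]]) x| ≤ 1 := fun n =>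
    ae_bdd_abs_condExp_of_ae_bdd_abs (Eventually.of_forall (hc1 n))
  set ξ : X → ℝ := c j - m[c j | F.comap T^[j]] with hξ
  set d : X → ℝ := fun y =>
    Real.cos (t * (∑ i ∈ Finset.Ico j k, h (T^[i] y)) / √k + θ) with hd
  set ζ : X → ℝ := d - m[c k | F.comap T^[k]] with hζ
  have hdm : StronglyMeasurable[F.comap T^[j]] d := by
    have h1 := (hh.stronglyMeasurable_sum_Ico j k).measurable
    exact (Real.measurable_cos.comp
      (((h1.const_mul t).div_const _).add_const θ)).stronglyMeasurable
  have hζm : StronglyMeasurable[F.comap T^[j]] ζ :=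
    hdm.sub (stronglyMeasurable_condExp.mono (hh.antitone hjk.le))
  have hζb : ∀ᵐ x ∂m, ‖ζ x‖ ≤ 2 := by
    filter_upwards [hE1 k] with x hx
    refine (norm_sub_le _ _).trans ?_
    have : |d x| ≤ 1 := Real.abs_cos_le_one _
    rw [Real.norm_eq_abs, Real.norm_eq_abs]
    linarith
  have hξi : Integrable ξ m := (hci j).sub integrable_condExp
  have hξb : ∀ᵐ x ∂m, |ξ x| ≤ 2 := by
    filter_upwards [hE1 j] with x hx
    refine (abs_sub _ _).trans ?_
    linarith [hc1 j x]
  have hζξ : Integrable (ζ * ξ) m :=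
    hξi.bdd_mul (hζm.mono (hh.comap_iterate_le j)).aestronglyMeasurable hζb
  have hzero : ∫ x, ζ x * ξ x ∂m = 0 := by
    have h1 := condExp_mul_of_stronglyMeasurable_left hζm hζξ hξi
    have h2 : m[ξ | F.comap T^[j]] =ᵐ[m] 0 := by
      have h3 := condExp_sub (hci j) (integrable_condExp (m := F.comap T^[j]) (μ := m) (f := c j))
        (F.comap T^[j])
      rw [condExp_of_stronglyMeasurable (hh.comap_iterate_le j) stronglyMeasurable_condExp
        integrable_condExp, sub_self] at h3
      exact h3
    have h4 : m[ζ * ξ | F.comap T^[j]] =ᵐ[m] 0 := by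
      filter_upwards [h1, h2] with x h1 h2
      rw [h1, Pi.mul_apply, h2]
      simp
    change ∫ x, (ζ * ξ) x ∂m = 0
    rw [← integral_condExp (hh.comap_iterate_le j), integral_congr_ae h4]
    simp
  have hdiff : ∀ x, |c k x - d x| ≤ |t| / √k * |birkhoffSum T h j x| := fun x => by
    rw [hc, hd]
    have h1 : birkhoffSum T h k x =
        birkhoffSum T h j x + ∑ i ∈ Finset.Ico j k, h (T^[i] x) := by
      simp only [birkhoffSum]
      rw [Finset.sum_range_add_sum_Ico _ hjk.le]
    refine (Real.abs_cos_sub_cos_le _ _).trans (le_of_eq ?_)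
    rw [h1, ← abs_of_nonneg (Real.sqrt_nonneg (k : ℝ)), ← abs_div, ← abs_mul]
    congr 1
    rw [abs_of_nonneg (Real.sqrt_nonneg (k : ℝ))]
    ring
  have hsplit : ∀ x, (c j x - (m[c j | F.comap T^[j]]) x) *
      (c k x - (m[c k | F.comap T^[k]]) x) = ζ x * ξ x + ξ x * (c k x - d x) := fun x => by
    simp only [hξ, hζ, Pi.sub_apply]
    ring
  have hdi : Integrable d m := Integrable.of_bound
    (hdm.mono (hh.comap_iterate_le j)).aestronglyMeasurable 1
    (Eventually.of_forall fun x => Real.abs_cos_le_one _)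
  have hri : Integrable (fun x => ξ x * (c k x - d x)) m :=
    ((hci k).sub hdi).bdd_mul hξi.aestronglyMeasurable hξb
  simp_rw [hsplit]
  rw [integral_add (f := fun x => ζ x * ξ x) hζξ hri, hzero, zero_add]
  have hSi : Integrable (fun x => |birkhoffSum T h j x|) m :=
    ((hh.memLp_birkhoffSum j).integrable one_le_two).abs
  calc |∫ x, ξ x * (c k x - d x) ∂m| ≤ ∫ x, |ξ x * (c k x - d x)| ∂m :=
        abs_integral_le_integral_abs
    _ ≤ ∫ x, 2 * (|t| / √k) * |birkhoffSum T h j x| ∂m := by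
        refine integral_mono_ae hri.abs (hSi.const_mul _) ?_
        filter_upwards [hξb] with x hx
        simp only [abs_mul]
        have := mul_le_mul hx (hdiff x) (abs_nonneg _) zero_le_two
        linarith
    _ = 2 * (|t| / √k) * ∫ x, |birkhoffSum T h j x| ∂m := integral_const_mul _ _
    _ ≤ 2 * (|t| / √k) * (√(∫ x, h x ^ 2 ∂m) * √j) :=
        mul_le_mul_of_nonneg_left (hh.integral_abs_birkhoffSum_le j) (by positivity)
    _ = _ := by ring

/-- Almost sure convergence of the logarithmic averages of `cos (t Sₖ / √k + θ)`. -/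
theorem ae_tendsto_logAverage_cos (hh : IsReversedMartingaleDifference F m T h)
    (hT : Ergodic T m) (t θ : ℝ) :
    ∀ᵐ x ∂m, Tendsto (fun N : ℕ => (∑ k ∈ Finset.Icc 1 N,
      (1 / (k : ℝ)) * Real.cos (t * birkhoffSum T h k x / √k + θ)) / Real.log N) atTop
      (𝓝 (Real.exp (-(t ^ 2 * (∫ x, h x ^ 2 ∂m) / 2)) * Real.cos θ)) := by
  have hTm := hh.measurePreserving
  obtain ⟨c, hc⟩ : ∃ c : ℕ → X → ℝ,
    c = fun n y => Real.cos (t * birkhoffSum T h n y / √n + θ) := ⟨_, rfl⟩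
  set γ := Real.exp (-(t ^ 2 * (∫ x, h x ^ 2 ∂m) / 2)) * Real.cos θ with hγ
  have hcm : ∀ n, Measurable (c n) := fun n => by
    rw [hc]
    exact Real.measurable_cos.comp
      ((((hh.measurable_birkhoffSum n).const_mul t).div_const _).add_const θ)
  have hc1 : ∀ n x, |c n x| ≤ 1 := fun n x => by rw [hc]; exact Real.abs_cos_le_one _
  have hci : ∀ n, Integrable (c n) m := fun n =>
    Integrable.of_bound (hcm n).aestronglyMeasurable 1 (Eventually.of_forall (hc1 n))
  have hE1 : ∀ n, ∀ᵐ x ∂m, |(m[c n | F.comap T^[n]]) x| ≤ 1 := fun n =>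
    ae_bdd_abs_condExp_of_ae_bdd_abs (Eventually.of_forall (hc1 n))
  -- the fluctuations
  have hA := ae_tendsto_logAverage_of_correlation_le (m := m)
    (ξ := fun k x => c k x - (m[c k | F.comap T^[k]]) x) (B := 2)
    (fun k => (hci k).aestronglyMeasurable.sub integrable_condExp.aestronglyMeasurable)
    (fun k => by
      filter_upwards [hE1 k] with x hx
      refine (abs_sub _ _).trans ?_
      linarith [hc1 k x])
    (fun j k _ hjk => hh.abs_integral_fluctuation_mul_le t θ hjk hc)
  -- the conditional expectations
  have hMk := isMarkovOperator_transfer hTm hh.le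
  have hquench := hh.tendsto_transfer_iterate_cos hT t θ
  rw [← hγ] at hquench
  have hB := ae_tendsto_average_comp_iterate_of_tendsto_zero hTm
    (q := fun n x => (transfer m F T)^[n] (c n) x - γ) (C := 1 + |γ|)
    (fun n => (measurable_transfer_iterate hh.le (hcm n) n).sub_const γ)
    (fun n => by
      filter_upwards [hMk.abs_iterate_le (hci n) (Eventually.of_forall (hc1 n)) n] with x hx
      exact (abs_sub _ _).trans (by linarith))
    (by
      filter_upwards [hquench] with x hx
      rw [hc]
      simpa using hx.sub_const γ)
  have hcond : ∀ᵐ x ∂m, ∀ k, 1 ≤ k →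
      (transfer m F T)^[k] (c k) (T^[k] x) = (m[c k | F.comap T^[k]]) x := by
    refine ae_all_iff.2 fun k => ?_
    cases k with
    | zero => exact Eventually.of_forall fun x h0 => absurd h0 (by norm_num)
    | succ k =>
      filter_upwards [transfer_iterate_comp_iterate hTm hh.le hh.comap_le (hci (k + 1)) k]
        with x hx _ using hx
  filter_upwards [hA, hB, hcond] with x hxA hxB hxc
  have h1 := (hxA.add (tendsto_logAverage_of_tendsto_average hxB)).add
    (tendsto_harmonic_div_log.const_mul γ)
  rw [add_zero, zero_add, mul_one] at h1
  refine h1.congr fun N => ?_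
  rw [← add_div, mul_div_assoc', ← add_div, Finset.mul_sum, ← Finset.sum_add_distrib,
    ← Finset.sum_add_distrib]
  congr 1
  refine Finset.sum_congr rfl fun k hk => ?_
  rw [hxc k (Finset.mem_Icc.1 hk).1, hc]
  ring

/-- The characteristic functions of `Sₙ / √n` converge (in real form). -/
theorem tendsto_integral_cos (hh : IsReversedMartingaleDifference F m T h)
    (hT : Ergodic T m) (t θ : ℝ) :
    Tendsto (fun n : ℕ => ∫ x, Real.cos (t * birkhoffSum T h n x / √n + θ) ∂m) atTop
      (𝓝 (Real.exp (-(t ^ 2 * (∫ x, h x ^ 2 ∂m) / 2)) * Real.cos θ)) := by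
  have hTm := hh.measurePreserving
  have hMk := isMarkovOperator_transfer hTm hh.le
  set c : ℕ → X → ℝ := fun n y => Real.cos (t * birkhoffSum T h n y / √n + θ) with hc
  set γ := Real.exp (-(t ^ 2 * (∫ x, h x ^ 2 ∂m) / 2)) * Real.cos θ with hγ
  have hcm : ∀ n, Measurable (c n) := fun n => Real.measurable_cos.comp
    ((((hh.measurable_birkhoffSum n).const_mul t).div_const _).add_const θ)
  have hci : ∀ n, Integrable (c n) m := fun n =>
    Integrable.of_bound (hcm n).aestronglyMeasurable 1
      (Eventually.of_forall fun x => Real.abs_cos_le_one _)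
  have hint : ∀ n, ∫ x, (transfer m F T)^[n] (c n) x ∂m = ∫ x, c n x ∂m := by
    have : ∀ (n : ℕ) (p : X → ℝ), Integrable p m →
        ∫ x, (transfer m F T)^[n] p x ∂m = ∫ x, p x ∂m := by
      intro n p hp
      induction n with
      | zero => rfl
      | succ n ih =>
        rw [Function.iterate_succ_apply', hMk.integral_eq _ (hMk.integrable_iterate hp n), ih]
    exact fun n => this n _ (hci n)
  have h1 := tendsto_integral_of_dominated_convergence (μ := m)
    (F := fun n x => (transfer m F T)^[n] (c n) x) (f := fun _ => γ) (fun _ => 1)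
    (fun n => (measurable_transfer_iterate hh.le (hcm n) n).aestronglyMeasurable)
    (integrable_const 1)
    (fun n => hMk.abs_iterate_le (hci n)
      (Eventually.of_forall fun x => Real.abs_cos_le_one _) n)
    (hh.tendsto_transfer_iterate_cos hT t θ)
  simp only [integral_const, probReal_univ, smul_eq_mul, one_mul] at h1
  exact h1.congr hint

end IsReversedMartingaleDifference

/-! ### Lévy's convergence theorem from almost everywhere convergence -/

/-- Tightness only needs the characteristic functions to converge almost everywhere, since it is
controlled by their integrals over small intervals. -/
theorem isTightMeasureSet_of_ae_tendsto_charFun {μ : ℕ → ProbabilityMeasure ℝ}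
    {μ₀ : ProbabilityMeasure ℝ}
    (h : ∀ᵐ t : ℝ, Tendsto (fun n => charFun (μ n : Measure ℝ) t) atTop
      (𝓝 (charFun (μ₀ : Measure ℝ) t))) :
    IsTightMeasureSet (Set.range fun n => (μ n : Measure ℝ)) := by
  refine isTightMeasureSet_range_of_tendsto_limsup_measure_norm_gt ?_
  rw [ENNReal.tendsto_nhds_zero]
  intro ε hε
  obtain ⟨δ, hδ, hδε⟩ : ∃ δ : ℝ, 0 < δ ∧ ENNReal.ofReal δ ≤ ε := by
    rcases eq_or_ne ε ⊤ with rfl | hne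
    · exact ⟨1, one_pos, le_top⟩
    · exact ⟨ε.toReal, ENNReal.toReal_pos hε.ne' hne, ENNReal.ofReal_toReal_le⟩
  have hcont : Continuous (charFun (μ₀ : Measure ℝ)) := continuous_charFun
  have h0 := hcont.tendsto 0
  rw [charFun_zero, Metric.tendsto_nhds_nhds] at h0
  obtain ⟨ρ, hρ, hball⟩ := h0 (δ / 4) (by positivity)
  filter_upwards [eventually_gt_atTop (2 / ρ)] with r hr
  have hr0 : 0 < r := lt_trans (by positivity) hr
  have hsmall : 2 * r⁻¹ < ρ := by
    rw [← div_eq_mul_inv, div_lt_iff₀ hr0]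
    rwa [div_lt_iff₀ hρ, mul_comm] at hr
  have hlimint : 2⁻¹ * r * ‖∫ t in (-2 * r⁻¹)..(2 * r⁻¹), 1 - charFun (μ₀ : Measure ℝ) t‖ < δ := by
    have := intervalIntegral.norm_integral_le_of_norm_le_const (a := -2 * r⁻¹) (b := 2 * r⁻¹)
      (C := δ / 4) (f := fun t => 1 - charFun (μ₀ : Measure ℝ) t) (by
        intro t ht
        rw [Set.uIoc_of_le (by nlinarith [inv_pos.2 hr0])] at ht
        have hd : dist t 0 < ρ := by
          rw [Real.dist_eq, sub_zero, abs_lt]; constructor <;> linarith [ht.1, ht.2]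
        have := hball hd
        rw [dist_eq_norm, ← norm_neg] at this
        simpa using this.le)
    have habs : |2 * r⁻¹ - -2 * r⁻¹| = 4 * r⁻¹ := by
      rw [abs_of_pos (by nlinarith [inv_pos.2 hr0])]; ring
    rw [habs] at this
    calc _ ≤ 2⁻¹ * r * (δ / 4 * (4 * r⁻¹)) := by gcongr
      _ = δ / 2 := by field_simp
      _ < δ := by linarith
  have hconv : Tendsto (fun n => 2⁻¹ * r *
      ‖∫ t in (-2 * r⁻¹)..(2 * r⁻¹), 1 - charFun (μ n : Measure ℝ) t‖) atTop
      (𝓝 (2⁻¹ * r * ‖∫ t in (-2 * r⁻¹)..(2 * r⁻¹), 1 - charFun (μ₀ : Measure ℝ) t‖)) := by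
    refine (Tendsto.norm ?_).const_mul _
    have hr' : -2 * r⁻¹ ≤ 2 * r⁻¹ := by nlinarith [inv_pos.2 hr0]
    simp_rw [intervalIntegral.integral_of_le hr']
    refine tendsto_integral_of_dominated_convergence (fun _ => 2) ?_ (by fun_prop) ?_ ?_
    · exact fun _ => Measurable.aestronglyMeasurable (by fun_prop)
    · exact fun _ => ae_of_all _ fun _ => norm_one_sub_charFun_le_two
    · exact ae_restrict_of_ae (h.mono fun t ht => tendsto_const_nhds.sub ht)
  refine limsup_le_of_le (h := ?_)
  filter_upwards [hconv.eventually (gt_mem_nhds hlimint)] with n hn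
  have := (measureReal_abs_gt_le_integral_charFun (μ := (μ n : Measure ℝ)) hr0).trans hn.le
  simp only [Real.norm_eq_abs]
  rw [← ofReal_measureReal]
  exact (ENNReal.ofReal_le_ofReal this).trans hδε

theorem tendsto_of_ae_tendsto_charFun {μ : ℕ → ProbabilityMeasure ℝ}
    {μ₀ : ProbabilityMeasure ℝ}
    (h : ∀ᵐ t : ℝ, Tendsto (fun n => charFun (μ n : Measure ℝ) t) atTop
      (𝓝 (charFun (μ₀ : Measure ℝ) t))) :
    Tendsto μ atTop (𝓝 μ₀) := by
  have htight := isTightMeasureSet_of_ae_tendsto_charFun h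
  refine (Filter.tendsto_iff_ultrafilter _ _ _).2 fun U hU => ?_
  have hcompact : IsCompact (closure (Set.range μ)) :=
    isCompact_closure_of_isTightMeasureSet (by
      convert htight using 1
      ext ν
      simp)
  obtain ⟨μ', -, hμ' : Tendsto _ _ _⟩ := hcompact.ultrafilter_le_nhds (U.map μ)
    (.trans (by simp) (monotone_principal subset_closure))
  suffices hμ : (μ' : Measure ℝ) = μ₀ by
    have : μ' = μ₀ := Subtype.ext hμ
    rw [← this]; exact hμ'
  have hchar (t : ℝ) : Tendsto (fun n => charFun (μ n : Measure ℝ) t) U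
      (𝓝 (charFun (μ' : Measure ℝ) t)) := by
    rw [ProbabilityMeasure.tendsto_iff_forall_integral_rclike_tendsto ℂ] at hμ'
    simp_rw [charFun_eq_integral_innerProbChar]
    exact hμ' (BoundedContinuousFunction.innerProbChar t)
  have hae : charFun (μ' : Measure ℝ) =ᵐ[volume] charFun (μ₀ : Measure ℝ) :=
    h.mono fun t ht => tendsto_nhds_unique (hchar t) (ht.comp hU)
  exact Measure.ext_of_charFun ((Continuous.ae_eq_iff_eq volume continuous_charFun
    continuous_charFun).1 hae)

/-! ### Weak convergence of logarithmic empirical measures -/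

theorem integral_logEmpiricalMeasure (x : ℕ → ℝ) (N : ℕ) (φ : ℝ → ℂ) :
    ∫ y, φ y ∂(logEmpiricalMeasure x N : Measure ℝ) =
      ((1 / Real.log N : ℝ) : ℂ) * ∑ k ∈ Finset.Icc 1 N, ((1 / (k : ℝ) : ℝ) : ℂ) * φ (x k) := by
  have hlog : 0 ≤ 1 / Real.log N := one_div_nonneg.2 (Real.log_natCast_nonneg N)
  have hm : (logEmpiricalMeasure x N : Measure ℝ) = Real.toNNReal (1 / Real.log N) •
      ∑ k ∈ Finset.Icc 1 N, (1 / (k : NNReal)) • Measure.dirac (x k) := by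
    rw [logEmpiricalMeasure, FiniteMeasure.toMeasure_smul, FiniteMeasure.toMeasure_sum]
    rfl
  rw [hm, integral_smul_nnreal_measure, integral_finsetSum_measure]
  · simp only [integral_smul_nnreal_measure, integral_dirac, NNReal.smul_def, Complex.real_smul]
    rw [Real.coe_toNNReal _ hlog]
    push_cast
    rfl
  · intro k _
    refine Integrable.smul_measure_nnreal ?_
    exact integrable_dirac (by simp)

theorem mass_logEmpiricalMeasure (x : ℕ → ℝ) (N : ℕ) :
    ((logEmpiricalMeasure x N).mass : ℝ) =
      (∑ k ∈ Finset.Icc 1 N, 1 / (k : ℝ)) / Real.log N := by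
  have h := integral_logEmpiricalMeasure x N (fun _ => 1)
  rw [integral_const] at h
  have hm : (logEmpiricalMeasure x N : Measure ℝ).real Set.univ =
      (logEmpiricalMeasure x N).mass := rfl
  rw [hm] at h
  apply Complex.ofReal_injective
  simp only [Complex.real_smul, mul_one] at h
  rw [h]
  push_cast
  ring

/-- Weak convergence of logarithmic empirical measures follows from the convergence of the
logarithmic averages of `cos (t x_k + θ)`, for almost every frequency `t` and for the two phases
`0` and `-π / 2`, to the values prescribed by the characteristic function. -/
theorem tendsto_logEmpiricalMeasure_gaussianReal {x : ℕ → ℝ} {v : NNReal}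
    (h : ∀ᵐ t : ℝ, ∀ θ ∈ ({0, -(Real.pi / 2)} : Set ℝ), Tendsto (fun N : ℕ =>
      (∑ k ∈ Finset.Icc 1 N, (1 / (k : ℝ)) * Real.cos (t * x k + θ)) / Real.log N) atTop
      (𝓝 (Real.exp (-(t ^ 2 * v / 2)) * Real.cos θ))) :
    Tendsto (fun N : ℕ => logEmpiricalMeasure x N) atTop
      (𝓝 (⟨gaussianReal 0 v, inferInstance⟩ : FiniteMeasure ℝ)) := by
  set ν : ProbabilityMeasure ℝ := ⟨gaussianReal 0 v, inferInstance⟩ with hν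
  change Tendsto _ _ (𝓝 ν.toFiniteMeasure)
  have hmass : Tendsto (fun N : ℕ => (logEmpiricalMeasure x N).mass) atTop (𝓝 1) := by
    rw [← NNReal.tendsto_coe]
    simp_rw [mass_logEmpiricalMeasure]
    exact tendsto_harmonic_div_log
  refine FiniteMeasure.tendsto_of_tendsto_normalize_testAgainstNN_of_tendsto_mass ?_
    (by simpa using hmass)
  rw [ProbabilityMeasure.toFiniteMeasure_normalize_eq_self]
  refine tendsto_of_ae_tendsto_charFun ?_
  filter_upwards [h] with t ht
  have h1 := ht 0 (by simp)
  have h2 := ht (-(Real.pi / 2)) (by simp)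
  simp only [add_zero, Real.cos_zero, mul_one] at h1
  simp only [← sub_eq_add_neg, Real.cos_sub_pi_div_two, Real.cos_neg, Real.cos_pi_div_two,
    mul_zero] at h2
  have hchar : charFun (ν : Measure ℝ) t = ((Real.exp (-(t ^ 2 * v / 2)) : ℝ) : ℂ) := by
    rw [hν]
    change charFun (gaussianReal 0 v) t = _
    rw [charFun_gaussianReal]
    push_cast
    congr 1
    simp only [mul_zero, zero_mul, zero_sub]
    ring
  have hlim : Tendsto (fun N : ℕ => ∫ y, Complex.exp (t * y * Complex.I)
      ∂(logEmpiricalMeasure x N : Measure ℝ)) atTop (𝓝 (charFun (ν : Measure ℝ) t)) := by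
    have h3 := ((Complex.continuous_ofReal.tendsto _).comp h1).add
      (((Complex.continuous_ofReal.tendsto _).comp h2).mul_const Complex.I)
    rw [Complex.ofReal_zero, zero_mul, add_zero, ← hchar] at h3
    refine h3.congr fun N => ?_
    rw [integral_logEmpiricalMeasure]
    simp only [Function.comp_apply]
    push_cast
    rw [div_eq_mul_inv, div_eq_mul_inv, mul_right_comm _ _ Complex.I, ← add_mul, Finset.sum_mul,
      ← Finset.sum_add_distrib, mul_comm _ (_⁻¹), one_div]
    refine congrArg _ (Finset.sum_congr rfl fun k _ => ?_)
    rw [Complex.exp_mul_I]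
    ring
  have hmul := (((Complex.continuous_ofReal.tendsto _).comp
    ((NNReal.continuous_coe.tendsto _).comp hmass)).inv₀ (by simp)).mul hlim
  simp only [NNReal.coe_one, Complex.ofReal_one, inv_one, one_mul] at hmul
  refine hmul.congr' ?_
  filter_upwards [hmass.eventually_ne one_ne_zero] with N hN
  have hN0 : logEmpiricalMeasure x N ≠ 0 := by
    rwa [← FiniteMeasure.mass_nonzero_iff]
  rw [charFun_apply_real, FiniteMeasure.toMeasure_normalize_eq_of_nonzero _ hN0,
    integral_smul_nnreal_measure, NNReal.smul_def, Complex.real_smul]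
  push_cast
  rfl

/-! ### The martingale-coboundary decomposition -/

section Gordin

variable {X : Type*} {F : MeasurableSpace X} {mX : MeasurableSpace X} {m : Measure X}
  {T : X → X}

theorem eLpNorm_sub_condExp_le [IsProbabilityMeasure m]
    (hF : F ≤ mX) {u : X → ℝ} (hu : MemLp u 2 m) :
    eLpNorm (u - m[u | F]) 2 m ≤ eLpNorm u 2 m := by
  have hd : MemLp (u - m[u | F]) 2 m := hu.sub (hu.condExp one_le_two)
  have hint : ∫ x, (u - m[u | F]) x ^ 2 ∂m ≤ ∫ x, u x ^ 2 ∂m := by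
    have h1 := integral_mono_ae integrable_condVar integrable_condExp
      (condVar_ae_le_condExp_sq hF hu)
    rw [integral_condExp hF, condVar, integral_condExp hF] at h1
    exact h1
  rw [hd.eLpNorm_eq_integral_rpow_norm two_ne_zero ENNReal.ofNat_ne_top,
    hu.eLpNorm_eq_integral_rpow_norm two_ne_zero ENNReal.ofNat_ne_top]
  refine ENNReal.ofReal_le_ofReal (Real.rpow_le_rpow (by positivity) ?_ (by positivity))
  simpa using hint

/-- The conditional expectation is the best approximation in `L²` by `F`-measurable functions. -/
theorem eLpNorm_condExp_sub_le [IsProbabilityMeasure m]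
    (hF : F ≤ mX) {p q : X → ℝ} (hp : MemLp p 2 m) (hq : MemLp q 2 m)
    (hqm : StronglyMeasurable[F] q) :
    eLpNorm (m[p | F] - p) 2 m ≤ eLpNorm (q - p) 2 m := by
  refine le_trans (le_of_eq (eLpNorm_congr_ae ?_)) (eLpNorm_sub_condExp_le hF (hq.sub hp))
  have h1 := condExp_sub (hq.integrable one_le_two) (hp.integrable one_le_two) F
  have h2 := condExp_of_stronglyMeasurable hF hqm (hq.integrable one_le_two)
  filter_upwards [h1] with x hx
  simp only [Pi.sub_apply] at hx ⊢
  rw [hx, h2]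
  ring

theorem eLpNorm_condExp_comp_iterate_sub_le [IsProbabilityMeasure m]
    (hT : MeasurePreserving T m m) (hF : F ≤ mX)
    {f : X → ℝ} (hf : MemLp f 2 m) (n : ℕ) :
    eLpNorm (m[f ∘ T^[n] | F] - f ∘ T^[n]) 2 m ≤
      eLpNorm (m[f | imageSigmaAlgebra mX T^[n] F] - f) 2 m := by
  have hTn := hT.iterate n
  have hq : MemLp (m[f | imageSigmaAlgebra mX T^[n] F]) 2 m := hf.condExp one_le_two
  have hle : imageSigmaAlgebra mX T^[n] F ≤ F.map T^[n] := inf_le_left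
  have hmeas : StronglyMeasurable[F] (m[f | imageSigmaAlgebra mX T^[n] F] ∘ T^[n]) :=
    (stronglyMeasurable_condExp.mono hle).comp_measurable
      (measurable_iff_le_map.2 le_rfl)
  have hbest := eLpNorm_condExp_sub_le hF (hf.comp_measurePreserving hTn)
    (hq.comp_measurePreserving hTn) hmeas
  generalize m[f | imageSigmaAlgebra mX T^[n] F] = q at *
  rw [← eLpNorm_comp_measurePreserving (hq.sub hf).aestronglyMeasurable hTn]
  exact hbest

theorem memLp_transfer_iterate (hT : MeasurePreserving T m m) (hF : F ≤ mX) {f : X → ℝ}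
    (hf : MemLp f 2 m) (n : ℕ) : MemLp ((transfer m F T)^[n] f) 2 m := by
  induction n with
  | zero => exact hf
  | succ n ih =>
    rw [Function.iterate_succ_apply']
    exact memLp_transfer_of_memLp_condExp hT hF (ih.condExp one_le_two)

theorem eLpNorm_transfer_iterate [IsProbabilityMeasure m]
    (hT : MeasurePreserving T m m) (hF : F ≤ mX)
    (hFT : F.comap T ≤ F) {f : X → ℝ} (hf : MemLp f 2 m) (n : ℕ) :
    eLpNorm ((transfer m F T)^[n + 1] f) 2 m = eLpNorm (m[f | F.comap T^[n + 1]]) 2 m := by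
  rw [← eLpNorm_congr_ae
    (transfer_iterate_comp_iterate hT hF hFT (hf.integrable one_le_two) n),
    eLpNorm_comp_measurePreserving
      (memLp_transfer_iterate hT hF hf (n + 1)).aestronglyMeasurable (hT.iterate (n + 1))]

/-- The `n`-th term of the series whose sum is the transfer function in the decomposition of `f`
as a reversed martingale difference plus a coboundary. -/
noncomputable def gordinTerm (m : Measure X) (F : MeasurableSpace X) (T : X → X) (f : X → ℝ)
    (n : ℕ) : X → ℝ :=
  (m[f ∘ T^[n] | F] - f ∘ T^[n]) + (transfer m F T)^[n + 1] f

theorem memLp_gordinTerm (hT : MeasurePreserving T m m) (hF : F ≤ mX) {f : X → ℝ}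
    (hf : MemLp f 2 m) (n : ℕ) : MemLp (gordinTerm m F T f n) 2 m := by
  have h := hf.comp_measurePreserving (hT.iterate n)
  exact ((h.condExp one_le_two).sub h).add (memLp_transfer_iterate hT hF hf (n + 1))

/-- The partial sums of the decomposition: `f + g - g ∘ T`, where `g` is the sum of the terms of
index `< N`. -/
noncomputable def gordinPartial (m : Measure X) (F : MeasurableSpace X) (T : X → X) (f : X → ℝ) :
    ℕ → X → ℝ
  | 0 => f
  | N + 1 => gordinPartial m F T f N + (gordinTerm m F T f N - gordinTerm m F T f N ∘ T)

theorem memLp_gordinPartial (hT : MeasurePreserving T m m) (hF : F ≤ mX) {f : X → ℝ}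
    (hf : MemLp f 2 m) (N : ℕ) : MemLp (gordinPartial m F T f N) 2 m := by
  induction N with
  | zero => exact hf
  | succ N ih =>
    exact ih.add ((memLp_gordinTerm hT hF hf N).sub
      ((memLp_gordinTerm hT hF hf N).comp_measurePreserving hT))

theorem gordinPartial_eq (f : X → ℝ) (N : ℕ) (x : X) :
    gordinPartial m F T f N x = f x + ∑ n ∈ Finset.range N, gordinTerm m F T f n x
      - ∑ n ∈ Finset.range N, gordinTerm m F T f n (T x) := by
  induction N with
  | zero => simp [gordinPartial]
  | succ N ih =>
    simp only [gordinPartial, Pi.add_apply, Pi.sub_apply, Function.comp_apply, ih,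
      Finset.sum_range_succ]
    ring

theorem gordinPartial_succ_ae_eq [IsProbabilityMeasure m]
    (hT : MeasurePreserving T m m) (hF : F ≤ mX)
    {f : X → ℝ} (hf : MemLp f 2 m) (N : ℕ) :
    gordinPartial m F T f (N + 1) =ᵐ[m]
      (gordinPartial m F T f N + (m[f ∘ T^[N] | F] - f ∘ T^[N])) +
        (transfer m F T)^[N + 1] f - m[f ∘ T^[N + 1] | F.comap T] + f ∘ T^[N + 1]
          - m[(transfer m F T)^[N] f | F.comap T] := by
  have h1 := condExp_comp_ae_eq hT hF
    ((hf.comp_measurePreserving (hT.iterate N)).integrable one_le_two)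
  have h2 : (transfer m F T)^[N + 1] f ∘ T = m[(transfer m F T)^[N] f | F.comap T] := by
    rw [Function.iterate_succ_apply', transfer_comp]
  rw [Function.comp_assoc, ← Function.iterate_succ] at h1
  filter_upwards [h1] with x hx
  have hx2 := congrFun h2 x
  simp only [gordinPartial, gordinTerm, Pi.add_apply, Pi.sub_apply, Function.comp_apply,
    Function.iterate_succ_apply T] at hx hx2 ⊢
  rw [hx, hx2]
  ring

/-- Telescoping: conditioning the partial sums on `F` only removes the last future error. -/
theorem condExp_gordinPartial [IsProbabilityMeasure m]
    (hT : MeasurePreserving T m m) (hF : F ≤ mX)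
    (hFT : F.comap T ≤ F) {f : X → ℝ} (hf : MemLp f 2 m) (N : ℕ) :
    m[gordinPartial m F T f N | F] =ᵐ[m]
      gordinPartial m F T f N + (m[f ∘ T^[N] | F] - f ∘ T^[N]) := by
  induction N with
  | zero => exact .of_forall fun x => by simp [gordinPartial]
  | succ N ih =>
    have hfN := (hf.comp_measurePreserving (hT.iterate (N + 1))).integrable one_le_two
    set v : X → ℝ := (transfer m F T)^[N + 1] f - m[f ∘ T^[N + 1] | F.comap T]
      - m[(transfer m F T)^[N] f | F.comap T] with hv
    have hvm : StronglyMeasurable[F] v := by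
      refine ((?_ : StronglyMeasurable[F] ((transfer m F T)^[N + 1] f)).sub
        (stronglyMeasurable_condExp.mono hFT)).sub (stronglyMeasurable_condExp.mono hFT)
      rw [Function.iterate_succ_apply']
      exact stronglyMeasurable_transfer _
    have hvi : Integrable v m :=
      (((memLp_transfer_iterate hT hF hf (N + 1)).integrable one_le_two).sub
        integrable_condExp).sub integrable_condExp
    have h1 : gordinPartial m F T f (N + 1) =ᵐ[m]
        m[gordinPartial m F T f N | F] + v + f ∘ T^[N + 1] := by
      filter_upwards [gordinPartial_succ_ae_eq hT hF hf N, ih] with x hx hx2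
      rw [hx]
      simp only [hv, Pi.add_apply, Pi.sub_apply] at hx2 ⊢
      rw [hx2]
      ring
    have h2 : m[m[gordinPartial m F T f N | F] + v | F] =
        m[gordinPartial m F T f N | F] + v :=
      condExp_of_stronglyMeasurable hF (stronglyMeasurable_condExp.add hvm)
        (integrable_condExp.add hvi)
    have h3 := condExp_add (integrable_condExp.add hvi : Integrable
      (m[gordinPartial m F T f N | F] + v) m) hfN F
    filter_upwards [h1, condExp_congr_ae (m := F) h1, h3] with x hx1 hx2 hx3
    rw [hx2, hx3, Pi.add_apply, Pi.add_apply, hx1, h2]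
    simp only [Pi.add_apply, Pi.sub_apply]
    ring

/-- Telescoping: conditioning the partial sums on `T⁻¹ F` only leaves the last past term. -/
theorem condExp_comap_gordinPartial [IsProbabilityMeasure m]
    (hT : MeasurePreserving T m m) (hF : F ≤ mX)
    (hFT : F.comap T ≤ F) {f : X → ℝ} (hf : MemLp f 2 m) (N : ℕ) :
    m[gordinPartial m F T f N | F.comap T] =ᵐ[m] m[(transfer m F T)^[N] f | F.comap T] := by
  induction N with
  | zero => exact .of_forall fun x => by simp [gordinPartial]
  | succ N ih =>
    have hle := comap_le_of_measurable hT.measurable hF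
    have hfN := (hf.comp_measurePreserving (hT.iterate (N + 1))).integrable one_le_two
    have hb := (memLp_transfer_iterate hT hF hf (N + 1)).integrable one_le_two
    set w : X → ℝ := m[f ∘ T^[N + 1] | F.comap T] + m[(transfer m F T)^[N] f | F.comap T] with hw
    have hwi : Integrable w m := integrable_condExp.add integrable_condExp
    have h1 : gordinPartial m F T f (N + 1) =ᵐ[m]
        (m[gordinPartial m F T f N | F] + (transfer m F T)^[N + 1] f + f ∘ T^[N + 1]) - w := by
      filter_upwards [gordinPartial_succ_ae_eq hT hF hf N,
        condExp_gordinPartial hT hF hFT hf N] with x hx hx2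
      rw [hx]
      simp only [hw, Pi.add_apply, Pi.sub_apply] at hx2 ⊢
      rw [hx2]
      ring
    have hi1 : Integrable (m[gordinPartial m F T f N | F] + (transfer m F T)^[N + 1] f) m :=
      integrable_condExp.add hb
    have h2 := condExp_sub (hi1.add hfN) hwi (F.comap T)
    have h3 := condExp_add hi1 hfN (F.comap T)
    have h4 := condExp_add (integrable_condExp (m := F) (f := gordinPartial m F T f N) (μ := m))
      hb (F.comap T)
    have h5 : m[w | F.comap T] = w := condExp_of_stronglyMeasurable hle
      (stronglyMeasurable_condExp.add stronglyMeasurable_condExp) hwi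
    have h6 : m[m[gordinPartial m F T f N | F] | F.comap T] =ᵐ[m]
        m[gordinPartial m F T f N | F.comap T] := condExp_condExp_of_le hFT hF
    filter_upwards [condExp_congr_ae (m := F.comap T) h1, h2, h3, h4, h6, ih]
      with x hx1 hx2 hx3 hx4 hx6 hx7
    rw [hx1, hx2, Pi.sub_apply, hx3, Pi.add_apply, hx4, Pi.add_apply, hx6, hx7, h5]
    simp only [hw, Pi.add_apply]
    ring

theorem exists_tendsto_eLpNorm_sum_sub {u : ℕ → X → ℝ} (hu : ∀ n, MemLp (u n) 2 m)
    (hsum : ∑' n, eLpNorm (u n) 2 m ≠ ⊤) :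
    ∃ g : X → ℝ, Measurable g ∧ MemLp g 2 m ∧
      Tendsto (fun N => eLpNorm (∑ n ∈ Finset.range N, u n - g) 2 m) atTop (𝓝 0) := by
  have hs : Summable fun n => (hu n).toLp (u n) := by
    refine Summable.of_norm ?_
    simp_rw [Lp.norm_toLp]
    exact ENNReal.summable_toReal hsum
  set G : Lp ℝ 2 m := ∑' n, (hu n).toLp (u n) with hG
  refine ⟨G, (Lp.stronglyMeasurable G).measurable, Lp.memLp G, ?_⟩
  have hlim := (Lp.tendsto_Lp_iff_tendsto_eLpNorm' _ _).1 hs.hasSum.tendsto_sum_nat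
  refine hlim.congr fun N => eLpNorm_congr_ae (EventuallyEq.sub ?_ EventuallyEq.rfl)
  refine (Lp.coeFn_finsetSum _ _).trans ?_
  have hall : ∀ᵐ x ∂m, ∀ n, ((hu n).toLp (u n)) x = u n x :=
    ae_all_iff.2 fun n => (hu n).coeFn_toLp
  filter_upwards [hall] with x hx
  rw [Finset.sum_apply, Finset.sum_apply]
  exact Finset.sum_congr rfl fun n _ => hx n

theorem ae_eq_zero_of_eLpNorm_le_of_tendsto {u : X → ℝ} (hu : AEStronglyMeasurable u m)
    {c : ℕ → ENNReal} (hc : Tendsto c atTop (𝓝 0)) (h : ∀ N, eLpNorm u 2 m ≤ c N) :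
    u =ᵐ[m] 0 :=
  (eLpNorm_eq_zero_iff hu two_ne_zero).1 (le_antisymm (ge_of_tendsto' hc h) zero_le)

variable [IsProbabilityMeasure m]

/-- The martingale-coboundary decomposition: `f` is almost everywhere the sum of a square
integrable reversed martingale difference and of a coboundary. -/
theorem exists_reversedMartingaleDifference_add_coboundary (hT : MeasurePreserving T m m)
    (hF : F ≤ mX) (hFT : F.comap T ≤ F) {f : X → ℝ} (hf : MemLp f 2 m)
    (hpos : ∑' n : ℕ, eLpNorm (m[f | imageSigmaAlgebra mX T^[n] F] - f) 2 m ≠ ⊤)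
    (hneg : ∑' n : ℕ, eLpNorm (m[f | F.comap T^[n]]) 2 m ≠ ⊤) :
    ∃ h g : X → ℝ, IsReversedMartingaleDifference F m T h ∧ Measurable g ∧ MemLp g 2 m ∧
      f =ᵐ[m] h + g ∘ T - g := by
  have hle := comap_le_of_measurable hT.measurable hF
  have ha : Tendsto (fun N => eLpNorm (m[f ∘ T^[N] | F] - f ∘ T^[N]) 2 m) atTop (𝓝 0) :=
    tendsto_of_tendsto_of_tendsto_of_le_of_le tendsto_const_nhds
      (ENNReal.tendsto_atTop_zero_of_tsum_ne_top hpos) (fun _ => zero_le)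
      (fun N => eLpNorm_condExp_comp_iterate_sub_le hT hF hf N)
  have hb : Tendsto (fun N => eLpNorm ((transfer m F T)^[N] f) 2 m) atTop (𝓝 0) := by
    rw [← tendsto_add_atTop_iff_nat 1]
    simp_rw [eLpNorm_transfer_iterate hT hF hFT hf]
    exact (tendsto_add_atTop_iff_nat 1).2 (ENNReal.tendsto_atTop_zero_of_tsum_ne_top hneg)
  have hsum : ∑' n, eLpNorm (gordinTerm m F T f n) 2 m ≠ ⊤ := by
    refine ne_top_of_le_ne_top (ENNReal.add_ne_top.2 ⟨hpos, hneg⟩) ?_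
    calc ∑' n, eLpNorm (gordinTerm m F T f n) 2 m
        ≤ ∑' n, (eLpNorm (m[f | imageSigmaAlgebra mX T^[n] F] - f) 2 m +
          eLpNorm (m[f | F.comap T^[n + 1]]) 2 m) := by
          refine ENNReal.tsum_le_tsum fun n => ?_
          have hfn := hf.comp_measurePreserving (hT.iterate n)
          refine (eLpNorm_add_le ((hfn.condExp one_le_two).sub hfn).aestronglyMeasurable
            (memLp_transfer_iterate hT hF hf (n + 1)).aestronglyMeasurable one_le_two).trans ?_
          rw [eLpNorm_transfer_iterate hT hF hFT hf]
          gcongr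
          exact eLpNorm_condExp_comp_iterate_sub_le hT hF hf n
      _ ≤ _ := by
          rw [ENNReal.tsum_add]
          exact add_le_add le_rfl (ENNReal.tsum_comp_le_tsum_of_injective (add_left_injective 1)
            fun n => eLpNorm (m[f | F.comap T^[n]]) 2 m)
  obtain ⟨g, hgm, hg, hglim⟩ := exists_tendsto_eLpNorm_sum_sub
    (fun n => memLp_gordinTerm hT hF hf n) hsum
  have hgT := hg.comp_measurePreserving hT
  set h₀ : X → ℝ := f + g - g ∘ T with hh₀
  have hh₀L : MemLp h₀ 2 m := (hf.add hg).sub hgT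
  have hGL (N : ℕ) : MemLp (∑ n ∈ Finset.range N, gordinTerm m F T f n - g) 2 m :=
    (memLp_finsetSum' _ fun n _ => memLp_gordinTerm hT hF hf n).sub hg
  -- the partial decompositions converge in `L²`
  have hd : Tendsto (fun N => eLpNorm (h₀ - gordinPartial m F T f N) 2 m) atTop (𝓝 0) := by
    have h2 : Tendsto (fun N => eLpNorm (∑ n ∈ Finset.range N, gordinTerm m F T f n - g) 2 m +
        eLpNorm (∑ n ∈ Finset.range N, gordinTerm m F T f n - g) 2 m) atTop (𝓝 0) := by
      simpa using hglim.add hglim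
    refine tendsto_of_tendsto_of_tendsto_of_le_of_le tendsto_const_nhds h2
      (fun _ => zero_le) (fun N => ?_)
    have heq : h₀ - gordinPartial m F T f N =
        (∑ n ∈ Finset.range N, gordinTerm m F T f n - g) ∘ T -
          (∑ n ∈ Finset.range N, gordinTerm m F T f n - g) := by
      ext x
      simp only [hh₀, Pi.sub_apply, Pi.add_apply, Function.comp_apply, gordinPartial_eq,
        Finset.sum_apply]
      ring
    rw [heq]
    refine (eLpNorm_sub_le ((hGL N).comp_measurePreserving hT).aestronglyMeasurable
      (hGL N).aestronglyMeasurable one_le_two).trans ?_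
    rw [eLpNorm_comp_measurePreserving (hGL N).aestronglyMeasurable hT]
  have hdi (N : ℕ) : MemLp (h₀ - gordinPartial m F T f N) 2 m :=
    hh₀L.sub (memLp_gordinPartial hT hF hf N)
  have hsplit (N : ℕ) (F' : MeasurableSpace X) : m[h₀ | F'] =ᵐ[m]
      m[h₀ - gordinPartial m F T f N | F'] + m[gordinPartial m F T f N | F'] := by
    have := condExp_add ((hdi N).integrable one_le_two)
      ((memLp_gordinPartial hT hF hf N).integrable one_le_two) F'
    rwa [sub_add_cancel] at this
  have hF0 : m[h₀ | F] =ᵐ[m] h₀ := by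
    have : m[h₀ | F] - h₀ =ᵐ[m] 0 := by
      have hc : Tendsto (fun N => (eLpNorm (h₀ - gordinPartial m F T f N) 2 m +
          eLpNorm (h₀ - gordinPartial m F T f N) 2 m) +
          eLpNorm (m[f ∘ T^[N] | F] - f ∘ T^[N]) 2 m) atTop (𝓝 0) := by
        simpa using (hd.add hd).add ha
      refine ae_eq_zero_of_eLpNorm_le_of_tendsto
        ((hh₀L.condExp one_le_two).sub hh₀L).aestronglyMeasurable hc fun N => ?_
      have hfN := hf.comp_measurePreserving (hT.iterate N)
      have heq : m[h₀ | F] - h₀ =ᵐ[m] (m[h₀ - gordinPartial m F T f N | F] -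
          (h₀ - gordinPartial m F T f N)) + (m[f ∘ T^[N] | F] - f ∘ T^[N]) := by
        filter_upwards [hsplit N F, condExp_gordinPartial hT hF hFT hf N] with x hx hx2
        simp only [Pi.add_apply, Pi.sub_apply] at hx hx2 ⊢
        rw [hx, hx2]
        ring
      rw [eLpNorm_congr_ae heq]
      refine (eLpNorm_add_le (((hdi N).condExp one_le_two).sub (hdi N)).aestronglyMeasurable
        ((hfN.condExp one_le_two).sub hfN).aestronglyMeasurable one_le_two).trans ?_
      gcongr
      refine (eLpNorm_sub_le ((hdi N).condExp one_le_two).aestronglyMeasurable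
        (hdi N).aestronglyMeasurable one_le_two).trans ?_
      gcongr
      exact eLpNorm_condExp_le_eLpNorm _ one_le_two
    filter_upwards [this] with x hx using sub_eq_zero.1 hx
  have hF1 : m[h₀ | F.comap T] =ᵐ[m] 0 := by
    have hc : Tendsto (fun N => eLpNorm (h₀ - gordinPartial m F T f N) 2 m +
        eLpNorm ((transfer m F T)^[N] f) 2 m) atTop (𝓝 0) := by simpa using hd.add hb
    refine ae_eq_zero_of_eLpNorm_le_of_tendsto
      (hh₀L.condExp one_le_two).aestronglyMeasurable hc fun N => ?_
    have heq : m[h₀ | F.comap T] =ᵐ[m] m[h₀ - gordinPartial m F T f N | F.comap T] +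
        m[(transfer m F T)^[N] f | F.comap T] :=
      (hsplit N (F.comap T)).trans
        (EventuallyEq.rfl.add (condExp_comap_gordinPartial hT hF hFT hf N))
    rw [eLpNorm_congr_ae heq]
    refine (eLpNorm_add_le ((hdi N).condExp one_le_two).aestronglyMeasurable
      ((memLp_transfer_iterate hT hF hf N).condExp one_le_two).aestronglyMeasurable
      one_le_two).trans ?_
    gcongr
    · exact eLpNorm_condExp_le_eLpNorm _ one_le_two
    · exact eLpNorm_condExp_le_eLpNorm _ one_le_two
  refine ⟨m[h₀ | F], g, ⟨hF, hT, hFT, stronglyMeasurable_condExp, hh₀L.condExp one_le_two,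
    (condExp_condExp_of_le hFT hF).trans hF1⟩, hgm, hg, ?_⟩
  filter_upwards [hF0] with x hx
  rw [Pi.sub_apply, Pi.add_apply, hx]
  simp only [hh₀, Pi.add_apply, Pi.sub_apply]
  ring

end Gordin

/-! ### Tightness of the maxima -/

section TightMaxima

variable {X : Type*} {F : MeasurableSpace X} {mX : MeasurableSpace X} {m : Measure X}
  {T : X → X} {h : X → ℝ}

/-- Birkhoff sums of `h + g ∘ T - g` telescope. -/
theorem ae_birkhoffSum_eq_of_ae_eq_add_coboundary (hT : MeasurePreserving T m m) {f g : X → ℝ}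
    (hf : f =ᵐ[m] h + g ∘ T - g) :
    ∀ᵐ x ∂m, ∀ k, birkhoffSum T f k x = birkhoffSum T h k x + (g (T^[k] x) - g x) := by
  have hall : ∀ᵐ x ∂m, ∀ k, f (T^[k] x) = h (T^[k] x) + g (T (T^[k] x)) - g (T^[k] x) :=
    ae_all_iff.2 fun k => (hT.iterate k).quasiMeasurePreserving.ae hf
  filter_upwards [hall] with x hx k
  induction k with
  | zero => simp
  | succ k ih =>
    rw [birkhoffSum_succ, birkhoffSum_succ, ih, hx k, Function.iterate_succ_apply']
    ring

variable [IsProbabilityMeasure m]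

/-- For fixed `n`, the `σ`-algebras `T⁻ⁿ⁺ⁱ F` increase with `i`: this is time reversal. -/
def reversedFiltration (hT : Measurable T) (hF : F ≤ mX) (hFT : F.comap T ≤ F) (n : ℕ) :
    Filtration ℕ mX where
  seq i := F.comap T^[n - i]
  mono' _ _ hij := comap_iterate_antitone hFT (Nat.sub_le_sub_left hij n)
  le' i := comap_iterate_le hT hF (n - i)

namespace IsReversedMartingaleDifference

theorem martingale_sum_Ico (hh : IsReversedMartingaleDifference F m T h) (n : ℕ) :
    Martingale (fun i x => ∑ k ∈ Finset.Ico (n - i) n, h (T^[k] x))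
      (reversedFiltration hh.measurePreserving.measurable hh.le hh.comap_le n) m := by
  have hsm (i : ℕ) : StronglyMeasurable[F.comap T^[n - i]]
      fun x => ∑ k ∈ Finset.Ico (n - i) n, h (T^[k] x) := hh.stronglyMeasurable_sum_Ico (n - i) n
  have hint (i : ℕ) : Integrable (fun x => ∑ k ∈ Finset.Ico (n - i) n, h (T^[k] x)) m :=
    integrable_finsetSum _ fun k _ => hh.integrable_comp k
  refine martingale_nat hsm hint fun i => ?_
  change _ =ᵐ[m] m[_ | F.comap T^[n - i]]
  have hself := condExp_of_stronglyMeasurable (hh.comap_iterate_le (n - i)) (hsm i) (hint i)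
  rcases le_or_gt n i with hni | hni
  · have : n - (i + 1) = n - i := by omega
    rw [this, hself]
  · obtain ⟨k, hk⟩ : ∃ k, n - i = k + 1 := ⟨n - i - 1, by omega⟩
    have hk' : n - (i + 1) = k := by omega
    have hsplit : (fun x => ∑ l ∈ Finset.Ico k n, h (T^[l] x)) =
        (fun x => h (T^[k] x)) + fun x => ∑ l ∈ Finset.Ico (n - i) n, h (T^[l] x) := by
      ext x
      rw [Pi.add_apply, hk, Finset.sum_eq_sum_Ico_succ_bot (by omega)]
    rw [hk', hsplit]
    have hadd := condExp_add (hh.integrable_comp k) (hint i) (F.comap T^[n - i])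
    have hzero := hh.condExp_comp k
    rw [← hk] at hzero
    filter_upwards [hadd, hzero] with x hx hx2
    rw [hx, Pi.add_apply, hx2, hself]
    simp

/-- Doob's maximal inequality for the reversed partial sums, which control the partial sums since
`S_k = S_n - (S_n - S_k)`. -/
theorem measure_exists_lt_abs_birkhoffSum_le (hh : IsReversedMartingaleDifference F m T h)
    {n : ℕ} (hn : 1 ≤ n) {c : ℝ} (hc : 0 < c) :
    m {x | ∃ k ≤ n, 2 * c * √n < |birkhoffSum T h k x|} ≤
      ENNReal.ofReal (√(∫ x, h x ^ 2 ∂m) / c) := by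
  have hn0 : 0 < √(n : ℝ) := Real.sqrt_pos.2 (by exact_mod_cast hn)
  have hM := hh.martingale_sum_Ico n
  have hsub := hM.submartingale.sup hM.neg.submartingale
  set M : ℕ → X → ℝ := fun i x => ∑ k ∈ Finset.Ico (n - i) n, h (T^[k] x) with hMdef
  have habs (i : ℕ) (x : X) : (M ⊔ -M) i x = |M i x| := rfl
  have hS (k : ℕ) (hk : k ≤ n) (x : X) : birkhoffSum T h k x = M n x - M (n - k) x := by
    have hk' : n - (n - k) = k := by omega
    simp only [hMdef, birkhoffSum, Nat.sub_self, hk', ← Finset.range_eq_Ico]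
    rw [← Finset.sum_range_add_sum_Ico _ hk]
    ring
  set ε : NNReal := ⟨c * √n, by positivity⟩ with hε
  have hmax := maximal_ineq hsub (ε := ε) (fun i x => by rw [habs]; exact abs_nonneg _) n
  set E := {x | (ε : ℝ) ≤ (Finset.range (n + 1)).sup' Finset.nonempty_range_add_one
    fun k => (M ⊔ -M) k x} with hE
  have hsubset : {x | ∃ k ≤ n, 2 * c * √n < |birkhoffSum T h k x|} ⊆ E := by
    rintro x ⟨k, hk, hlt⟩
    rw [hS k hk] at hlt
    have htri := abs_sub (M n x) (M (n - k) x)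
    have hor : c * √n ≤ |M n x| ∨ c * √n ≤ |M (n - k) x| := by
      by_contra! hcon
      linarith [hcon.1, hcon.2]
    rw [hE, Set.mem_ofPred_eq, Finset.le_sup'_iff]
    rcases hor with h1 | h1
    · exact ⟨n, Finset.mem_range.2 (by omega), h1⟩
    · exact ⟨n - k, Finset.mem_range.2 (by omega), h1⟩
  have hMn (x : X) : (M ⊔ -M) n x = |birkhoffSum T h n x| := by
    rw [habs, hS n le_rfl, Nat.sub_self]
    simp [hMdef]
  have hbound : ε * m E ≤ ENNReal.ofReal (√(∫ x, h x ^ 2 ∂m) * √n) := by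
    refine hmax.trans (ENNReal.ofReal_le_ofReal ?_)
    simp_rw [hMn]
    exact (setIntegral_le_integral ((hh.memLp_birkhoffSum n).integrable one_le_two).abs
      (ae_of_all _ fun x => abs_nonneg _)).trans (hh.integral_abs_birkhoffSum_le n)
  refine (measure_mono hsubset).trans ?_
  have hεpos : 0 < c * √(n : ℝ) := mul_pos hc hn0
  have hεe : (ε : ENNReal) = ENNReal.ofReal (c * √n) := (ENNReal.ofReal_eq_coe_nnreal _).symm
  rw [hεe, mul_comm] at hbound
  have := ENNReal.le_div_iff_mul_le (Or.inl (ENNReal.ofReal_pos.2 hεpos).ne')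
    (Or.inl ENNReal.ofReal_ne_top) |>.2 hbound
  rw [← ENNReal.ofReal_div_of_pos hεpos, mul_div_mul_right _ _ hn0.ne'] at this
  exact this

end IsReversedMartingaleDifference

theorem measure_exists_lt_abs_comp_iterate_le (hT : MeasurePreserving T m m) {g : X → ℝ}
    (hg : MemLp g 2 m) (hgm : Measurable g) {n : ℕ} (hn : 1 ≤ n) {c : ℝ} (hc : 0 < c) :
    m {x | ∃ k ≤ n, c * √n < |g (T^[k] x)|} ≤ ENNReal.ofReal (2 * (∫ x, g x ^ 2 ∂m) / c ^ 2) := by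
  have hn1 : (1 : ℝ) ≤ n := by exact_mod_cast hn
  have hnpos : (0 : ℝ) < c ^ 2 * n := by positivity
  set A : Set X := {x | c * √n < |g x|} with hA
  have hAm : MeasurableSet A := measurableSet_lt measurable_const hgm.abs
  have hAle : m A ≤ ENNReal.ofReal ((∫ x, g x ^ 2 ∂m) / (c ^ 2 * n)) := by
    have hcheb := mul_meas_ge_le_integral_of_nonneg (μ := m) (f := fun x => g x ^ 2)
      (ae_of_all _ fun x => sq_nonneg _) hg.integrable_sq (c ^ 2 * n)
    have hsub : A ⊆ {x | c ^ 2 * n ≤ g x ^ 2} := by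
      intro x hx
      have h0 : 0 ≤ c * √n := by positivity
      have := pow_le_pow_left₀ h0 (le_of_lt hx) 2
      rwa [mul_pow, Real.sq_sqrt (by positivity), sq_abs] at this
    have hreal : m.real A ≤ (∫ x, g x ^ 2 ∂m) / (c ^ 2 * n) := by
      rw [le_div_iff₀ hnpos, mul_comm]
      exact (mul_le_mul_of_nonneg_left (measureReal_mono hsub) hnpos.le).trans hcheb
    rw [← ofReal_measureReal]
    exact ENNReal.ofReal_le_ofReal hreal
  have hunion : {x | ∃ k ≤ n, c * √n < |g (T^[k] x)|} ⊆
      ⋃ k ∈ Finset.range (n + 1), T^[k] ⁻¹' A := by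
    rintro x ⟨k, hk, hlt⟩
    exact Set.mem_biUnion (Finset.mem_coe.2 (Finset.mem_range.2 (by omega))) hlt
  calc _ ≤ ∑ k ∈ Finset.range (n + 1), m (T^[k] ⁻¹' A) :=
        (measure_mono hunion).trans (measure_biUnion_finset_le _ _)
    _ = ((n + 1 : ℕ) : ENNReal) * m A := by
        simp_rw [(hT.iterate _).measure_preimage hAm.nullMeasurableSet]
        simp
    _ ≤ ENNReal.ofReal (n + 1 : ℕ) * ENNReal.ofReal ((∫ x, g x ^ 2 ∂m) / (c ^ 2 * n)) := by
        rw [ENNReal.ofReal_natCast]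
        gcongr
    _ ≤ _ := by
        rw [← ENNReal.ofReal_mul (by positivity)]
        refine ENNReal.ofReal_le_ofReal ?_
        have hI : 0 ≤ ∫ x, g x ^ 2 ∂m := integral_nonneg fun x => sq_nonneg _
        rw [← mul_div_assoc, div_le_div_iff₀ hnpos (by positivity)]
        have : ((n + 1 : ℕ) : ℝ) ≤ 2 * n := by push_cast; linarith
        calc ((n + 1 : ℕ) : ℝ) * (∫ x, g x ^ 2 ∂m) * c ^ 2
            ≤ 2 * n * (∫ x, g x ^ 2 ∂m) * c ^ 2 := by gcongr
          _ = _ := by ring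

theorem exists_measure_lt_sup_abs_birkhoffSum_le (hh : IsReversedMartingaleDifference F m T h)
    {f g : X → ℝ} (hg : MemLp g 2 m) (hgm : Measurable g) (hf : f =ᵐ[m] h + g ∘ T - g)
    {ε : ℝ} (hε : 0 < ε) :
    ∃ c : ℝ, 0 < c ∧ ∀ (n : ℕ) (hn : 1 ≤ n),
      m {x | c < (Finset.Icc 1 n).sup' (Finset.nonempty_Icc.mpr hn)
        (fun k => |birkhoffSum T f k x|) / √n} ≤ ENNReal.ofReal ε := by
  have hI : 0 ≤ ∫ x, g x ^ 2 ∂m := integral_nonneg fun x => sq_nonneg _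
  set σ := √(∫ x, h x ^ 2 ∂m) with hσ
  have hσ0 : 0 ≤ σ := Real.sqrt_nonneg _
  set c : ℝ := (σ + 2 * ∫ x, g x ^ 2 ∂m) / ε + 1 with hc
  have hc1 : 1 ≤ c := by rw [hc, le_add_iff_nonneg_left]; positivity
  have hc0 : 0 < c := by linarith
  refine ⟨4 * c, by positivity, fun n hn => ?_⟩
  have hn0 : 0 < √(n : ℝ) := Real.sqrt_pos.2 (by exact_mod_cast hn)
  have hsub : {x | 4 * c < (Finset.Icc 1 n).sup' (Finset.nonempty_Icc.mpr hn)
      (fun k => |birkhoffSum T f k x|) / √n} ≤ᵐ[m]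
      ({x | ∃ k ≤ n, 2 * c * √n < |birkhoffSum T h k x|} ∪
        {x | ∃ k ≤ n, c * √n < |g (T^[k] x)|} : Set X) := by
    filter_upwards [ae_birkhoffSum_eq_of_ae_eq_add_coboundary hh.measurePreserving hf]
      with x hx hlt
    change 4 * c < _ at hlt
    rw [lt_div_iff₀ hn0, Finset.lt_sup'_iff] at hlt
    obtain ⟨k, hk, hlt⟩ := hlt
    have hk := (Finset.mem_Icc.1 hk).2
    rw [hx k] at hlt
    by_contra hcon
    have hcon' := not_or.1 hcon
    have h1 : |birkhoffSum T h k x| ≤ 2 * c * √n :=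
      not_lt.1 fun hl => hcon'.1 ⟨k, hk, hl⟩
    have h2 : |g (T^[k] x)| ≤ c * √n := not_lt.1 fun hl => hcon'.2 ⟨k, hk, hl⟩
    have h3 : |g x| ≤ c * √n := not_lt.1 fun hl => hcon'.2 ⟨0, Nat.zero_le _, hl⟩
    have h4 := abs_add_le (birkhoffSum T h k x) (g (T^[k] x) - g x)
    have h5 := abs_sub (g (T^[k] x)) (g x)
    linarith
  calc _ ≤ m ({x | ∃ k ≤ n, 2 * c * √n < |birkhoffSum T h k x|} ∪
        {x | ∃ k ≤ n, c * √n < |g (T^[k] x)|}) := measure_mono_ae hsub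
    _ ≤ ENNReal.ofReal (σ / c) + ENNReal.ofReal (2 * (∫ x, g x ^ 2 ∂m) / c ^ 2) :=
        (measure_union_le _ _).trans (add_le_add (hh.measure_exists_lt_abs_birkhoffSum_le hn hc0)
          (measure_exists_lt_abs_comp_iterate_le hh.measurePreserving hg hgm hn hc0))
    _ ≤ ENNReal.ofReal ε := by
        rw [← ENNReal.ofReal_add (by positivity) (by positivity)]
        refine ENNReal.ofReal_le_ofReal ?_
        have h1 : 2 * (∫ x, g x ^ 2 ∂m) / c ^ 2 ≤ 2 * (∫ x, g x ^ 2 ∂m) / c := by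
          gcongr
          nlinarith
        have h2 : (σ + 2 * ∫ x, g x ^ 2 ∂m) / c ≤ ε := by
          rw [div_le_iff₀ hc0, hc, mul_add, mul_div_cancel₀ _ hε.ne']
          linarith
        rw [add_div] at h2
        linarith

end TightMaxima

/-! ### Limit theorems for martingale-coboundary sums -/

section LimitTheorems

variable {X : Type*} {F : MeasurableSpace X} {mX : MeasurableSpace X} {m : Measure X}
  [IsProbabilityMeasure m] {T : X → X} {h f g : X → ℝ}

/-- A Borel–Cantelli argument: `∑ m {g² > δ n}` is finite for every `δ > 0`. -/
theorem ae_tendsto_comp_iterate_div_sqrt (hT : MeasurePreserving T m m)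
    (hg : MemLp g 2 m) (hgm : Measurable g) :
    ∀ᵐ x ∂m, Tendsto (fun n : ℕ => g (T^[n] x) / √n) atTop (𝓝 0) := by
  have hev : ∀ j : ℕ, ∀ᵐ x ∂m, ∀ᶠ n : ℕ in atTop,
      g (T^[n] x) ^ 2 / (1 / ((j : ℝ) + 1)) ^ 2 ≤ n := by
    intro j
    have hsum : ∑' n : ℕ, m {x | g x ^ 2 / (1 / ((j : ℝ) + 1)) ^ 2 ∈ Set.Ioi (n : ℝ)} < ⊤ :=
      @tsum_prob_mem_Ioi_lt_top X ⟨m⟩ _ (fun x => g x ^ 2 / (1 / ((j : ℝ) + 1)) ^ 2)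
        (hg.integrable_sq.div_const _) fun x => by positivity
    have hsum' : ∑' n : ℕ, m (T^[n] ⁻¹' {x | g x ^ 2 / (1 / ((j : ℝ) + 1)) ^ 2 ∈
        Set.Ioi (n : ℝ)}) ≠ ⊤ := by
      have hmeas (n : ℕ) :
          MeasurableSet {x | g x ^ 2 / (1 / ((j : ℝ) + 1)) ^ 2 ∈ Set.Ioi (n : ℝ)} :=
        measurableSet_lt measurable_const ((hgm.pow_const 2).div_const _)
      simp_rw [(hT.iterate _).measure_preimage (hmeas _).nullMeasurableSet]
      exact hsum.ne
    filter_upwards [ae_eventually_notMem hsum'] with x hx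
    filter_upwards [hx] with n hn
    exact not_lt.1 hn
  filter_upwards [ae_all_iff.2 hev] with x hx
  rw [Metric.tendsto_atTop]
  intro ε hε
  obtain ⟨j, hj⟩ := exists_nat_one_div_lt hε
  obtain ⟨N, hN⟩ := eventually_atTop.1 ((hx j).and (eventually_ge_atTop 1))
  refine ⟨N, fun n hn => ?_⟩
  obtain ⟨h1, h2⟩ := hN n hn
  have hn0 : 0 < √(n : ℝ) := Real.sqrt_pos.2 (by exact_mod_cast h2)
  have hδ : (0 : ℝ) < 1 / ((j : ℝ) + 1) := by positivity
  rw [div_le_iff₀ (by positivity)] at h1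
  rw [Real.dist_eq, sub_zero, abs_div, abs_of_pos hn0, div_lt_iff₀ hn0]
  have h3 : |g (T^[n] x)| ≤ 1 / ((j : ℝ) + 1) * √n := by
    refine abs_le_of_sq_le_sq ?_ (by positivity)
    rw [mul_pow, Real.sq_sqrt (by positivity)]
    linarith
  exact h3.trans_lt (mul_lt_mul_of_pos_right hj hn0)

theorem ae_tendsto_birkhoffSum_sub_div_sqrt (hT : MeasurePreserving T m m)
    (hg : MemLp g 2 m) (hgm : Measurable g) (hf : f =ᵐ[m] h + g ∘ T - g) :
    ∀ᵐ x ∂m, Tendsto (fun n : ℕ => birkhoffSum T f n x / √n - birkhoffSum T h n x / √n)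
      atTop (𝓝 0) := by
  filter_upwards [ae_tendsto_comp_iterate_div_sqrt hT hg hgm,
    ae_birkhoffSum_eq_of_ae_eq_add_coboundary hT hf] with x hx hx2
  have h1 : Tendsto (fun n : ℕ => g x / √n) atTop (𝓝 0) :=
    tendsto_const_nhds.div_atTop (Real.tendsto_sqrt_atTop.comp tendsto_natCast_atTop_atTop)
  have h2 := hx.sub h1
  rw [sub_zero] at h2
  refine h2.congr fun n => ?_
  rw [hx2 n]
  ring

theorem tendsto_cos_sub_cos {a b : ℕ → ℝ} (hab : Tendsto (fun n => a n - b n) atTop (𝓝 0))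
    (t θ : ℝ) :
    Tendsto (fun n => Real.cos (t * a n + θ) - Real.cos (t * b n + θ)) atTop (𝓝 0) := by
  have h1 : Tendsto (fun n => |t| * |a n - b n|) atTop (𝓝 0) := by
    simpa using hab.abs.const_mul |t|
  refine squeeze_zero_norm (fun n => ?_) h1
  rw [Real.norm_eq_abs, ← abs_mul]
  refine (Real.abs_cos_sub_cos_le _ _).trans (le_of_eq ?_)
  congr 1
  ring

/-- Almost every point is good for almost every frequency at once, by Fubini's theorem. -/
theorem IsReversedMartingaleDifference.ae_ae_tendsto_logAverage_cos
    (hh : IsReversedMartingaleDifference F m T h) (hT : Ergodic T m) (θ : ℝ) :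
    ∀ᵐ x ∂m, ∀ᵐ t : ℝ, Tendsto (fun N : ℕ => (∑ k ∈ Finset.Icc 1 N,
      (1 / (k : ℝ)) * Real.cos (t * (birkhoffSum T h k x / √k) + θ)) / Real.log N) atTop
      (𝓝 (Real.exp (-(t ^ 2 * (∫ x, h x ^ 2 ∂m) / 2)) * Real.cos θ)) := by
  have hcomm := Measure.ae_ae_comm (μ := m) (ν := (volume : Measure ℝ)) (p := fun x t =>
    Tendsto (fun N : ℕ => (∑ k ∈ Finset.Icc 1 N,
      (1 / (k : ℝ)) * Real.cos (t * (birkhoffSum T h k x / √k) + θ)) / Real.log N -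
      Real.exp (-(t ^ 2 * (∫ x, h x ^ 2 ∂m) / 2)) * Real.cos θ) atTop (𝓝 0)) (by
    refine measurableSet_tendsto (𝓝 0) fun N => ?_
    refine Measurable.sub (Measurable.div_const (Finset.measurable_sum _ fun k _ => ?_) _)
      (by fun_prop)
    have hS : Measurable fun z : X × ℝ => birkhoffSum T h k z.1 :=
      (hh.measurable_birkhoffSum k).comp measurable_fst
    fun_prop)
  have hmain : ∀ᵐ x ∂m, ∀ᵐ t : ℝ, Tendsto (fun N : ℕ => (∑ k ∈ Finset.Icc 1 N,
      (1 / (k : ℝ)) * Real.cos (t * (birkhoffSum T h k x / √k) + θ)) / Real.log N -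
      Real.exp (-(t ^ 2 * (∫ x, h x ^ 2 ∂m) / 2)) * Real.cos θ) atTop (𝓝 0) := by
    refine hcomm.2 (ae_of_all _ fun t => ?_)
    filter_upwards [hh.ae_tendsto_logAverage_cos hT t θ] with x hx
    have := hx.sub_const (Real.exp (-(t ^ 2 * (∫ x, h x ^ 2 ∂m) / 2)) * Real.cos θ)
    rw [sub_self] at this
    simpa only [mul_div_assoc] using this
  filter_upwards [hmain] with x hx
  filter_upwards [hx] with t ht
  exact tendsto_sub_nhds_zero_iff.1 ht

/-- The almost sure central limit theorem for the sum of a reversed martingale difference and of a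
coboundary. -/
theorem IsReversedMartingaleDifference.satisfiesASCLT
    (hh : IsReversedMartingaleDifference F m T h) (hT : Ergodic T m)
    (hg : MemLp g 2 m) (hgm : Measurable g) (hf : f =ᵐ[m] h + g ∘ T - g) :
    SatisfiesASCLT m (fun n => birkhoffSum T f n) (fun n => √n)
      (gaussianReal 0 (∫ x, h x ^ 2 ∂m).toNNReal) := by
  have hI : 0 ≤ ∫ x, h x ^ 2 ∂m := integral_nonneg fun x => sq_nonneg _
  filter_upwards [hh.ae_ae_tendsto_logAverage_cos hT 0,
    hh.ae_ae_tendsto_logAverage_cos hT (-(Real.pi / 2)),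
    ae_tendsto_birkhoffSum_sub_div_sqrt hh.measurePreserving hg hgm hf] with x h1 h2 h3
  refine tendsto_logEmpiricalMeasure_gaussianReal ?_
  filter_upwards [h1, h2] with t ht1 ht2
  rw [Real.coe_toNNReal _ hI]
  have key : ∀ θ : ℝ, Tendsto (fun N : ℕ => (∑ k ∈ Finset.Icc 1 N,
      (1 / (k : ℝ)) * Real.cos (t * (birkhoffSum T h k x / √k) + θ)) / Real.log N) atTop
      (𝓝 (Real.exp (-(t ^ 2 * (∫ x, h x ^ 2 ∂m) / 2)) * Real.cos θ)) →
      Tendsto (fun N : ℕ => (∑ k ∈ Finset.Icc 1 N,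
      (1 / (k : ℝ)) * Real.cos (t * (birkhoffSum T f k x / √k) + θ)) / Real.log N) atTop
      (𝓝 (Real.exp (-(t ^ 2 * (∫ x, h x ^ 2 ∂m) / 2)) * Real.cos θ)) := by
    intro θ hθ
    have := (tendsto_logAverage_of_tendsto_zero (tendsto_cos_sub_cos h3 t θ)).add hθ
    rw [zero_add] at this
    refine this.congr fun N => ?_
    rw [← add_div, ← Finset.sum_add_distrib]
    congr 1
    exact Finset.sum_congr rfl fun k _ => by ring
  rintro θ (rfl | hθ)
  · exact key 0 ht1
  · rw [Set.mem_singleton_iff.1 hθ]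
    exact key _ ht2

/-- The central limit theorem for the sum of a reversed martingale difference and of a
coboundary. -/
theorem IsReversedMartingaleDifference.tendstoInDistribution
    (hh : IsReversedMartingaleDifference F m T h) (hT : Ergodic T m)
    (hfL : MemLp f 2 m) (hg : MemLp g 2 m) (hgm : Measurable g) (hf : f =ᵐ[m] h + g ∘ T - g) :
    TendstoInDistribution (fun (n : ℕ) x => birkhoffSum T f n x / √n) atTop (id : ℝ → ℝ)
      (fun _ => m) (gaussianReal 0 (∫ x, h x ^ 2 ∂m).toNNReal) := by
  have hI : 0 ≤ ∫ x, h x ^ 2 ∂m := integral_nonneg fun x => sq_nonneg _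
  have hTm := hh.measurePreserving
  have hmeas (n : ℕ) : AEMeasurable (fun x => birkhoffSum T f n x / √n) m := by
    refine AEMeasurable.div_const ?_ _
    unfold birkhoffSum
    exact Finset.aemeasurable_fun_sum _ fun k _ =>
      (hfL.comp_measurePreserving (hTm.iterate k)).aestronglyMeasurable.aemeasurable
  have hmeas' (n : ℕ) : AEMeasurable (fun x => birkhoffSum T h n x / √n) m :=
    ((hh.measurable_birkhoffSum n).div_const _).aemeasurable
  have hbound (a : ℝ) : ‖Real.cos a‖ ≤ 1 := by
    rw [Real.norm_eq_abs]; exact Real.abs_cos_le_one _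
  have hint {u : X → ℝ} (hu : AEMeasurable u m) (t θ : ℝ) :
      Integrable (fun x => Real.cos (t * u x + θ)) m :=
    Integrable.of_bound (Real.measurable_cos.comp_aemeasurable
      ((hu.const_mul t).add_const θ)).aestronglyMeasurable 1 (ae_of_all _ fun x => hbound _)
  have hcos (t θ : ℝ) : Tendsto (fun n : ℕ => ∫ x, Real.cos (t * (birkhoffSum T f n x / √n) + θ) ∂m)
      atTop (𝓝 (Real.exp (-(t ^ 2 * (∫ x, h x ^ 2 ∂m) / 2)) * Real.cos θ)) := by
    have hdiff : Tendsto (fun n : ℕ => ∫ x, (Real.cos (t * (birkhoffSum T f n x / √n) + θ) -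
        Real.cos (t * (birkhoffSum T h n x / √n) + θ)) ∂m) atTop (𝓝 (∫ _, (0 : ℝ) ∂m)) := by
      refine tendsto_integral_of_dominated_convergence (fun _ => 2)
        (fun n => ((hint (hmeas n) t θ).sub (hint (hmeas' n) t θ)).aestronglyMeasurable)
        (integrable_const _) (fun n => ae_of_all _ fun x => ?_) ?_
      · exact (norm_sub_le _ _).trans
          ((add_le_add (hbound _) (hbound _)).trans_eq one_add_one_eq_two)
      · filter_upwards [ae_tendsto_birkhoffSum_sub_div_sqrt hTm hg hgm hf] with x hx
        exact tendsto_cos_sub_cos hx t θ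
    have h1 := hh.tendsto_integral_cos hT t θ
    simp only [mul_div_assoc] at h1
    have h2 := hdiff.add h1
    simp only [integral_zero, zero_add] at h2
    refine (by simpa only [mul_div_assoc] using h2 : Tendsto _ atTop _).congr fun n => ?_
    rw [integral_sub (hint (hmeas n) t θ) (hint (hmeas' n) t θ), sub_add_cancel]
  refine ⟨hmeas, aemeasurable_id, ProbabilityMeasure.tendsto_of_tendsto_charFun fun t => ?_⟩
  change Tendsto (fun n : ℕ => charFun (m.map fun x => birkhoffSum T f n x / √n) t) atTop
    (𝓝 (charFun ((gaussianReal 0 (∫ x, h x ^ 2 ∂m).toNNReal).map id) t))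
  have hchar : charFun ((gaussianReal 0 (∫ x, h x ^ 2 ∂m).toNNReal).map id) t =
      ((Real.exp (-(t ^ 2 * (∫ x, h x ^ 2 ∂m) / 2)) : ℝ) : ℂ) := by
    rw [Measure.map_id, charFun_gaussianReal, Real.coe_toNNReal _ hI]
    push_cast
    congr 1
    simp only [mul_zero, zero_mul, zero_sub]
    ring
  have h1 := hcos t 0
  have h2 := hcos t (-(Real.pi / 2))
  simp only [add_zero, Real.cos_zero, mul_one] at h1
  simp only [Real.cos_neg, Real.cos_pi_div_two, mul_zero] at h2
  have h3 := ((Complex.continuous_ofReal.tendsto _).comp h1).add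
    (((Complex.continuous_ofReal.tendsto _).comp h2).mul_const Complex.I)
  rw [Complex.ofReal_zero, zero_mul, add_zero, ← hchar] at h3
  refine h3.congr fun n => ?_
  have hi1 := hint (hmeas n) t 0
  have hi2 := hint (hmeas n) t (-(Real.pi / 2))
  simp only [add_zero] at hi1
  rw [charFun_apply_real, integral_map (hmeas n) (by fun_prop)]
  simp only [Function.comp_apply]
  rw [← integral_complex_ofReal, ← integral_complex_ofReal, ← integral_mul_const,
    ← integral_add hi1.ofReal (hi2.ofReal.mul_const _)]
  refine integral_congr_ae (ae_of_all _ fun x => ?_)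
  simp only [← sub_eq_add_neg, Real.cos_sub_pi_div_two]
  rw [← Complex.ofReal_mul, Complex.exp_mul_I, Complex.ofReal_cos, Complex.ofReal_sin]

end LimitTheorems

theorem mainTheorem4 {X : Type*} (F : MeasurableSpace X) [mX : MeasurableSpace X]
    (m : Measure X) [IsProbabilityMeasure m] (T : X → X) (hT : Ergodic T m)
    (hF : F ≤ mX) (hFT : F ≤ imageSigmaAlgebra mX T F)
    (f : X → ℝ) (hf : MemLp f 2 m) (hf0 : ∫ x, f x ∂m = 0)
    (hpos : ∑' n : ℕ, eLpNorm (m[f | imageSigmaAlgebra mX (T^[n]) F] - f) 2 m < ⊤)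
    (hneg : ∑' n : ℕ, eLpNorm (m[f | F.comap (T^[n])]) 2 m < ⊤) :
    ∃ v : NNReal,
      ConvergesWithTightMaxima m (fun n => birkhoffSum T f n) (fun n => Real.sqrt n)
        (gaussianReal 0 v) ∧
      SatisfiesASCLT m (fun n => birkhoffSum T f n) (fun n => Real.sqrt n)
        (gaussianReal 0 v) := by
  have hcomap : F.comap T ≤ F := MeasurableSpace.comap_le_iff_le_map.2 (hFT.trans inf_le_left)
  obtain ⟨h, g, hh, hgm, hg, hfg⟩ := exists_reversedMartingaleDifference_add_coboundary
    hT.toMeasurePreserving hF hcomap hf hpos.ne hneg.ne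
  exact ⟨(∫ x, h x ^ 2 ∂m).toNNReal,
    ⟨hh.tendstoInDistribution hT hf hg hgm hfg,
      fun _ hε => exists_measure_lt_sup_abs_birkhoffSum_le hh hg hgm hfg hε⟩,
    hh.satisfiesASCLT hT hg hgm hfg⟩
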